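/- **Setting.** Let $\mathbb{R}^p$ carry the Euclidean norm and $\mathbb{R}^q$ an arbitrary norm $\|\cdot\|$ with dual norm $\|\cdot\|_*$. Consider $$\min_{x\in\mathbb{R}^p}\ \psi(x):=\max_{y\in\mathbb{R}^q}[f(x,y)-r(y)]+g(x),$$ with $f:\mathbb{R}^p\times\mathbb{R}^q\to\mathbb{R}$ continuous and $r,g$ proper, closed and convex with values in $\mathbb{R}\cup\{+\infty\}$; put $\mathcal X=\mathrm{dom}\,g$, $\mathcal Y=\mathrm{dom}\,r$. $\partial$ is the Fréchet subdifferential. Let $d:\mathcal Y\to\mathbb{R}$ be a distance generating function: convex and continuous on $\mathcal Y$, and continuously differentiable (through a continuous selection $\nabla d$ of subgradients) and $1$-strongly convex with respect to $\|\cdot\|$ on $\mathcal Y^o=\{y\in\mathcal Y:\partial d(y)\ne\emptyset\}$. Let $V(y,y')=d(y)-d(y')-\langle\nabla d(y'),y-y'\rangle$ for $y\in\mathcal Y$, $y'\in\mathcal Y^o$. **Assumption 1.** $\rho>0$, $\mu\ge 0$. - For each $y\in\mathcal Y$, $f(\cdot,y)$ is $\rho$-weakly convex on $\mathcal X$: $f(x,y)\ge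 f(x',y)+\zeta^\top(x-x')-\frac{\rho}{2}\|x-x'\|_2^2$ for $x,x'\in\mathcal X$, $\zeta\in\partial_xf(x',y)$. For each $x\in\mathcal X$, $f(x,\cdot)$ is concave on $\mathcal Y$. - $r$ is $\mu$-strongly convex with respect to $V$: $r(y)\ge r(y')+\zeta^\top(y-y')+\mu V(y,y')$ for $y\in\mathcal Y$, $y'\in\mathcal Y^o$, $\zeta\in\partial r(y')$. - $\inf\psi>-\infty$. **Assumption 2.** There are measurable stochastic subgradients $g_x(x,y,\xi)$, $g_y(x,y,\xi)$ such that, for all $(x,y)\in\mathcal X\times\mathcal Y$, $\mathbb{E}g_x\in\partial_xf(x,y)$, $-\mathbb{E}g_y\in\partial_y[-f(x,y)]$, $\mathbb{E}\|g_x\|_2^2\le M_x^2$ and $\mathbb{E}\|g_y\|_*^2\le M_y^2$, with $M_x,M_y>0$. Moreover $\sup_{\mathcal X}g-\inf_{\mathcal X}g\le Q_g<\infty$ and $\sup_{\mathcal Y}r-\inf_{\mathcal Y}r\le Q_r<\infty$. One of the following cases holds. - *D1.* $\mu=0$, and there are $D_x,D_y>0$ with $\|x-x'\|_2\le D_x$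 on $\mathcal X$ and $2d(y)-2d(y')\le D_y^2$ on $\mathcal Y$. - *D2.* $\mu>0$ and $f(x,y)=\frac1n\sum_{i=1}^ny^\top c_i(x)$, where $y^\top c_i(x)$ is $\rho$-weakly convex in $x$ for every $y\in\mathcal Y$. With $c=\frac1n\sum_ic_i$, $\|c(x)-c(x')\|_*\le M_c\|x-x'\|_2$ on $\mathcal X$ for some $M_c>0$. Further, $\xi$ is uniform on $\{1,\dots,n\}$, $g_x(x,y,\xi)\in\partial_x[y^\top c_\xi(x)]$ and $g_y(x,y,\xi)=c_\xi(x)$. **Algorithm PG-SMD.** Let $\gamma=1/(2\rho)$ and start from $\bar x^{(0)}\in\mathcal X$. For $t=0,\dots,T-2$: - take $\bar y^{(t)}=\operatorname{argmin}d$ in case D1, and $\bar y^{(t)}=\operatorname{argmax}_yf(\bar x^{(t)},y)-r(y)$ in case D2; - take $(\eta_x,\eta_y,J)=\big(\frac{D_x}{M_x\sqrt J},\frac{D_y}{M_y\sqrt J},(t+2)^2\big)$ in case D1, and $\big(\frac{60}{\rho(J-30)},\frac{8M_c^2\gamma}{\mu^2J},t+32\big)$ in case D2; - starting at $(x^{(0)},y^{(0)})=(\bar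 x^{(t)},\bar y^{(t)})\in\mathcal X\times\mathcal Y^o$, for $j=0,\dots,J-2$ draw a fresh independent sample $\xi^{(j)}$, compute $g_x^{(j)},g_y^{(j)}$ at $(x^{(j)},y^{(j)},\xi^{(j)})$, and set $$x^{(j+1)}=\operatorname*{argmin}_x\ x^\top g_x^{(j)}+\tfrac1{2\eta_x}\|x-x^{(j)}\|_2^2+\tfrac1{2\gamma}\|x-\bar x^{(t)}\|_2^2+g(x),\qquad y^{(j+1)}=\operatorname*{argmin}_y\ -y^\top g_y^{(j)}+\tfrac1{\eta_y}V(y,y^{(j)})+r(y);$$ - set $\bar x^{(t+1)}=\frac1J\sum_{j=0}^{J-1}x^{(j)}$. The output is $\bar x^{(\tau)}$, with $\tau$ uniform on $\{0,\dots,T-1\}$ and independent of the samples. The complexity is the number of pairs $(g_x^{(j)},g_y^{(j)})$ computed; in case D2 each computation of $\bar y^{(t)}$ counts as $n$ further ones. **Theorem.** Let $\Delta$ satisfy $\psi(\bar x^{(0)})-\inf\psi\le\Delta$. There are constants $C,k$, depending only on $\rho,M_x,M_y,Q_g,Q_r,\Delta$ and on $D_x,D_y$ (case D1) or $\mu,M_c$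 (case D2), such that for each $\varepsilon\in(0,1]$ there is $T\ge1$, depending only on these parameters and $\varepsilon$, with $$T\le C\varepsilon^{-2}(1+\log\tfrac1\varepsilon)^k,$$ for which the following holds. The proximal point $x_\dagger=\operatorname{argmin}_z\{\psi(z)+\frac1{2\gamma}\|z-\bar x^{(\tau)}\|_2^2\}$ exists and is unique, and $$\mathbb{E}\big[\mathrm{Dist}(0,\partial\psi(x_\dagger))^2\big]\le\gamma^{-2}\,\mathbb{E}\|x_\dagger-\bar x^{(\tau)}\|_2^2\le\varepsilon^2 .$$ The total number of stochastic subgradients is at most $C\varepsilon^{-6}(1+\log\frac1\varepsilon)^k$ in case D1, and at most $C(n\varepsilon^{-2}+\varepsilon^{-4})(1+\log\frac1\varepsilon)^k$ in case D2. -/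

import Mathlib

open MeasureTheory ProbabilityTheory Topology

namespace WCC

noncomputable section

/-! ### Extended-valued functions and subdifferentials -/

/-- The effective domain of a function with values in `ℝ ∪ {+∞}`. -/
def effDom {V : Type*} (h : V → EReal) : Set V := {x | h x ≠ ⊤}

/-- The function equal to `d` on `S` and to `+∞` outside `S`. -/
def extendTop {V : Type*} (S : Set V) (d : V → ℝ) : V → EReal := by
  classical exact fun y => if y ∈ S then (d y : EReal) else ⊤

/-- The Fréchet subdifferential of `h` at a point `x` where `h` is finite: the functionals `ζ` with
`h z ≥ h x + ζ (z - x) + o(‖z - x‖)` as `z → x`. -/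
def frechetSubdiff {V : Type*} [NormedAddCommGroup V] [NormedSpace ℝ V]
    (h : V → EReal) (x : V) : Set (StrongDual ℝ V) :=
  {ζ | h x ≠ ⊤ ∧ h x ≠ ⊥ ∧ ∀ e : ℝ, 0 < e →
    ∀ᶠ z in 𝓝 x, (((h x).toReal + ζ (z - x) - e * ‖z - x‖ : ℝ) : EReal) ≤ h z}

/-- The Fréchet subdifferential on Euclidean space, as a set of vectors. -/
def euclSubdiff {p : ℕ} (h : EuclideanSpace ℝ (Fin p) → EReal) (x : EuclideanSpace ℝ (Fin p)) :
    Set (EuclideanSpace ℝ (Fin p)) :=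
  {ζ | innerSL ℝ ζ ∈ frechetSubdiff h x}

/-- Proper, closed (lower semicontinuous) and convex functions with values in `ℝ ∪ {+∞}`. -/
structure ProperClosedConvex {V : Type*} [NormedAddCommGroup V] [NormedSpace ℝ V]
    (h : V → EReal) : Prop where
  ne_bot : ∀ x, h x ≠ ⊥
  nonempty_dom : (effDom h).Nonempty
  closed : LowerSemicontinuous h
  convex : ConvexOn ℝ (effDom h) (fun x => (h x).toReal)

/-- `h` is `ρ`-weakly convex on `X`: each Fréchet subgradient of `h` at a point of `X` gives a
lower bound on `X` up to the quadratic term. -/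
def WeaklyConvexOn {p : ℕ} (ρ : ℝ) (X : Set (EuclideanSpace ℝ (Fin p)))
    (h : EuclideanSpace ℝ (Fin p) → ℝ) : Prop :=
  ∀ x ∈ X, ∀ x' ∈ X, ∀ ζ ∈ euclSubdiff (fun z => (h z : EReal)) x',
    h x' + inner ℝ ζ (x - x') - ρ / 2 * ‖x - x'‖ ^ 2 ≤ h x

/-! ### Distance generating functions and Bregman divergences -/

section Bregman

variable {F : Type*} [NormedAddCommGroup F] [NormedSpace ℝ F]

/-- The points of `Y` at which `d : Y → ℝ` has a subgradient. -/
def subdiffDom (Y : Set F) (d : F → ℝ) : Set F :=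
  {y | y ∈ Y ∧ (frechetSubdiff (extendTop Y d) y).Nonempty}

/-- The Bregman divergence `V(y, y') = d y - d y' - ⟨∇d(y'), y - y'⟩`. -/
def bregman (d : F → ℝ) (dGrad : F → StrongDual ℝ F) (y y' : F) : ℝ :=
  d y - d y' - dGrad y' (y - y')

/-- `d` is a distance generating function on `Y` for the norm of `F`. As `Y` may have an empty
interior (for instance a simplex), the gradient on `subdiffDom Y d` is a continuous choice of
subgradients; on `Y` it determines the Bregman divergence. -/
structure IsDGF (Y : Set F) (d : F → ℝ) (dGrad : F → StrongDual ℝ F) : Prop where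
  convex : ConvexOn ℝ Y d
  continuous : ContinuousOn d Y
  grad_mem : ∀ y ∈ subdiffDom Y d, dGrad y ∈ frechetSubdiff (extendTop Y d) y
  grad_continuous : ContinuousOn dGrad (subdiffDom Y d)
  strong : ∀ y ∈ subdiffDom Y d, ∀ y' ∈ subdiffDom Y d,
    d y' + dGrad y' (y - y') + 1 / 2 * ‖y - y'‖ ^ 2 ≤ d y

/-- `r` satisfies the `μ`-strong convexity inequality with respect to the Bregman divergence
of `d`. -/
def BregmanStrong (μ : ℝ) (r : F → EReal) (d : F → ℝ) (dGrad : F → StrongDual ℝ F) : Prop :=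
  ∀ y ∈ effDom r, ∀ y' ∈ subdiffDom (effDom r) d, ∀ ζ ∈ frechetSubdiff r y',
    (r y').toReal + ζ (y - y') + μ * bregman d dGrad y y' ≤ (r y).toReal

end Bregman

/-! ### The problem and its assumptions -/

/-- The data of a stochastic min-max problem
`min_x { ψ(x) = max_y [f(x, y) - r(y)] + g(x) }`, `x ∈ ℝ^p`, `y ∈ F`: the functions, the distance
generating function with its gradient, and the stochastic subgradients. The space `F` is `ℝ^q`
with an arbitrary norm, and its dual carries the dual norm. -/
structure Problem (p : ℕ) (F Ξ : Type*) [NormedAddCommGroup F] [NormedSpace ℝ F] where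
  f : EuclideanSpace ℝ (Fin p) → F → ℝ
  r : F → EReal
  g : EuclideanSpace ℝ (Fin p) → EReal
  d : F → ℝ
  dGrad : F → StrongDual ℝ F
  gx : EuclideanSpace ℝ (Fin p) → F → Ξ → EuclideanSpace ℝ (Fin p)
  gy : EuclideanSpace ℝ (Fin p) → F → Ξ → StrongDual ℝ F

section Setting

variable {p : ℕ} {F Ξ : Type*} [NormedAddCommGroup F] [NormedSpace ℝ F]

/-- `X = dom g`. -/
def Problem.X (P : Problem p F Ξ) : Set (EuclideanSpace ℝ (Fin p)) := effDom P.g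

/-- `Y = dom r`. -/
def Problem.Y (P : Problem p F Ξ) : Set F := effDom P.r

/-- The points of `Y` at which the distance generating function has a subgradient. -/
def Problem.Yo (P : Problem p F Ξ) : Set F := subdiffDom P.Y P.d

/-- The Bregman divergence `V_y`. -/
def Problem.V (P : Problem p F Ξ) (y y' : F) : ℝ := bregman P.d P.dGrad y y'

/-- The outer objective `ψ(x) = sup_y [f(x, y) - r(y)] + g(x)`. -/
def Problem.psi (P : Problem p F Ξ) (x : EuclideanSpace ℝ (Fin p)) : EReal :=
  (⨆ y, ((P.f x y : ℝ) : EReal) - P.r y) + P.g x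

/-- The weakly-convex-concave setting. -/
structure WeaklyConvexConcave (P : Problem p F Ξ) (ρ μ : ℝ) : Prop where
  f_continuous : Continuous (fun z : EuclideanSpace ℝ (Fin p) × F => P.f z.1 z.2)
  dgf : IsDGF P.Y P.d P.dGrad
  weaklyConvex : ∀ y ∈ P.Y, WeaklyConvexOn ρ P.X (fun x => P.f x y)
  concave : ∀ x ∈ P.X, ConcaveOn ℝ P.Y (P.f x)
  r_closed_convex : ProperClosedConvex P.r
  r_strong : BregmanStrong μ P.r P.d P.dGrad
  g_closed_convex : ProperClosedConvex P.g
  psi_bddBelow : ⊥ < ⨅ x, P.psi x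

/-- The stochastic subgradient oracle: unbiasedness, second moments bounded by `Mx ^ 2` and
`My ^ 2`, and oscillations of `g` on `X` and of `r` on `Y` at most `Qg` and `Qr`. -/
structure StochasticOracle [MeasurableSpace F] [MeasurableSpace Ξ] (P : Problem p F Ξ)
    (ν : Measure Ξ) (Mx My Qg Qr : ℝ) : Prop where
  gx_measurable :
    StronglyMeasurable (fun z : EuclideanSpace ℝ (Fin p) × F × Ξ => P.gx z.1 z.2.1 z.2.2)
  gy_measurable :
    StronglyMeasurable (fun z : EuclideanSpace ℝ (Fin p) × F × Ξ => P.gy z.1 z.2.1 z.2.2)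
  gx_mean : ∀ x ∈ P.X, ∀ y ∈ P.Y,
    (∫ s, P.gx x y s ∂ν) ∈ euclSubdiff (fun z => ((P.f z y : ℝ) : EReal)) x
  gy_mean : ∀ x ∈ P.X, ∀ y ∈ P.Y,
    -(∫ s, P.gy x y s ∂ν) ∈ frechetSubdiff (fun z => ((-P.f x z : ℝ) : EReal)) y
  gx_moment : ∀ x ∈ P.X, ∀ y ∈ P.Y, ∫⁻ s, ‖P.gx x y s‖ₑ ^ 2 ∂ν ≤ ENNReal.ofReal (Mx ^ 2)
  gy_moment : ∀ x ∈ P.X, ∀ y ∈ P.Y, ∫⁻ s, ‖P.gy x y s‖ₑ ^ 2 ∂ν ≤ ENNReal.ofReal (My ^ 2)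
  g_osc : ∀ x ∈ P.X, ∀ x' ∈ P.X, (P.g x).toReal - (P.g x').toReal ≤ Qg
  r_osc : ∀ y ∈ P.Y, ∀ y' ∈ P.Y, (P.r y).toReal - (P.r y').toReal ≤ Qr

/-- Case D1: the diameter of `X` is at most `Dx`, and
`2 (max d - min d)` over `Y` is at most `Dy ^ 2`. -/
structure CaseD1 (P : Problem p F Ξ) (Dx Dy : ℝ) : Prop where
  diam_X : ∀ x ∈ P.X, ∀ x' ∈ P.X, ‖x - x'‖ ≤ Dx
  range_d : ∀ y ∈ P.Y, ∀ y' ∈ P.Y, 2 * P.d y - 2 * P.d y' ≤ Dy ^ 2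

/-- Case D2, apart from `μ > 0` and the uniform law of the sample: `f` is the average of `n`
functions that are linear in `y`, given by `c i : ℝ^p → F*`, and the stochastic subgradients are
those of a single summand. -/
structure CaseD2 {n : ℕ} (P : Problem p F (Fin n)) (ρ Mc : ℝ)
    (c : Fin n → EuclideanSpace ℝ (Fin p) → StrongDual ℝ F) : Prop where
  f_eq : ∀ x y, P.f x y = 1 / (n : ℝ) * ∑ i, c i x y
  weaklyConvex : ∀ i, ∀ y ∈ P.Y, WeaklyConvexOn ρ P.X (fun x => c i x y)
  lipschitz : ∀ x ∈ P.X, ∀ x' ∈ P.X,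
    ‖(1 / (n : ℝ)) • ∑ i, c i x - (1 / (n : ℝ)) • ∑ i, c i x'‖ ≤ Mc * ‖x - x'‖
  gx_mem : ∀ x ∈ P.X, ∀ y ∈ P.Y, ∀ i,
    P.gx x y i ∈ euclSubdiff (fun z => ((c i z y : ℝ) : EReal)) x
  gy_eq : ∀ x ∈ P.X, ∀ y ∈ P.Y, ∀ i, P.gy x y i = c i x

/-! ### The algorithms, with a counter for the stochastic subgradients -/

/-- A state of either loop: the primal and dual points, and the number of stochastic
subgradients computed so far. -/
structure State (p : ℕ) (F : Type*) where
  x : EuclideanSpace ℝ (Fin p)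
  y : F
  calls : ℕ

/-- One iteration of stochastic mirror descent with the sample `s`, prox-center `xbar` and step
sizes `ηx`, `ηy`. It computes one stochastic subgradient. -/
structure SMDStep (P : Problem p F Ξ) (γ : ℝ) (xbar : EuclideanSpace ℝ (Fin p)) (ηx ηy : ℝ)
    (s : Ξ) (a b : State p F) : Prop where
  x_mem : b.x ∈ P.X
  x_min : IsMinOn (fun x => inner ℝ x (P.gx a.x a.y s) + 1 / (2 * ηx) * ‖x - a.x‖ ^ 2
    + 1 / (2 * γ) * ‖x - xbar‖ ^ 2 + (P.g x).toReal) P.X b.x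
  y_mem : b.y ∈ P.Y
  y_min : IsMinOn (fun y => -(P.gy a.x a.y s y) + 1 / ηy * P.V y a.y + (P.r y).toReal) P.Y b.y
  calls_eq : b.calls = a.calls + 1

/-- `SMD(xbar, ybar, ηx, ηy, J)` with the samples `s 0, …, s (J - 2)`, for the subproblem with
prox-center `xbar`, started with counter value `k`: it returns the average `xhat` of the iterates
`0, …, J - 1` and leaves the counter at `k'`. -/
def IsSMD (P : Problem p F Ξ) (γ : ℝ) (xbar : EuclideanSpace ℝ (Fin p)) (ybar : F) (ηx ηy : ℝ)
    (J : ℕ) (s : ℕ → Ξ) (k : ℕ) (xhat : EuclideanSpace ℝ (Fin p)) (k' : ℕ) : Prop :=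
  ybar ∈ P.Yo ∧ ∃ u : ℕ → State p F,
    u 0 = ⟨xbar, ybar, k⟩ ∧
    (∀ j, j + 2 ≤ J → SMDStep P γ xbar ηx ηy (s j) (u j) (u (j + 1))) ∧
    xhat = (1 / (J : ℝ)) • ∑ j ∈ Finset.range J, (u j).x ∧
    k' = (u (J - 1)).calls

/-- The proximally guided method run for `t = 0, …, T - 2` from `x0`. In state `t` the dual point is
the starting point of the `t`-th call of SMD, it satisfies `init`, and its computation
counts as `cost` stochastic subgradients; `s t j` is the `j`-th sample of the `t`-th call. -/
def IsPGSMD (P : Problem p F Ξ) (γ : ℝ) (init : EuclideanSpace ℝ (Fin p) → F → Prop) (cost : ℕ)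
    (ηx ηy : ℕ → ℝ) (J : ℕ → ℕ) (T : ℕ) (x0 : EuclideanSpace ℝ (Fin p)) (s : ℕ → ℕ → Ξ)
    (u : ℕ → State p F) : Prop :=
  (u 0).x = x0 ∧ (u 0).calls = 0 ∧
  ∀ t, t + 2 ≤ T → init (u t).x (u t).y ∧
    IsSMD P γ (u t).x (u t).y (ηx t) (ηy t) (J t) (s t) ((u t).calls + cost)
      (u (t + 1)).x (u (t + 1)).calls

/-- PG-SMD with the parameters of case D1: `j_t = (t + 2)^2`, `ηx = Dx / (Mx √j_t)`,
`ηy = Dy / (My √j_t)`, and the dual points minimize `d` over `Y`. -/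
def IsPGSMD1 (P : Problem p F Ξ) (γ Mx My Dx Dy : ℝ) (T : ℕ) (x0 : EuclideanSpace ℝ (Fin p))
    (s : ℕ → ℕ → Ξ) (u : ℕ → State p F) : Prop :=
  IsPGSMD P γ (fun _ y => y ∈ P.Y ∧ IsMinOn P.d P.Y y) 0
    (fun t => Dx / (Mx * √(((t + 2) ^ 2 : ℕ) : ℝ)))
    (fun t => Dy / (My * √(((t + 2) ^ 2 : ℕ) : ℝ)))
    (fun t => (t + 2) ^ 2) T x0 s u

/-- PG-SMD with the parameters of case D2: `j_t = t + 32`, `ηx = 60 / (ρ (j_t - 30))`,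
`ηy = 8 Mc² γ / (μ² j_t)`, and the dual points maximize `f(x, ·) - r` for the current `x`, at the
cost of `n` stochastic subgradients. -/
def IsPGSMD2 (P : Problem p F Ξ) (γ ρ μ Mc : ℝ) (n T : ℕ) (x0 : EuclideanSpace ℝ (Fin p))
    (s : ℕ → ℕ → Ξ) (u : ℕ → State p F) : Prop :=
  IsPGSMD P γ (fun x y => y ∈ P.Y ∧ IsMaxOn (fun z => P.f x z - (P.r z).toReal) P.Y y) n
    (fun t => 60 / (ρ * (((t + 32 : ℕ) : ℝ) - 30)))
    (fun t => 8 * Mc ^ 2 * γ / (μ ^ 2 * ((t + 32 : ℕ) : ℝ)))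
    (fun t => t + 32) T x0 s u

end Setting

/-- The randomness of PG-SMD: independent samples `ξ t j` of law `ν`, and an index `τ` that is
uniform on `{0, …, T - 1}` and independent of the samples. -/
structure IsSampling {Ω Ξ : Type*} [MeasurableSpace Ω] [MeasurableSpace Ξ] (Pr : Measure Ω)
    (ν : Measure Ξ) (T : ℕ) (ξ : ℕ → ℕ → Ω → Ξ) (τ : Ω → Fin T) : Prop where
  sample_measurable : ∀ t j, Measurable (ξ t j)
  sample_law : ∀ t j, Measure.map (ξ t j) Pr = ν
  sample_indep : iIndepFun (fun (i : ℕ × ℕ) => ξ i.1 i.2) Pr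
  index_measurable : Measurable τ
  index_law : ∀ i, Pr (τ ⁻¹' {i}) = (T : ENNReal)⁻¹
  index_indep : IndepFun τ (fun ω (i : ℕ × ℕ) => ξ i.1 i.2 ω) Pr

/-! ### Near stationarity -/

/-- `z` is a proximal point of `ψ` at `x`: a minimizer of `ψ + ‖· - x‖² / (2γ)`, with `ψ z` finite. -/
def IsProx {p : ℕ} (ψ : EuclideanSpace ℝ (Fin p) → EReal) (γ : ℝ)
    (x z : EuclideanSpace ℝ (Fin p)) : Prop :=
  ψ z ≠ ⊤ ∧ ψ z ≠ ⊥ ∧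
    ∀ w, ψ z + ((1 / (2 * γ) * ‖z - x‖ ^ 2 : ℝ) : EReal)
      ≤ ψ w + ((1 / (2 * γ) * ‖w - x‖ ^ 2 : ℝ) : EReal)

/-- The random point `xout` is nearly `ε`-stationary in mean square: its proximal point `xdag`
exists, is unique, and
`E[dist(0, ∂ψ(xdag))²] ≤ γ⁻² E‖xdag - xout‖² ≤ ε²`; the distance to an empty set is `+∞`. -/
def NearlyStationary {p : ℕ} {Ω : Type*} [MeasurableSpace Ω] (Pr : Measure Ω)
    (ψ : EuclideanSpace ℝ (Fin p) → EReal) (γ ε : ℝ)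
    (xout : Ω → EuclideanSpace ℝ (Fin p)) : Prop :=
  ∃ xdag : Ω → EuclideanSpace ℝ (Fin p),
    (∀ ω z, IsProx ψ γ (xout ω) z ↔ z = xdag ω) ∧
    ∫⁻ ω, Metric.infEDist 0 (euclSubdiff ψ (xdag ω)) ^ 2 ∂Pr
      ≤ ENNReal.ofReal (1 / γ ^ 2) * ∫⁻ ω, ‖xdag ω - xout ω‖ₑ ^ 2 ∂Pr ∧
    ENNReal.ofReal (1 / γ ^ 2) * ∫⁻ ω, ‖xdag ω - xout ω‖ₑ ^ 2 ∂Pr ≤ ENNReal.ofReal (ε ^ 2)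

end

end WCC

/-! Since 1/(2γ) = ρ, put φ(x) = min_z ψ(z) + ρ‖z - x‖², with minimizer x†. The function ψ +
(ρ/2)‖·‖² is convex, so x† is unique and continuous in x, and 2ρ(x - x†) is a Fréchet subgradient of
ψ at x†. It remains to make the average over t of A_t = E‖x†_t - x̄_t‖² of order ε². Testing φ at
the new center with the old proximal point gives φ(x̄_{t+1}) ≤ φ(x̄_t) - ρ‖x†_t - x̄_t‖² +
ρ‖x̄_{t+1} - x†_t‖². If every inner call satisfies E‖x̄_{t+1} - x†_t‖² ≤ θ A_t + δ_t with a fixed θ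
< 1 and δ_t = O(1/(t+2)), telescoping gives ∑ A_t = O(1 + log T), and T of order ε⁻²(1 + log(1/ε))
is enough (`sum_le_of_descent`, `nearlyStationary_of_contraction`, `exists_iterations`).

For the inner estimate, Sion's theorem provides y† such that (x†, y†) is a saddle point of f - r + g
+ ρ‖· - x̄‖², with growth (ρ/2)‖x - x†‖² in x (`exists_saddle`). The three-point inequalities of the
two proximal updates are added and averaged over the sample. The loss (ρ/2)‖x - x†‖² due to weak
convexity is paid by the growth at the saddle point, and the proximal term of the primal step leaves
a gain ρ‖x - x†‖² at the new iterate. Thus a nonnegative potential decreases in mean by this gain,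
up to a constant noise term (`lintegral_potential_step_le`); summation and Jensen's inequality bound
the averaged iterate.

In case D1 the diameters bound the initial potential, and the step sizes balance it against the
noise: the error is of order 1/√j_t = 1/(t+2). In case D2 the maximizers are Lipschitz in x, so the
initial V(y†, ȳ) is at most (2Mc²/μ²)‖x̄ - x†‖² and joins the contraction factor
(`dist_isMaxOn_le`); j_t of order t then suffices.

Two further points need care. The set Y may have empty interior, so first order conditions are
obtained by separation in the span of its directions, and the selected gradient is compared with
arbitrary subgradients (`subgradient_le_gradient`). Measurability of the iterates holds because both
proximal solution maps are Lipschitz in their linear data. -/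

namespace WCC

/-! ### Subgradients, relative interiors and a sum rule by separation. -/

section ConvexAnalysis

variable {F : Type*} [NormedAddCommGroup F] [NormedSpace ℝ F]

/-- A Fréchet subgradient of a function that agrees on the convex set `Y` with the convex function
`φ` is a subgradient of `φ` on `Y` in the sense of convex analysis. -/
theorem le_of_mem_frechetSubdiff {h : F → EReal} {φ : F → ℝ} {Y : Set F} (hφ : ConvexOn ℝ Y φ)
    (hh : ∀ y ∈ Y, h y = (φ y : EReal)) {y z : F} (hy : y ∈ Y) (hz : z ∈ Y)
    {ζ : StrongDual ℝ F} (hζ : ζ ∈ frechetSubdiff h y) : φ y + ζ (z - y) ≤ φ z := by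
  obtain ⟨-, -, hζ⟩ := hζ
  refine le_of_forall_pos_le_add fun e he => ?_
  have he' : 0 < e / (‖z - y‖ + 1) := by positivity
  have hlim : Filter.Tendsto (fun s : ℝ => y + s • (z - y)) (𝓝[>] 0) (𝓝 y) := by
    have : Continuous fun s : ℝ => y + s • (z - y) := by fun_prop
    simpa using (this.tendsto 0).mono_left nhdsWithin_le_nhds
  have h1 := hlim.eventually (hζ _ he')
  have h2 : ∀ᶠ s : ℝ in 𝓝[>] 0, s ∈ Set.Ioo (0 : ℝ) 1 := Ioo_mem_nhdsGT one_pos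
  obtain ⟨s, hs, hs0, hs1⟩ := (h1.and h2).exists
  have hmem : y + s • (z - y) ∈ Y := hφ.1.add_smul_sub_mem hy hz ⟨hs0.le, hs1.le⟩
  rw [hh _ hmem, hh _ hy, EReal.toReal_coe, EReal.coe_le_coe_iff] at hs
  have hc := hφ.2 hy hz (sub_nonneg.2 hs1.le) hs0.le (by ring)
  have : (1 - s) • y + s • z = y + s • (z - y) := by
    rw [sub_smul, smul_sub, one_smul]; abel
  rw [this] at hc
  simp only [add_sub_cancel_left, map_smul, smul_eq_mul, norm_smul, Real.norm_eq_abs,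
    abs_of_pos hs0] at hs hc
  have h3 : e / (‖z - y‖ + 1) * ‖z - y‖ ≤ e := by
    rw [div_mul_eq_mul_div, div_le_iff₀ (by positivity)]
    nlinarith [norm_nonneg (z - y)]
  have h4 : s * (φ y + ζ (z - y)) ≤ s * (φ z + e) := by nlinarith
  exact le_of_mul_le_mul_left h4 hs0

/-- A global affine minorant touching `h` at `y` is a Fréchet subgradient. -/
theorem mem_frechetSubdiff_of_le {h : F → EReal} {y : F} {φ : ℝ} (hy : h y = (φ : EReal))
    {ζ : StrongDual ℝ F} (hζ : ∀ z, h z ≠ ⊤ → ((φ + ζ (z - y) : ℝ) : EReal) ≤ h z) :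
    ζ ∈ frechetSubdiff h y := by
  refine ⟨by simp [hy], by simp [hy], fun e he => Filter.Eventually.of_forall fun z => ?_⟩
  by_cases hz : h z = ⊤
  · simp [hz]
  · refine le_trans ?_ (hζ z hz)
    rw [hy, EReal.toReal_coe, EReal.coe_le_coe_iff]
    have := mul_nonneg he.le (norm_nonneg (z - y))
    linarith

/-- The relative interior of a set, described by balls of its direction. -/
def relInterior (Y : Set F) : Set F :=
  {y | ∃ δ > 0, ∀ w ∈ vectorSpan ℝ Y, ‖w‖ < δ → y + w ∈ Y}

theorem relInterior_subset {Y : Set F} : relInterior Y ⊆ Y := by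
  rintro y ⟨δ, hδ, h⟩
  simpa using h 0 (Submodule.zero_mem _) (by simpa using hδ)

theorem relInterior_nonempty [FiniteDimensional ℝ F] {Y : Set F} (hY : Convex ℝ Y)
    (hne : Y.Nonempty) : (relInterior Y).Nonempty := by
  obtain ⟨x, hx⟩ := hne.intrinsicInterior hY
  obtain ⟨y, hy, rfl⟩ := mem_intrinsicInterior.1 hx
  rw [mem_interior_iff_mem_nhds, Metric.mem_nhds_iff] at hy
  obtain ⟨δ, hδ, h⟩ := hy
  refine ⟨y, δ, hδ, fun w hw hwδ => ?_⟩
  have hmem : (y : F) + w ∈ affineSpan ℝ Y := by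
    have := AffineSubspace.vadd_mem_of_mem_direction (s := affineSpan ℝ Y) (v := w)
      (by rwa [direction_affineSpan]) y.2
    simpa [add_comm] using this
  have := @h ⟨_, hmem⟩ (by simpa [Subtype.dist_eq] using hwδ)
  simpa using this

/-- The ball around `z`, shrunk towards `y` by the factor `s`, stays in `Y` by convexity. -/
theorem add_smul_sub_mem_relInterior {Y : Set F} (hY : Convex ℝ Y) {y z : F} (hy : y ∈ Y)
    (hz : z ∈ relInterior Y) {s : ℝ} (hs : 0 < s) (hs1 : s ≤ 1) :
    y + s • (z - y) ∈ relInterior Y := by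
  obtain ⟨δ, hδ, h⟩ := hz
  refine ⟨s * δ, by positivity, fun w hw hwδ => ?_⟩
  have h1 := h (s⁻¹ • w) (Submodule.smul_mem _ _ hw) (by
    rw [norm_smul, norm_inv, Real.norm_eq_abs, abs_of_pos hs, inv_mul_lt_iff₀ hs]; exact hwδ)
  have h2 := hY.add_smul_sub_mem hy h1 ⟨hs.le, hs1⟩
  have : y + s • (z - y) + w = y + s • (z + s⁻¹ • w - y) := by
    rw [add_sub_right_comm z, smul_add s (z - y), smul_smul, mul_inv_cancel₀ hs.ne', one_smul,
      add_assoc]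
  rwa [this]

theorem tendsto_add_smul_sub (y z : F) :
    Filter.Tendsto (fun s : ℝ => y + s • (z - y)) (𝓝[>] 0) (𝓝 y) := by
  have : Continuous fun s : ℝ => y + s • (z - y) := by fun_prop
  simpa using (this.tendsto 0).mono_left nhdsWithin_le_nhds

/-- Convex functions `d` on `Y` and `h` on `Z ⊆ Y` such that `d + h` is minimal at `y₀` have
opposite subgradients at `y₀`, provided that `Z` meets the relative interior of `Y`. -/
theorem exists_subgradient_of_isMinOn_add [FiniteDimensional ℝ F] {Y Z : Set F} {d h : F → ℝ}
    (hd : ConvexOn ℝ Y d) (hdc : ContinuousOn d Y) (hh : ConvexOn ℝ Z h) (hZY : Z ⊆ Y)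
    (hZ : (Z ∩ relInterior Y).Nonempty) {y₀ : F} (hy₀ : y₀ ∈ Z)
    (hmin : ∀ y ∈ Z, d y₀ + h y₀ ≤ d y + h y) :
    ∃ ζ : StrongDual ℝ F, (∀ y ∈ Y, d y₀ + ζ (y - y₀) ≤ d y) ∧
      ∀ y ∈ Z, h y₀ - ζ (y - y₀) ≤ h y := by
  classical
  -- Inside the space `W` of directions of `Y` the relative interior becomes the open set `R`, so
  -- that the open form of Hahn-Banach applies in `W × ℝ`.
  set W : Submodule ℝ F := vectorSpan ℝ Y with hW
  have hdir : ∀ y ∈ Y, y - y₀ ∈ W := fun y hy => vsub_mem_vectorSpan ℝ hy (hZY hy₀)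
  set R : Set W := {w | y₀ + w ∈ relInterior Y} with hR
  have hRopen : IsOpen R := by
    rw [Metric.isOpen_iff]
    rintro w ⟨δ, hδ, hw⟩
    refine ⟨δ / 2, by positivity, fun v hv => ⟨δ / 2, by positivity, fun u hu huδ => ?_⟩⟩
    have := hw ((v : F) - w + u) (W.add_mem (W.sub_mem v.2 w.2) hu) (by
      have h1 : ‖(v : F) - w‖ < δ / 2 := by
        have := Metric.mem_ball.1 hv
        rwa [Subtype.dist_eq, dist_eq_norm] at this
      calc ‖(v : F) - w + u‖ ≤ ‖(v : F) - w‖ + ‖u‖ := norm_add_le _ _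
        _ < δ := by linarith)
    convert this using 1
    abel
  have hRconv : Convex ℝ R := by
    intro w hw v hv a b ha hb hab
    rcases hb.eq_or_lt with rfl | hb'
    · have : a = 1 := by linarith
      subst this; simpa using hw
    · have h1 := add_smul_sub_mem_relInterior hd.1 (relInterior_subset hw) hv hb' (by linarith)
      have ha' : a = 1 - b := by linarith
      subst ha'
      change y₀ + (((1 - b) • w + b • v : W) : F) ∈ relInterior Y
      convert h1 using 1
      push_cast
      rw [sub_smul, one_smul]
      module
  have hcont : ContinuousOn (fun p : W × ℝ => p.2 - d (y₀ + p.1)) (R ×ˢ Set.univ) := by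
    refine continuousOn_snd.sub (hdc.comp (by fun_prop) ?_)
    rintro ⟨w, t⟩ ⟨hw, -⟩
    exact relInterior_subset hw
  -- `A` is the strict epigraph of `d` over the relative interior, and `B` below is the hypograph of
  -- `d y₀ + h y₀ - h` over `Z`. Minimality at `y₀` says that they are disjoint.
  set A : Set (W × ℝ) := (R ×ˢ Set.univ) ∩ (fun p : W × ℝ => p.2 - d (y₀ + p.1)) ⁻¹' Set.Ioi 0
  have hAopen : IsOpen A := hcont.isOpen_inter_preimage (hRopen.prod isOpen_univ) isOpen_Ioi
  have hcombo : ∀ (w v : W) (a b : ℝ), a + b = 1 →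
      y₀ + ((a • w + b • v : W) : F) = a • (y₀ + w) + b • (y₀ + v) := by
    intro w v a b hab
    have : a = 1 - b := by linarith
    subst this
    push_cast
    module
  have hAconv : Convex ℝ A := by
    rintro ⟨w, t⟩ ⟨⟨hw, -⟩, hwt⟩ ⟨v, u⟩ ⟨⟨hv, -⟩, hvu⟩ a b ha hb hab
    refine ⟨⟨hRconv hw hv ha hb hab, Set.mem_univ _⟩, ?_⟩
    simp only [Set.mem_preimage, Set.mem_Ioi, Prod.smul_mk, Prod.mk_add_mk, smul_eq_mul] at *
    have := hd.2 (relInterior_subset hw) (relInterior_subset hv) ha hb hab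
    rw [← hcombo w v a b hab] at this
    simp only [smul_eq_mul] at this
    rcases ha.eq_or_lt with rfl | ha'
    · have : b = 1 := by linarith
      subst this; simp at *; linarith
    · nlinarith
  set B : Set (W × ℝ) := {p | y₀ + p.1 ∈ Z ∧ p.2 ≤ d y₀ + h y₀ - h (y₀ + p.1)}
  have hBconv : Convex ℝ B := by
    rintro ⟨w, t⟩ ⟨hw, hwt⟩ ⟨v, u⟩ ⟨hv, hvu⟩ a b ha hb hab
    have h1 := hh.2 hw hv ha hb hab
    refine ⟨?_, ?_⟩
    · rw [Prod.smul_mk, Prod.smul_mk, Prod.mk_add_mk, hcombo w v a b hab]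
      exact hh.1 hw hv ha hb hab
    · simp only [Prod.smul_mk, Prod.mk_add_mk, smul_eq_mul] at *
      rw [hcombo w v a b hab]
      have h2 := mul_le_mul_of_nonneg_left hwt ha
      have h3 := mul_le_mul_of_nonneg_left hvu hb
      have h4 : (a + b) * (d y₀ + h y₀) = d y₀ + h y₀ := by rw [hab, one_mul]
      linarith
  have hdisj : Disjoint A B := by
    rw [Set.disjoint_left]
    rintro ⟨w, t⟩ ⟨-, hwt⟩ ⟨hw, hwt'⟩
    have := hmin _ hw
    simp only [Set.mem_preimage, Set.mem_Ioi] at hwt hwt'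
    linarith
  obtain ⟨φ, u, hA, hB⟩ := geometric_hahn_banach_open hAconv hAopen hBconv hdisj
  set l : StrongDual ℝ W := φ.comp (ContinuousLinearMap.inl ℝ W ℝ)
  set α : ℝ := φ (0, 1)
  have hφ : ∀ w t, φ (w, t) = l w + α * t := by
    intro w t
    have : (w, t) = (w, (0 : ℝ)) + t • ((0 : W), (1 : ℝ)) := by simp
    rw [this, map_add, map_smul, smul_eq_mul, mul_comm]
    rfl
  have hA' : ∀ w ∈ R, ∀ t, d (y₀ + w) < t → l w + α * t < u := fun w hw t ht => by
    rw [← hφ]; exact hA _ ⟨⟨hw, Set.mem_univ _⟩, by simpa using ht⟩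
  have hB' : ∀ w : W, y₀ + (w : F) ∈ Z → u ≤ l w + α * (d y₀ + h y₀ - h (y₀ + w)) :=
    fun w hw => by rw [← hφ]; exact hB _ ⟨hw, le_rfl⟩
  obtain ⟨z, hzZ, hzR⟩ := hZ
  have hzw : y₀ + ((⟨z - y₀, hdir z (hZY hzZ)⟩ : W) : F) = z := by simp
  set wz : W := ⟨z - y₀, hdir z (hZY hzZ)⟩
  -- The separating hyperplane is not vertical: over the common point `z` of `Z` and the relative
  -- interior, `A` has a point above one of `B`.
  have hα : α < 0 := by
    have h2 := hB' wz (by rwa [hzw])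
    have h1 := hA' wz (by rwa [hR, Set.mem_ofPred_eq, hzw]) (d z + 1) (by rw [hzw]; linarith)
    rw [hzw] at h2
    have h3 := hmin z hzZ
    by_contra hα
    have := mul_le_mul_of_nonneg_left (by linarith : d y₀ + h y₀ - h z ≤ d z + 1) (not_lt.1 hα)
    linarith
  have hAR : ∀ w ∈ R, l w + α * d (y₀ + w) ≤ u := by
    intro w hw
    by_contra! hlt
    have h1 := hA' w hw (d (y₀ + w) + (l w + α * d (y₀ + w) - u) / (-α))
      (lt_add_of_pos_right _ (div_pos (sub_pos.2 hlt) (by linarith)))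
    have h2 : α * ((l w + α * d (y₀ + w) - u) / (-α)) = -(l w + α * d (y₀ + w) - u) := by
      field_simp [hα.ne]
    linarith
  -- The inequality passes from the relative interior to all of `Y` by continuity of `d` along
  -- segments ending at `z`.
  have hA'' : ∀ w : W, y₀ + (w : F) ∈ Y → l w + α * d (y₀ + w) ≤ u := by
    intro w hw
    have hpath : ∀ s : ℝ, y₀ + ((w + s • (wz - w) : W) : F) = y₀ + w + s • (z - (y₀ + w)) := by
      intro s
      rw [← hzw]
      push_cast
      module
    have hlim := tendsto_add_smul_sub (y₀ + (w : F)) z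
    have hI : ∀ᶠ s : ℝ in 𝓝[>] 0, s ∈ Set.Ioo (0 : ℝ) 1 := Ioo_mem_nhdsGT one_pos
    have hRs : ∀ᶠ s : ℝ in 𝓝[>] 0, y₀ + w + s • (z - (y₀ + w)) ∈ relInterior Y :=
      hI.mono fun s hs => add_smul_sub_mem_relInterior hd.1 hw hzR hs.1 hs.2.le
    have hdlim := (hdc _ hw).tendsto.comp (tendsto_nhdsWithin_iff.2
      ⟨hlim, hRs.mono fun s hs => relInterior_subset hs⟩)
    have hllim := (l.continuous.tendsto w).comp (tendsto_add_smul_sub w wz)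
    refine le_of_tendsto (hllim.add (hdlim.const_mul α)) (hRs.mono fun s hs => ?_)
    have := hAR (w + s • (wz - w)) (by rwa [hR, Set.mem_ofPred_eq, hpath])
    rwa [hpath] at this
  have hu : u = α * d y₀ := by
    refine le_antisymm ?_ ?_
    · simpa using hB' 0 (by simpa using hy₀)
    · simpa using hA'' 0 (by simpa using hZY hy₀)
  -- Division by `-α` turns the hyperplane into a slope on `W`; any linear extension to `F` works,
  -- since only directions in `W` are tested.
  obtain ⟨ζ', hζ'⟩ := LinearMap.exists_extend ((-α)⁻¹ • (l : W →ₗ[ℝ] ℝ))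
  have hζ : ∀ w : W, ζ' w = (-α)⁻¹ * l w := fun w => by
    have := LinearMap.congr_fun hζ' w
    simpa using this
  refine ⟨LinearMap.toContinuousLinearMap ζ', fun y hy => ?_, fun y hy => ?_⟩
  · have h1 := hA'' ⟨y - y₀, hdir y hy⟩ (by simpa using hy)
    have h2 := hζ ⟨y - y₀, hdir y hy⟩
    simp only [add_sub_cancel] at h1 h2
    rw [LinearMap.coe_toContinuousLinearMap', h2, ← sub_nonneg]
    have h3 : d y - (d y₀ + (-α)⁻¹ * l ⟨y - y₀, hdir y hy⟩)
        = (-α)⁻¹ * (u - (l ⟨y - y₀, hdir y hy⟩ + α * d y)) := by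
      rw [hu]; field_simp [hα.ne]; ring
    rw [h3]
    exact mul_nonneg (inv_nonneg.2 (by linarith)) (by linarith)
  · have h1 := hB' ⟨y - y₀, hdir y (hZY hy)⟩ (by simpa using hy)
    have h2 := hζ ⟨y - y₀, hdir y (hZY hy)⟩
    simp only [add_sub_cancel] at h1 h2
    rw [LinearMap.coe_toContinuousLinearMap', h2, ← sub_nonneg]
    have h3 : h y - (h y₀ - (-α)⁻¹ * l ⟨y - y₀, hdir y (hZY hy)⟩)
        = (-α)⁻¹ * (l ⟨y - y₀, hdir y (hZY hy)⟩ + α * (d y₀ + h y₀ - h y) - u) := by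
      rw [hu]; field_simp [hα.ne]; ring
    rw [h3]
    exact mul_nonneg (inv_nonneg.2 (by linarith)) (by linarith)

end ConvexAnalysis

/-! ### Quadratically regularized minimization in Euclidean spaces. -/

section QuadraticProx

variable {E : Type*} [NormedAddCommGroup E] [InnerProductSpace ℝ E]

/-- The objective `h + κ‖·‖² - ⟨·, v⟩`. -/
def quadObj (h : E → ℝ) (κ : ℝ) (v x : E) : ℝ := h x + κ * ‖x‖ ^ 2 - inner ℝ x v

/-- The square of the norm has an exact defect of convexity along the segment from `z` to `x`.
Compare `z` with `z + s(x - z)`, divide by `s` and let `s → 0`. -/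
theorem quadObj_add_sq_le {X : Set E} {h : E → ℝ} (hh : ConvexOn ℝ X h) {κ : ℝ} {v z : E}
    (hz : z ∈ X) (hmin : IsMinOn (quadObj h κ v) X z) {x : E} (hx : x ∈ X) :
    quadObj h κ v z + κ * ‖x - z‖ ^ 2 ≤ quadObj h κ v x := by
  have key : ∀ s : ℝ, 0 < s → s < 1 →
      (1 - s) * (κ * ‖x - z‖ ^ 2) ≤ quadObj h κ v x - quadObj h κ v z := by
    intro s hs hs1
    have h1 := hmin (hh.1.add_smul_sub_mem hz hx ⟨hs.le, hs1.le⟩)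
    have h2 := hh.2 hz hx (sub_nonneg.2 hs1.le) hs.le (by ring)
    have h3 : (1 - s) • z + s • x = z + s • (x - z) := by module
    rw [h3] at h2
    simp only [Set.mem_ofPred_eq, quadObj, smul_eq_mul] at h1 h2 ⊢
    have h4 : ‖z + s • (x - z)‖ ^ 2
        = (1 - s) * ‖z‖ ^ 2 + s * ‖x‖ ^ 2 - s * (1 - s) * ‖x - z‖ ^ 2 := by
      simp only [← real_inner_self_eq_norm_sq, inner_add_left, inner_add_right, inner_sub_left,
        inner_sub_right, inner_smul_left, inner_smul_right, real_inner_comm x z]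
      simp
      ring
    have h5 : inner ℝ (z + s • (x - z)) v = (1 - s) * inner ℝ z v + s * inner ℝ x v := by
      simp only [inner_add_left, inner_sub_left, inner_smul_left]
      simp
      ring
    rw [h4, h5] at h1
    refine le_of_mul_le_mul_left ?_ hs
    linarith
  have hlim : Filter.Tendsto (fun s : ℝ => (1 - s) * (κ * ‖x - z‖ ^ 2)) (𝓝[>] 0)
      (𝓝 (κ * ‖x - z‖ ^ 2)) := by
    have : Continuous fun s : ℝ => (1 - s) * (κ * ‖x - z‖ ^ 2) := by fun_prop
    simpa using (this.tendsto 0).mono_left nhdsWithin_le_nhds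
  have hI : ∀ᶠ s : ℝ in 𝓝[>] 0, s ∈ Set.Ioo (0 : ℝ) 1 := Ioo_mem_nhdsGT one_pos
  have := le_of_tendsto hlim (hI.mono fun s hs => key s hs.1 hs.2)
  linarith

/-- Add the two growth inequalities, each tested at the other minimizer, and apply Cauchy-Schwarz.
-/
theorem dist_quadObj_minimizers_le {X : Set E} {h : E → ℝ} (hh : ConvexOn ℝ X h) {κ : ℝ}
    (hκ : 0 < κ) {v₁ v₂ z₁ z₂ : E} (hz₁ : z₁ ∈ X) (hmin₁ : IsMinOn (quadObj h κ v₁) X z₁)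
    (hz₂ : z₂ ∈ X) (hmin₂ : IsMinOn (quadObj h κ v₂) X z₂) :
    dist z₁ z₂ ≤ (2 * κ)⁻¹ * dist v₁ v₂ := by
  have h1 := quadObj_add_sq_le hh hz₁ hmin₁ hz₂
  have h2 := quadObj_add_sq_le hh hz₂ hmin₂ hz₁
  rw [norm_sub_rev] at h1
  have h3 : 2 * κ * ‖z₁ - z₂‖ ^ 2 ≤ inner ℝ (z₁ - z₂) (v₁ - v₂) := by
    simp only [quadObj, inner_sub_left, inner_sub_right] at *
    linarith
  have h4 := real_inner_le_norm (z₁ - z₂) (v₁ - v₂)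
  rw [dist_eq_norm, dist_eq_norm, inv_mul_eq_div, le_div_iff₀ (by positivity)]
  rcases (norm_nonneg (z₁ - z₂)).eq_or_lt with h0 | h0
  · rw [← h0]; simp
  · refine le_of_mul_le_mul_left ?_ h0
    linarith

theorem exists_isMinOn_quadObj [FiniteDimensional ℝ E] {X : Set E} (hX : IsClosed X)
    (hne : X.Nonempty) {h : E → ℝ} (hlsc : LowerSemicontinuousOn h X) {m : ℝ}
    (hm : ∀ x ∈ X, m ≤ h x) {κ : ℝ} (hκ : 0 < κ) (v : E) :
    ∃ z ∈ X, IsMinOn (quadObj h κ v) X z := by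
  obtain ⟨x₀, hx₀⟩ := hne
  have : ProperSpace E := FiniteDimensional.proper_real E
  -- Beyond this radius `κ‖x‖ > ‖v‖ + 1`, so the quadratic part exceeds `‖x‖`, which in turn exceeds
  -- the value at `x₀` minus `m`. Minimizing over the ball is therefore enough.
  set r : ℝ := max ‖x₀‖ (max ((‖v‖ + 1) / κ) (quadObj h κ v x₀ - m))
  set K := X ∩ Metric.closedBall (0 : E) r
  have hx₀K : x₀ ∈ K := ⟨hx₀, by simp [r]⟩
  have hobj : LowerSemicontinuousOn (quadObj h κ v) K := by
    have h1 : LowerSemicontinuousOn (fun x : E => h x + (κ * ‖x‖ ^ 2 - inner ℝ x v)) K :=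
      LowerSemicontinuousOn.add (hlsc.mono Set.inter_subset_left)
        (Continuous.continuousOn (by fun_prop)).lowerSemicontinuousOn
    convert h1 using 2 with x
    simp only [quadObj]; ring
  obtain ⟨z, hz, hzmin⟩ := hobj.exists_isMinOn ⟨x₀, hx₀K⟩
    ((isCompact_closedBall (0 : E) r).inter_left hX)
  refine ⟨z, hz.1, fun x hx => ?_⟩
  by_cases hxr : ‖x‖ ≤ r
  · exact hzmin ⟨hx, by simpa using hxr⟩
  · refine le_trans (isMinOn_iff.1 hzmin _ hx₀K) ?_
    push Not at hxr
    have h1 : (‖v‖ + 1) / κ < ‖x‖ :=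
      ((le_max_left _ _).trans (le_max_right _ _)).trans_lt hxr
    have h2 : quadObj h κ v x₀ - m < ‖x‖ :=
      ((le_max_right _ _).trans (le_max_right _ _)).trans_lt hxr
    rw [div_lt_iff₀ hκ] at h1
    have h3 := real_inner_le_norm x v
    have h4 := hm x hx
    change _ ≤ h x + κ * ‖x‖ ^ 2 - inner ℝ x v
    have h5 := mul_le_mul_of_nonneg_left h1.le (norm_nonneg x)
    nlinarith

/-- The minimizers of `h + κ‖·‖² - ⟨·, v⟩` on `X` form a continuous function of `v`. -/
theorem exists_continuous_quadObj_argmin [FiniteDimensional ℝ E] {X : Set E} (hX : IsClosed X)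
    (hne : X.Nonempty) {h : E → ℝ} (hh : ConvexOn ℝ X h) (hlsc : LowerSemicontinuousOn h X) {m : ℝ}
    (hm : ∀ x ∈ X, m ≤ h x) {κ : ℝ} (hκ : 0 < κ) :
    ∃ S : E → E, Continuous S ∧ ∀ v z, (z ∈ X ∧ IsMinOn (quadObj h κ v) X z) ↔ z = S v := by
  choose S hS hSmin using exists_isMinOn_quadObj hX hne hlsc hm hκ
  refine ⟨S, (LipschitzWith.of_dist_le_mul (K := ⟨(2 * κ)⁻¹, by positivity⟩) fun v w =>
    dist_quadObj_minimizers_le hh hκ (hS v) (hSmin v) (hS w) (hSmin w)).continuous, fun v z => ?_⟩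
  constructor
  · rintro ⟨hz, hzmin⟩
    have := dist_quadObj_minimizers_le hh hκ hz hzmin (hS v) (hSmin v)
    rw [dist_self, mul_zero] at this
    exact dist_le_zero.1 this
  · rintro rfl
    exact ⟨hS v, hSmin v⟩

end QuadraticProx

/-! ### Bregman divergences and the mirror proximal map. -/

section Mirror

variable {F : Type*} [NormedAddCommGroup F] [NormedSpace ℝ F]
  {Y : Set F} {d : F → ℝ} {dGrad : F → StrongDual ℝ F}

theorem mem_frechetSubdiff_extendTop_iff (hd : ConvexOn ℝ Y d) {y : F} (hy : y ∈ Y)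
    {ζ : StrongDual ℝ F} :
    ζ ∈ frechetSubdiff (extendTop Y d) y ↔ ∀ z ∈ Y, d y + ζ (z - y) ≤ d z := by
  have hcoe : ∀ z ∈ Y, extendTop Y d z = (d z : EReal) := fun z hz => by simp [extendTop, hz]
  refine ⟨fun h z hz => le_of_mem_frechetSubdiff hd hcoe hy hz h, fun h =>
    mem_frechetSubdiff_of_le (hcoe y hy) fun z hz => ?_⟩
  have hzY : z ∈ Y := by
    by_contra hzY
    simp [extendTop, hzY] at hz
  rw [hcoe z hzY, EReal.coe_le_coe_iff]
  exact h z hzY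

namespace IsDGF

variable (hd : IsDGF Y d dGrad)
include hd

theorem gradient_le {y y' : F} (hy : y ∈ Y) (hy' : y' ∈ subdiffDom Y d) :
    d y' + dGrad y' (y - y') ≤ d y :=
  (mem_frechetSubdiff_extendTop_iff hd.convex hy'.1).1 (hd.grad_mem y' hy') y hy

variable [FiniteDimensional ℝ F]

/-- This is the sum rule with `Z = {y}` and `h = 0`, for which minimality is trivial. -/
theorem relInterior_subset_subdiffDom : relInterior Y ⊆ subdiffDom Y d := by
  intro y hy
  have hyY := relInterior_subset hy
  obtain ⟨ζ, hζ, -⟩ := exists_subgradient_of_isMinOn_add (Z := {y}) (h := fun _ => 0) hd.convex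
    hd.continuous (convexOn_const 0 (convex_singleton y)) (by simpa using hyY) ⟨y, rfl, hy⟩
    (Set.mem_singleton y) (by simp)
  exact ⟨hyY, ζ, (mem_frechetSubdiff_extendTop_iff hd.convex hyY).2 hζ⟩

/-- Each point of `Y` is the limit, along a segment, of points of the relative interior. -/
theorem exists_approach (hne : Y.Nonempty) : ∃ z ∈ Y, ∀ y ∈ Y, (∀ᶠ s : ℝ in 𝓝[>] 0,
    y + s • (z - y) ∈ relInterior Y) ∧
    Filter.Tendsto (fun s : ℝ => y + s • (z - y)) (𝓝[>] 0) (𝓝[Y] y) := by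
  obtain ⟨z, hz⟩ := relInterior_nonempty hd.convex.1 hne
  have hI : ∀ᶠ s : ℝ in 𝓝[>] 0, s ∈ Set.Ioo (0 : ℝ) 1 := Ioo_mem_nhdsGT one_pos
  refine ⟨z, relInterior_subset hz, fun y hy => ?_⟩
  have hR : ∀ᶠ s : ℝ in 𝓝[>] 0, y + s • (z - y) ∈ relInterior Y :=
    hI.mono fun s hs => add_smul_sub_mem_relInterior hd.convex.1 hy hz hs.1 hs.2.le
  exact ⟨hR, tendsto_nhdsWithin_iff.2
    ⟨tendsto_add_smul_sub y z, hR.mono fun s hs => relInterior_subset hs⟩⟩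

/-- Strong convexity is assumed only between points having subgradients. Points of the relative
interior are of this kind and approach any `y` in `Y`, and both sides are continuous along the
approach. -/
theorem half_sq_le_bregman {y y' : F} (hy : y ∈ Y) (hy' : y' ∈ subdiffDom Y d) :
    1 / 2 * ‖y - y'‖ ^ 2 ≤ bregman d dGrad y y' := by
  obtain ⟨z, -, h⟩ := hd.exists_approach ⟨y, hy⟩
  obtain ⟨hR, hlim⟩ := h y hy
  have hlim' := hlim.mono_right nhdsWithin_le_nhds
  have hdlim := (hd.continuous y hy).tendsto.comp hlim
  have h1 : Filter.Tendsto (fun s : ℝ => 1 / 2 * ‖y + s • (z - y) - y'‖ ^ 2) (𝓝[>] 0)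
      (𝓝 (1 / 2 * ‖y - y'‖ ^ 2)) := (((hlim'.sub_const y').norm.pow 2).const_mul _)
  have h2 : Filter.Tendsto (fun s : ℝ => bregman d dGrad (y + s • (z - y)) y') (𝓝[>] 0)
      (𝓝 (bregman d dGrad y y')) :=
    (hdlim.sub_const _).sub (((dGrad y').continuous.tendsto _).comp (hlim'.sub_const y'))
  refine le_of_tendsto_of_tendsto h1 h2 (hR.mono fun s hs => ?_)
  have := hd.strong _ (hd.relInterior_subset_subdiffDom hs) y' hy'
  simp only [bregman]
  linarith

theorem bregman_nonneg {y y' : F} (hy : y ∈ Y) (hy' : y' ∈ subdiffDom Y d) :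
    0 ≤ bregman d dGrad y y' :=
  le_trans (by positivity) (hd.half_sq_le_bregman hy hy')

/-- The selected gradient is the largest subgradient in the directions that point into `Y`. -/
theorem subgradient_le_gradient {y y' : F} (hy : y ∈ Y) (hy' : y' ∈ subdiffDom Y d)
    {ζ : StrongDual ℝ F} (hζ : ∀ z ∈ Y, d y' + ζ (z - y') ≤ d z) :
    ζ (y - y') ≤ dGrad y' (y - y') := by
  have hrel : ∀ z ∈ relInterior Y, ζ (z - y') ≤ dGrad y' (z - y') := by
    intro z hz
    have hI : ∀ᶠ s : ℝ in 𝓝[>] 0, s ∈ Set.Ioo (0 : ℝ) 1 := Ioo_mem_nhdsGT one_pos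
    have hR : ∀ᶠ s : ℝ in 𝓝[>] 0, y' + s • (z - y') ∈ relInterior Y :=
      hI.mono fun s hs => add_smul_sub_mem_relInterior hd.convex.1 hy'.1 hz hs.1 hs.2.le
    have hlim := (hd.grad_continuous y' hy').tendsto.comp (tendsto_nhdsWithin_iff.2
      ⟨tendsto_add_smul_sub y' z, hR.mono fun s hs => hd.relInterior_subset_subdiffDom hs⟩)
    have hlim' : Filter.Tendsto (fun s : ℝ => dGrad (y' + s • (z - y')) (z - y')) (𝓝[>] 0)
        (𝓝 (dGrad y' (z - y'))) :=
      ((ContinuousLinearMap.apply ℝ ℝ (z - y')).continuous.tendsto _).comp hlim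
    refine ge_of_tendsto hlim' ((hI.and hR).mono fun s hs => ?_)
    obtain ⟨⟨hs0, hs1⟩, hsR⟩ := hs
    have h1 := hd.gradient_le hy'.1 (hd.relInterior_subset_subdiffDom hsR)
    have h2 := hζ _ (relInterior_subset hsR)
    have h3 : y' - (y' + s • (z - y')) = -(s • (z - y')) := by abel
    rw [h3] at h1
    simp only [add_sub_cancel_left, map_neg, map_smul, smul_eq_mul] at h1 h2
    refine le_of_mul_le_mul_left ?_ hs0
    linarith
  obtain ⟨z, -, h⟩ := hd.exists_approach ⟨y, hy⟩
  obtain ⟨hR, hlim⟩ := h y hy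
  have hlim' := (hlim.mono_right nhdsWithin_le_nhds).sub_const y'
  exact le_of_tendsto_of_tendsto ((ζ.continuous.tendsto _).comp hlim')
    (((dGrad y').continuous.tendsto _).comp hlim') (hR.mono fun s hs => hrel _ hs)

/-- First order conditions for the minimization of `d / η + q - ℓ` on `Y`. -/
theorem exists_subgradient_of_isMinOn {q : F → ℝ} (hq : ConvexOn ℝ Y q) {η : ℝ} (hη : 0 < η)
    {ℓ : StrongDual ℝ F} {z : F} (hz : z ∈ Y)
    (hmin : IsMinOn (fun y => 1 / η * d y + q y - ℓ y) Y z) :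
    z ∈ subdiffDom Y d ∧ ∃ ζ : StrongDual ℝ F, (∀ y ∈ Y, q z + ζ (y - z) ≤ q y) ∧
      ∀ y ∈ Y, ℓ (y - z) - 1 / η * dGrad z (y - z) ≤ ζ (y - z) := by
  obtain ⟨w, hw⟩ := relInterior_nonempty hd.convex.1 ⟨z, hz⟩
  have hconv : ConvexOn ℝ Y (fun y => η * (q y - ℓ y)) := by
    have h1 : ConvexOn ℝ Y (fun y => q y - ℓ y) := by
      have := hq.add ((-ℓ : F →ₗ[ℝ] ℝ).convexOn hq.1)
      refine this.congr fun y _ => ?_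
      simp [sub_eq_add_neg]
    exact h1.smul hη.le
  obtain ⟨ζ, hζd, hζq⟩ := exists_subgradient_of_isMinOn_add hd.convex hd.continuous hconv
    subset_rfl ⟨w, relInterior_subset hw, hw⟩ hz (fun y hy => by
      have h1 := mul_le_mul_of_nonneg_left (hmin hy) hη.le
      have h2 : ∀ y, η * (1 / η * d y + q y - ℓ y) = d y + η * (q y - ℓ y) := fun y => by
        field_simp
        ring
      simpa only [h2] using h1)
  have hzo : z ∈ subdiffDom Y d := ⟨hz, ζ, (mem_frechetSubdiff_extendTop_iff hd.convex hz).2 hζd⟩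
  -- What `ℓ` leaves after the subgradient `ζ` of `d` is a subgradient of `q`. As `ζ` is dominated
  -- by `dGrad z` in directions into `Y`, it may be replaced by `dGrad z` in the final inequality.
  refine ⟨hzo, ℓ - (1 / η) • ζ, fun y hy => ?_, fun y hy => ?_⟩
  · have h1 := hζq y hy
    simp only [sub_apply, smul_apply, smul_eq_mul]
    have h2 : η * (q z + (ℓ (y - z) - 1 / η * ζ (y - z))) ≤ η * q y := by
      have h3 : η * (q z + (ℓ (y - z) - 1 / η * ζ (y - z)))
        = η * (q z - ℓ z) - ζ (y - z) + η * ℓ y := by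
        rw [map_sub ℓ]; field_simp; ring
      linarith
    exact le_of_mul_le_mul_left h2 hη
  · have h1 := hd.subgradient_le_gradient hy hzo hζd
    simp only [sub_apply, smul_apply, smul_eq_mul]
    have := mul_le_mul_of_nonneg_left h1 (by positivity : 0 ≤ 1 / η)
    linarith

/-- The optimality conditions at the two points, tested at each other, meet the strong monotonicity
of `dGrad`, which is the sum of the two lower bounds on the Bregman divergences. -/
theorem dist_minimizers_le {q : F → ℝ} (hq : ConvexOn ℝ Y q) {η : ℝ} (hη : 0 < η)
    {ℓ₁ ℓ₂ : StrongDual ℝ F} {z₁ z₂ : F} (hz₁ : z₁ ∈ Y) (hz₂ : z₂ ∈ Y)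
    (hmin₁ : IsMinOn (fun y => 1 / η * d y + q y - ℓ₁ y) Y z₁)
    (hmin₂ : IsMinOn (fun y => 1 / η * d y + q y - ℓ₂ y) Y z₂) :
    dist z₁ z₂ ≤ η * dist ℓ₁ ℓ₂ := by
  obtain ⟨ho₁, ζ₁, hq₁, hζ₁⟩ := hd.exists_subgradient_of_isMinOn hq hη hz₁ hmin₁
  obtain ⟨ho₂, ζ₂, hq₂, hζ₂⟩ := hd.exists_subgradient_of_isMinOn hq hη hz₂ hmin₂
  have a1 := hq₁ z₂ hz₂
  have a2 := hq₂ z₁ hz₁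
  have b1 := hζ₁ z₂ hz₂
  have b2 := hζ₂ z₁ hz₁
  have c1 := hd.half_sq_le_bregman hz₁ ho₂
  have c2 := hd.half_sq_le_bregman hz₂ ho₁
  have hneg : z₂ - z₁ = -(z₁ - z₂) := by abel
  rw [norm_sub_rev] at c2
  simp only [bregman] at c1 c2
  rw [hneg, map_neg] at a1 b1 c2
  simp only [map_neg] at b1
  have e1 : ‖z₁ - z₂‖ ^ 2 ≤ dGrad z₁ (z₁ - z₂) - dGrad z₂ (z₁ - z₂) := by linarith
  have e2 : 1 / η * (dGrad z₁ (z₁ - z₂) - dGrad z₂ (z₁ - z₂)) ≤ (ℓ₁ - ℓ₂) (z₁ - z₂) := by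
    simp only [sub_apply]
    linarith
  have e3 : (ℓ₁ - ℓ₂) (z₁ - z₂) ≤ ‖ℓ₁ - ℓ₂‖ * ‖z₁ - z₂‖ :=
    (le_abs_self _).trans ((ℓ₁ - ℓ₂).le_opNorm _)
  have e4 : ‖z₁ - z₂‖ ^ 2 ≤ η * (‖ℓ₁ - ℓ₂‖ * ‖z₁ - z₂‖) := by
    have := mul_le_mul_of_nonneg_left (e2.trans e3) hη.le
    rw [← mul_assoc, mul_one_div_cancel hη.ne', one_mul] at this
    linarith
  rw [dist_eq_norm, dist_eq_norm]
  rcases (norm_nonneg (z₁ - z₂)).eq_or_lt with h0 | h0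
  · rw [← h0]; positivity
  · refine le_of_mul_le_mul_left ?_ h0
    linarith

/-- The minimizers of `d / η + q - ℓ` on a compact `Y` form a continuous function of `ℓ`. -/
theorem exists_continuous_argmin (hY : IsCompact Y) (hne : Y.Nonempty) {q : F → ℝ}
    (hq : ConvexOn ℝ Y q) (hlsc : LowerSemicontinuousOn q Y) {η : ℝ} (hη : 0 < η) :
    ∃ S : StrongDual ℝ F → F, Continuous S ∧ ∀ ℓ z,
      (z ∈ Y ∧ IsMinOn (fun y => 1 / η * d y + q y - ℓ y) Y z) ↔ z = S ℓ := by
  have hex : ∀ ℓ : StrongDual ℝ F, ∃ z ∈ Y,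
      IsMinOn (fun y => 1 / η * d y + q y - ℓ y) Y z := by
    intro ℓ
    refine LowerSemicontinuousOn.exists_isMinOn hne hY ?_
    have heq : (fun y => 1 / η * d y + q y - ℓ y) = fun y => q y + (1 / η * d y - ℓ y) := by
      funext y; ring
    rw [heq]
    exact hlsc.add (((hd.continuous.const_smul (1 / η)).sub
      ℓ.continuous.continuousOn).lowerSemicontinuousOn)
  choose S hS hSmin using hex
  refine ⟨S, (LipschitzWith.of_dist_le_mul (K := ⟨η, hη.le⟩) fun v w =>
    hd.dist_minimizers_le hq hη (hS v) (hS w) (hSmin v) (hSmin w)).continuous, fun v z => ?_⟩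
  constructor
  · rintro ⟨hz, hzmin⟩
    have := hd.dist_minimizers_le hq hη hz (hS v) hzmin (hSmin v)
    rw [dist_self, mul_zero] at this
    exact dist_le_zero.1 this
  · rintro rfl
    exact ⟨hS v, hSmin v⟩

end IsDGF

end Mirror

/-! ### Closed convex functions with values in `ℝ ∪ {+∞}`. -/

section ProperClosedConvex

variable {V : Type*} [NormedAddCommGroup V] [NormedSpace ℝ V] {h : V → EReal}

namespace ProperClosedConvex

variable (hh : ProperClosedConvex h)
include hh

theorem coe_toReal {x : V} (hx : x ∈ effDom h) : (((h x).toReal : ℝ) : EReal) = h x :=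
  EReal.coe_toReal hx (hh.ne_bot x)

theorem lowerSemicontinuousOn_toReal :
    LowerSemicontinuousOn (fun x => (h x).toReal) (effDom h) := by
  intro x hx c hc
  have h1 : (c : EReal) < h x := by
    rw [← hh.coe_toReal hx]; exact_mod_cast hc
  filter_upwards [(hh.closed x c h1).filter_mono nhdsWithin_le_nhds, self_mem_nhdsWithin]
    with z hz hzd
  rw [← hh.coe_toReal hzd] at hz
  exact_mod_cast hz

/-- Bounded oscillation makes the domain a sublevel set, and sublevel sets of lower semicontinuous
functions are closed. -/
theorem isClosed_effDom {Q : ℝ}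
    (hQ : ∀ x ∈ effDom h, ∀ x' ∈ effDom h, (h x).toReal - (h x').toReal ≤ Q) :
    IsClosed (effDom h) := by
  obtain ⟨x₀, hx₀⟩ := hh.nonempty_dom
  have : effDom h = h ⁻¹' Set.Iic (((h x₀).toReal + Q : ℝ) : EReal) := by
    ext x
    constructor
    · intro hx
      rw [Set.mem_preimage, Set.mem_Iic, ← hh.coe_toReal hx, EReal.coe_le_coe_iff]
      linarith [hQ x hx x₀ hx₀]
    · intro hx
      exact ne_top_of_le_ne_top (EReal.coe_ne_top _) hx
  rw [this]
  exact hh.closed.isClosed_preimage _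

end ProperClosedConvex

end ProperClosedConvex

/-- Weigh the subgradient inequalities at the convex combination, tested at the two endpoints: the
linear terms cancel. -/
theorem convexOn_of_forall_exists_subgradient {V : Type*} [AddCommGroup V] [Module ℝ V]
    {X : Set V} (hX : Convex ℝ X) {φ : V → ℝ}
    (hφ : ∀ x ∈ X, ∃ ζ : V →ₗ[ℝ] ℝ, ∀ z ∈ X, φ x + ζ (z - x) ≤ φ z) : ConvexOn ℝ X φ := by
  refine ⟨hX, fun x hx y hy a b ha hb hab => ?_⟩
  obtain ⟨ζ, hζ⟩ := hφ _ (hX hx hy ha hb hab)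
  have h1 := mul_le_mul_of_nonneg_left (hζ x hx) ha
  have h2 := mul_le_mul_of_nonneg_left (hζ y hy) hb
  have h3 : a * ζ (x - (a • x + b • y)) + b * ζ (y - (a • x + b • y)) = 0 := by
    rw [← smul_eq_mul, ← smul_eq_mul, ← map_smul, ← map_smul, ← map_add]
    have : a = 1 - b := by linarith
    subst this
    convert map_zero ζ using 2
    module
  have h4 : (a + b) * φ (a • x + b • y) = φ (a • x + b • y) := by rw [hab, one_mul]
  simp only [smul_eq_mul]
  linarith

theorem convexOn_quadObj {E : Type*} [NormedAddCommGroup E] [InnerProductSpace ℝ E] {X : Set E}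
    {h : E → ℝ} (hh : ConvexOn ℝ X h) {κ : ℝ} (hκ : 0 ≤ κ) (v : E) :
    ConvexOn ℝ X (quadObj h κ v) := by
  have h1 : ConvexOn ℝ X fun x : E => κ * ‖x‖ ^ 2 :=
    ((convexOn_univ_norm.pow (fun _ _ => norm_nonneg _) 2).smul hκ).subset (Set.subset_univ _) hh.1
  have h2 := (hh.add h1).add ((-(innerSL ℝ v) : E →ₗ[ℝ] ℝ).convexOn hh.1)
  refine h2.congr fun x _ => ?_
  simp [quadObj, real_inner_comm x v, sub_eq_add_neg]

/-! ### The outer objective, its proximal points and the saddle point. -/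

section Setting

variable {p : ℕ} {F Ξ : Type*} [NormedAddCommGroup F] [NormedSpace ℝ F]

local notation "𝔼" => EuclideanSpace ℝ (Fin p)

namespace Problem

/-- The outer objective as a real function, on `X`. -/
noncomputable def psiR (P : Problem p F Ξ) (x : 𝔼) : ℝ := (P.psi x).toReal

/-- The regularized saddle function `f(x, y) - r(y) + g(x) + ρ ‖x - xbar‖²`. -/
noncomputable def saddle (P : Problem p F Ξ) (ρ : ℝ) (xbar x : 𝔼) (y : F) : ℝ :=
  P.f x y - (P.r y).toReal + ((P.g x).toReal + ρ * ‖x - xbar‖ ^ 2)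

end Problem

namespace WeaklyConvexConcave

variable {P : Problem p F Ξ} {ρ μ : ℝ} (hW : WeaklyConvexConcave P ρ μ)

include hW

theorem f_continuous_left (y : F) : Continuous fun x => P.f x y :=
  hW.f_continuous.comp (Continuous.prodMk_left y)

theorem f_continuous_right (x : 𝔼) : Continuous (P.f x) :=
  hW.f_continuous.comp (Continuous.prodMk_right x)

theorem convex_X : Convex ℝ P.X := hW.g_closed_convex.convex.1

theorem convex_Y : Convex ℝ P.Y := hW.dgf.convex.1

theorem Y_nonempty : P.Y.Nonempty := hW.r_closed_convex.nonempty_dom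

theorem X_nonempty : P.X.Nonempty := hW.g_closed_convex.nonempty_dom

/-- Weak convexity speaks only of existing subgradients. The hypothesis `hsub`, which the means of
the oracle will supply, makes them exist everywhere on `X`, and adding the quadratic turns them into
convex subgradients. -/
theorem convexOn_f_add_sq
    (hsub : ∀ x ∈ P.X, ∀ y ∈ P.Y, (euclSubdiff (fun z => ((P.f z y : ℝ) : EReal)) x).Nonempty)
    {y : F} (hy : y ∈ P.Y) : ConvexOn ℝ P.X fun x => P.f x y + ρ / 2 * ‖x‖ ^ 2 := by
  refine convexOn_of_forall_exists_subgradient hW.convex_X fun x hx => ?_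
  obtain ⟨ζ, hζ⟩ := hsub x hx y hy
  refine ⟨(innerSL ℝ (ζ + ρ • x) : 𝔼 →ₗ[ℝ] ℝ), fun z hz => ?_⟩
  have h1 := hW.weaklyConvex y hy z hz x hx ζ hζ
  have h2 : ‖z - x‖ ^ 2 = ‖z‖ ^ 2 - 2 * inner ℝ x z + ‖x‖ ^ 2 := by
    rw [norm_sub_sq_real, real_inner_comm]
  have h3 : inner ℝ (ζ + ρ • x) (z - x)
      = inner ℝ ζ (z - x) + ρ * (inner ℝ x z - ‖x‖ ^ 2) := by
    rw [inner_add_left, inner_smul_left, inner_sub_right x, real_inner_self_eq_norm_sq]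
    simp
  simp only [ContinuousLinearMap.coe_coe, innerSL_apply_apply, h3]
  rw [h2] at h1
  linarith

theorem psi_eq_top {x : 𝔼} (hx : x ∉ P.X) : P.psi x = ⊤ := by
  have hg : P.g x = ⊤ := by simpa [Problem.X, effDom] using hx
  obtain ⟨y, hy⟩ := hW.Y_nonempty
  have h1 : ((P.f x y : ℝ) : EReal) - P.r y ≠ ⊥ := by
    rw [← hW.r_closed_convex.coe_toReal hy, ← EReal.coe_sub]
    exact EReal.coe_ne_bot _
  have h2 : (⨆ y, ((P.f x y : ℝ) : EReal) - P.r y) ≠ ⊥ := fun h =>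
    h1 (le_bot_iff.1 (h ▸ le_iSup (fun y => ((P.f x y : ℝ) : EReal) - P.r y) y))
  rw [Problem.psi, hg, EReal.add_top_of_ne_bot h2]

variable (hY : IsCompact P.Y)
include hY

theorem exists_isMaxOn (x : 𝔼) :
    ∃ y ∈ P.Y, ∀ z ∈ P.Y, P.f x z - (P.r z).toReal ≤ P.f x y - (P.r y).toReal := by
  have h1 : LowerSemicontinuousOn (fun y => (P.r y).toReal + -P.f x y) P.Y :=
    hW.r_closed_convex.lowerSemicontinuousOn_toReal.add
      (hW.f_continuous_right x).neg.continuousOn.lowerSemicontinuousOn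
  obtain ⟨y, hy, hmin⟩ := h1.exists_isMinOn hW.Y_nonempty hY
  exact ⟨y, hy, fun z hz => by linarith [isMinOn_iff.1 hmin z hz]⟩

theorem exists_psi_eq {x : 𝔼} (hx : x ∈ P.X) :
    P.psi x = ((P.psiR x : ℝ) : EReal) ∧
    (∃ y ∈ P.Y, P.psiR x = P.f x y - (P.r y).toReal + (P.g x).toReal) ∧
    ∀ y ∈ P.Y, P.f x y - (P.r y).toReal + (P.g x).toReal ≤ P.psiR x := by
  obtain ⟨y, hy, hmax⟩ := hW.exists_isMaxOn hY x
  have h1 : (⨆ y, ((P.f x y : ℝ) : EReal) - P.r y)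
      = ((P.f x y - (P.r y).toReal : ℝ) : EReal) := by
    refine le_antisymm (iSup_le fun z => ?_) ?_
    · by_cases hz : z ∈ P.Y
      · rw [← hW.r_closed_convex.coe_toReal hz, ← EReal.coe_sub, EReal.coe_le_coe_iff]
        exact hmax z hz
      · have : P.r z = ⊤ := by simpa [Problem.Y, effDom] using hz
        rw [this, EReal.sub_top]
        exact bot_le
    · rw [EReal.coe_sub, hW.r_closed_convex.coe_toReal hy]
      exact le_iSup (fun y => ((P.f x y : ℝ) : EReal) - P.r y) y
  have h2 : P.psi x = ((P.f x y - (P.r y).toReal + (P.g x).toReal : ℝ) : EReal) := by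
    rw [Problem.psi, h1, EReal.coe_add, hW.g_closed_convex.coe_toReal hx]
  have h3 : P.psiR x = P.f x y - (P.r y).toReal + (P.g x).toReal := by
    rw [Problem.psiR, h2, EReal.toReal_coe]
  exact ⟨by rw [h2, h3], ⟨y, hy, h3⟩, fun z hz => by rw [h3]; linarith [hmax z hz]⟩

/-- Fix the maximizing `y` at the convex combination; for this `y` the regularized function is
convex in `x`, and it is at most the objective at both endpoints. -/
theorem convexOn_psiR_add_sq
    (hsub : ∀ x ∈ P.X, ∀ y ∈ P.Y, (euclSubdiff (fun z => ((P.f z y : ℝ) : EReal)) x).Nonempty) :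
    ConvexOn ℝ P.X fun x => P.psiR x + ρ / 2 * ‖x‖ ^ 2 := by
  refine ⟨hW.convex_X, fun x hx x' hx' a b ha hb hab => ?_⟩
  have hmem := hW.convex_X hx hx' ha hb hab
  obtain ⟨-, ⟨y, hy, heq⟩, -⟩ := hW.exists_psi_eq hY hmem
  have h1 := (hW.convexOn_f_add_sq hsub hy).2 hx hx' ha hb hab
  have h2 := hW.g_closed_convex.convex.2 hx hx' ha hb hab
  have h3 := mul_le_mul_of_nonneg_left ((hW.exists_psi_eq hY hx).2.2 y hy) ha
  have h4 := mul_le_mul_of_nonneg_left ((hW.exists_psi_eq hY hx').2.2 y hy) hb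
  have h5 : (a + b) * (P.r y).toReal = (P.r y).toReal := by rw [hab, one_mul]
  simp only [smul_eq_mul] at *
  rw [heq]
  linarith

theorem lowerSemicontinuousOn_psiR : LowerSemicontinuousOn P.psiR P.X := by
  intro x hx c hc
  obtain ⟨-, ⟨y, hy, heq⟩, -⟩ := hW.exists_psi_eq hY hx
  have h1 : LowerSemicontinuousOn (fun x => (P.f x y - (P.r y).toReal) + (P.g x).toReal) P.X :=
    ((hW.f_continuous_left y).sub continuous_const).continuousOn.lowerSemicontinuousOn.add
      hW.g_closed_convex.lowerSemicontinuousOn_toReal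
  filter_upwards [h1 x hx c (lt_of_lt_of_eq hc heq), self_mem_nhdsWithin] with z hz hzX
  exact lt_of_lt_of_le hz ((hW.exists_psi_eq hY hzX).2.2 y hy)

theorem exists_iInf_psi_eq : ∃ m : ℝ, (⨅ x, P.psi x) = (m : EReal) ∧ ∀ x ∈ P.X, m ≤ P.psiR x := by
  obtain ⟨x₀, hx₀⟩ := hW.X_nonempty
  have htop : (⨅ x, P.psi x) ≠ ⊤ := by
    refine ne_top_of_le_ne_top ?_ (iInf_le _ x₀)
    rw [(hW.exists_psi_eq hY hx₀).1]
    exact EReal.coe_ne_top _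
  have hcoe := EReal.coe_toReal htop hW.psi_bddBelow.ne'
  refine ⟨_, hcoe.symm, fun x hx => ?_⟩
  rw [← EReal.coe_le_coe_iff, hcoe, ← (hW.exists_psi_eq hY hx).1]
  exact iInf_le _ x

theorem exists_prox (hρ : 0 < ρ) (hX : IsClosed P.X)
    (hsub : ∀ x ∈ P.X, ∀ y ∈ P.Y, (euclSubdiff (fun z => ((P.f z y : ℝ) : EReal)) x).Nonempty) :
    ∃ prox : 𝔼 → 𝔼, Continuous prox ∧
      (∀ x z, IsProx P.psi (1 / (2 * ρ)) x z ↔ z = prox x) ∧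
      (∀ x, prox x ∈ P.X) ∧
      ∀ x, ∀ z ∈ P.X, P.psiR (prox x) + ρ * ‖prox x - x‖ ^ 2 ≤ P.psiR z + ρ * ‖z - x‖ ^ 2 := by
  obtain ⟨m, -, hm⟩ := hW.exists_iInf_psi_eq hY
  obtain ⟨S, hS, hSmin⟩ := exists_continuous_quadObj_argmin hX hW.X_nonempty
    (hW.convexOn_psiR_add_sq hY hsub)
    ((hW.lowerSemicontinuousOn_psiR hY).add
      (Continuous.continuousOn (by fun_prop)).lowerSemicontinuousOn)
    (m := m) (fun x hx => (hm x hx).trans (le_add_of_nonneg_right (by positivity)))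
    (half_pos hρ)
  -- Half of `ρ‖z - x‖²` convexifies the objective, and the other half provides the modulus `κ = ρ /
  -- 2`.
  have hquad : ∀ x z : 𝔼, quadObj (fun x => P.psiR x + ρ / 2 * ‖x‖ ^ 2) (ρ / 2) ((2 * ρ) • x) z
      = P.psiR z + ρ * ‖z - x‖ ^ 2 - ρ * ‖x‖ ^ 2 := by
    intro x z
    rw [quadObj, inner_smul_right, norm_sub_sq_real]
    ring
  have hmin : ∀ x z : 𝔼, (z ∈ P.X ∧ ∀ w ∈ P.X,
      P.psiR z + ρ * ‖z - x‖ ^ 2 ≤ P.psiR w + ρ * ‖w - x‖ ^ 2) ↔ z = S ((2 * ρ) • x) := by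
    intro x z
    rw [← hSmin, isMinOn_iff]
    simp only [hquad, sub_le_sub_iff_right]
  have hγ : 1 / (2 * (1 / (2 * ρ))) = ρ := by field_simp
  refine ⟨fun x => S ((2 * ρ) • x), by fun_prop, fun x z => ?_, fun x => ((hmin x _).2 rfl).1,
    fun x => ((hmin x _).2 rfl).2⟩
  rw [← hmin, IsProx, hγ]
  constructor
  · rintro ⟨htop, -, hle⟩
    have hz : z ∈ P.X := by
      by_contra hz
      exact htop (hW.psi_eq_top hz)
    refine ⟨hz, fun w hw => ?_⟩
    have := hle w
    rw [(hW.exists_psi_eq hY hz).1, (hW.exists_psi_eq hY hw).1] at this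
    exact_mod_cast this
  · rintro ⟨hz, hle⟩
    rw [(hW.exists_psi_eq hY hz).1]
    refine ⟨EReal.coe_ne_top _, EReal.coe_ne_bot _, fun w => ?_⟩
    by_cases hw : w ∈ P.X
    · rw [(hW.exists_psi_eq hY hw).1]
      exact_mod_cast hle w hw
    · rw [hW.psi_eq_top hw, EReal.top_add_coe]
      exact le_top

/-- Expanding the minimality of `z` shows that `2ρ(x - z)` is a subgradient up to the error `ρ‖w -
z‖²`, which is `o(‖w - z‖)`. -/
theorem infEDist_euclSubdiff_le {x z : 𝔼} (hz : z ∈ P.X) (hρ : 0 < ρ)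
    (hmin : ∀ w ∈ P.X, P.psiR z + ρ * ‖z - x‖ ^ 2 ≤ P.psiR w + ρ * ‖w - x‖ ^ 2) :
    Metric.infEDist 0 (euclSubdiff P.psi z) ≤ ENNReal.ofReal (2 * ρ) * ‖z - x‖ₑ := by
  have hmem : (2 * ρ) • (x - z) ∈ euclSubdiff P.psi z := by
    have hψz := (hW.exists_psi_eq hY hz).1
    refine ⟨by simp [hψz], by simp [hψz], fun e he => ?_⟩
    have hball : Metric.ball z (e / ρ) ∈ 𝓝 z := Metric.ball_mem_nhds z (by positivity)
    filter_upwards [hball] with w hw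
    by_cases hwX : w ∈ P.X
    · rw [hψz, (hW.exists_psi_eq hY hwX).1, EReal.toReal_coe, EReal.coe_le_coe_iff]
      have h1 := hmin w hwX
      have h2 : ‖w - x‖ ^ 2 = ‖w - z‖ ^ 2 + 2 * inner ℝ (w - z) (z - x) + ‖z - x‖ ^ 2 := by
        rw [← norm_add_sq_real]; simp
      have h3 : (innerSL ℝ ((2 * ρ) • (x - z))) (w - z) = -(2 * ρ * inner ℝ (w - z) (z - x)) := by
        rw [innerSL_apply_apply, inner_smul_left, real_inner_comm, ← neg_sub z x, inner_neg_right]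
        simp
      have h4 : ρ * ‖w - z‖ ^ 2 ≤ e * ‖w - z‖ := by
        rw [mem_ball_iff_norm, lt_div_iff₀ hρ] at hw
        nlinarith [norm_nonneg (w - z)]
      rw [h2] at h1
      rw [h3]
      linarith
    · rw [hW.psi_eq_top hwX]
      exact le_top
  refine (Metric.infEDist_le_edist_of_mem hmem).trans ?_
  rw [edist_comm, edist_zero_right, enorm_smul, ← enorm_neg (x - z), neg_sub,
    Real.enorm_eq_ofReal (by positivity)]

/-- The dual half `b` of a Sion saddle point certifies the value at `xd`, so `xd` also minimizes the
saddle function at `y = b`. That function is a convex one plus a quadratic with coefficient `ρ / 2`,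
whence the growth term. -/
theorem exists_saddle (hρ : 0 < ρ) (hX : IsClosed P.X)
    (hsub : ∀ x ∈ P.X, ∀ y ∈ P.Y, (euclSubdiff (fun z => ((P.f z y : ℝ) : EReal)) x).Nonempty)
    {xbar xd : 𝔼} (hxd : xd ∈ P.X)
    (hmin : ∀ w ∈ P.X, P.psiR xd + ρ * ‖xd - xbar‖ ^ 2 ≤ P.psiR w + ρ * ‖w - xbar‖ ^ 2) :
    ∃ yd ∈ P.Y, ∀ x ∈ P.X, ∀ y ∈ P.Y,
      P.saddle ρ xbar xd y + ρ / 2 * ‖x - xd‖ ^ 2 ≤ P.saddle ρ xbar x yd := by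
  set h : F → 𝔼 → ℝ := fun y x =>
    P.f x y + ρ / 2 * ‖x‖ ^ 2 + (P.g x).toReal + (ρ * ‖xbar‖ ^ 2 - (P.r y).toReal)
  have hquad : ∀ x y, P.saddle ρ xbar x y = quadObj (h y) (ρ / 2) ((2 * ρ) • xbar) x := by
    intro x y
    simp only [Problem.saddle, quadObj, h]
    rw [inner_smul_right, norm_sub_sq_real]
    ring
  have hconv : ∀ y ∈ P.Y, ConvexOn ℝ P.X (h y) := fun y hy =>
    ((hW.convexOn_f_add_sq hsub hy).add hW.g_closed_convex.convex).add
      (convexOn_const _ hW.convex_X)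
  have hLconv : ∀ y ∈ P.Y, ConvexOn ℝ P.X fun x => P.saddle ρ xbar x y := fun y hy => by
    simp only [hquad]
    exact convexOn_quadObj (hconv y hy) (half_pos hρ).le _
  -- `X` may be unbounded; Sion's theorem is applied near `xd`, and convexity later turns the local
  -- minimum into a global one.
  set K := P.X ∩ Metric.closedBall xd 1
  have hKconv : Convex ℝ K := hW.convex_X.inter (convex_closedBall xd 1)
  have hxdK : xd ∈ K := ⟨hxd, by simp⟩
  obtain ⟨a, ha, b, hb, hab⟩ := Sion.exists_isSaddlePointOn (X := K) (Y := P.Y)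
    (f := P.saddle ρ xbar) ⟨xd, hxdK⟩ hKconv ((isCompact_closedBall xd 1).inter_left hX)
    (fun y hy => by
      have h1 : LowerSemicontinuousOn (fun x => (P.g x).toReal
          + (P.f x y - (P.r y).toReal + ρ * ‖x - xbar‖ ^ 2)) P.X :=
        hW.g_closed_convex.lowerSemicontinuousOn_toReal.add
          (Continuous.continuousOn (((hW.f_continuous_left y).sub continuous_const).add
            (by fun_prop))).lowerSemicontinuousOn
      have h2 : (fun x => P.saddle ρ xbar x y) = fun x => (P.g x).toReal
          + (P.f x y - (P.r y).toReal + ρ * ‖x - xbar‖ ^ 2) := by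
        funext x; rw [Problem.saddle]; ring
      rw [h2]
      exact h1.mono Set.inter_subset_left)
    (fun y hy => ((hLconv y hy).subset Set.inter_subset_left hKconv).quasiconvexOn)
    hW.convex_Y hW.Y_nonempty hY
    (fun x hx => by
      have h1 : UpperSemicontinuousOn (fun y => -(P.r y).toReal) P.Y :=
        continuous_neg.comp_lowerSemicontinuousOn_antitone
          hW.r_closed_convex.lowerSemicontinuousOn_toReal fun _ _ h => neg_le_neg h
      have h2 := h1.add ((hW.f_continuous_right x).add
        (continuous_const (y := (P.g x).toReal
          + ρ * ‖x - xbar‖ ^ 2))).continuousOn.upperSemicontinuousOn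
      have h3 : (fun y => P.saddle ρ xbar x y) = fun y => -(P.r y).toReal
          + (P.f x y + ((P.g x).toReal + ρ * ‖x - xbar‖ ^ 2)) := by
        funext y; rw [Problem.saddle]; ring
      rw [h3]
      exact h2)
    (fun x hx => by
      have h1 := ((hW.concave x hx.1).sub hW.r_closed_convex.convex).add
        (concaveOn_const ((P.g x).toReal + ρ * ‖x - xbar‖ ^ 2) hW.convex_Y)
      exact h1.quasiconcaveOn)
  have hle_psi : ∀ x ∈ P.X, ∀ y ∈ P.Y, P.saddle ρ xbar x y ≤ P.psiR x + ρ * ‖x - xbar‖ ^ 2 :=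
    fun x hx y hy => by
      have := (hW.exists_psi_eq hY hx).2.2 y hy
      rw [Problem.saddle]; linarith
  have hval : P.psiR xd + ρ * ‖xd - xbar‖ ^ 2 ≤ P.saddle ρ xbar a b := by
    obtain ⟨-, ⟨y, hy, heq⟩, -⟩ := hW.exists_psi_eq hY ha.1
    have h1 := hab a ha y hy
    have h2 := hmin a ha.1
    rw [Problem.saddle] at h1
    linarith
  have hminK : IsMinOn (fun x => P.saddle ρ xbar x b) K xd := isMinOn_iff.2 fun x hx =>
    ((hle_psi xd hxd b hb).trans hval).trans (hab x hx b hb)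
  have hminX : IsMinOn (fun x => P.saddle ρ xbar x b) P.X xd := by
    refine IsMinOn.of_isLocalMinOn_of_convexOn hxd ?_ (hLconv b hb)
    have h1 : IsLocalMinOn (fun x => P.saddle ρ xbar x b) K xd := hminK.localize
    have h2 : 𝓝[K] xd = 𝓝[P.X] xd :=
      nhdsWithin_inter_of_mem' (mem_nhdsWithin_of_mem_nhds (Metric.closedBall_mem_nhds xd one_pos))
    unfold IsLocalMinOn at h1 ⊢
    rwa [h2] at h1
  refine ⟨b, hb, fun x hx y hy => ?_⟩
  have h1 := quadObj_add_sq_le (hconv b hb) hxd (κ := ρ / 2) (v := (2 * ρ) • xbar)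
    (by simpa only [hquad] using hminX) hx
  rw [← hquad, ← hquad] at h1
  have h2 := hle_psi xd hxd y hy
  have h3 := hab xd hxdK b hb
  linarith

end WeaklyConvexConcave

end Setting

/-! ### Recursions driven by independent samples. -/

section Probability

variable {Ω A B Z Ξ : Type*} [MeasurableSpace A] [MeasurableSpace B]
  [MeasurableSpace Z] [MeasurableSpace Ξ]

/-- The trajectory of a recursion driven by the samples `s`. -/
def chain (step : Z → Ξ → Z) (z₀ : Z) (s : ℕ → Ξ) : ℕ → Z
  | 0 => z₀
  | j + 1 => step (chain step z₀ s j) (s j)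

theorem measurable_chain {step : A → Z → Ξ → Z}
    (hstep : Measurable fun q : A × Z × Ξ => step q.1 q.2.1 q.2.2) {z₀ : A → Z}
    (hz₀ : Measurable z₀) (j : ℕ) :
    Measurable fun q : A × (ℕ → Ξ) => chain (step q.1) (z₀ q.1) q.2 j := by
  induction j with
  | zero => exact hz₀.comp measurable_fst
  | succ j ih =>
    exact hstep.comp (measurable_fst.prodMk (ih.prodMk ((measurable_pi_apply j).comp measurable_snd)))

/-- The state `j` sees only the samples before `j`, which makes it independent of the sample `j`. -/
theorem measurable_chain_iSup {step : Z → Ξ → Z}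
    (hstep : Measurable fun q : Z × Ξ => step q.1 q.2) (z₀ : Z) (s : ℕ → Ω → Ξ) (j : ℕ) :
    Measurable[⨆ i ∈ Set.Iio j, MeasurableSpace.comap (s i) inferInstance]
      fun ω => chain step z₀ (fun i => s i ω) j := by
  induction j with
  | zero => exact measurable_const
  | succ j ih =>
    have h1 : Measurable[⨆ i ∈ Set.Iio (j + 1), MeasurableSpace.comap (s i) inferInstance]
        fun ω => chain step z₀ (fun i => s i ω) j :=
      ih.mono (biSup_mono fun i (hi : i < j) => Nat.lt_succ_of_lt hi) le_rfl
    have h2 : Measurable[⨆ i ∈ Set.Iio (j + 1), MeasurableSpace.comap (s i) inferInstance]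
        (s j) :=
      (comap_measurable (s j)).mono
        (le_iSup₂_of_le (f := fun i (_ : i ∈ Set.Iio (j + 1)) =>
          MeasurableSpace.comap (s i) inferInstance) j (Nat.lt_succ_self j) le_rfl) le_rfl
    exact hstep.comp (h1.prodMk h2)

variable [mΩ : MeasurableSpace Ω]

/-- To bound the expectation of a function of two independent variables, freeze the first one. -/
theorem lintegral_le_of_indepFun {Pr : Measure Ω} [IsProbabilityMeasure Pr] {X : Ω → A}
    {S : Ω → B} (hX : Measurable X) (hS : Measurable S) (hind : IndepFun X S Pr)
    {K : A × B → ENNReal} (hK : Measurable K) {L : A → ENNReal}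
    (hL : ∀ a, ∫⁻ b, K (a, b) ∂(Measure.map S Pr) ≤ L a) :
    ∫⁻ ω, K (X ω, S ω) ∂Pr ≤ ∫⁻ ω, L (X ω) ∂Pr := by
  have : IsProbabilityMeasure (Measure.map S Pr) := Measure.isProbabilityMeasure_map hS.aemeasurable
  calc ∫⁻ ω, K (X ω, S ω) ∂Pr = ∫⁻ z, K z ∂(Measure.map (fun ω => (X ω, S ω)) Pr) :=
        (lintegral_map hK (hX.prodMk hS)).symm
    _ = ∫⁻ z, K z ∂((Measure.map X Pr).prod (Measure.map S Pr)) := by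
        rw [(indepFun_iff_map_prod_eq_prod_map_map hX.aemeasurable hS.aemeasurable).1 hind]
    _ = ∫⁻ a, ∫⁻ b, K (a, b) ∂(Measure.map S Pr) ∂(Measure.map X Pr) :=
        lintegral_prod _ hK.aemeasurable
    _ = ∫⁻ ω, ∫⁻ b, K (X ω, b) ∂(Measure.map S Pr) ∂Pr :=
        lintegral_map hK.lintegral_prod_right' hX
    _ ≤ ∫⁻ ω, L (X ω) ∂Pr := lintegral_mono fun ω => hL _

/-- A drift inequality for one step of a recursion with independent samples bounds the expected
running sum of `w`. -/
theorem lintegral_chain_add_sum_le {Pr : Measure Ω} [IsProbabilityMeasure Pr] {ν : Measure Ξ}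
    {s : ℕ → Ω → Ξ} (hs : ∀ i, Measurable (s i)) (hlaw : ∀ i, Measure.map (s i) Pr = ν)
    (hind : iIndepFun s Pr) {step : Z → Ξ → Z}
    (hstep : Measurable fun q : Z × Ξ => step q.1 q.2) {Φ w : Z → ENNReal}
    (hΦ : Measurable Φ) (hw : Measurable w) {σ : ENNReal}
    (hdrift : ∀ z, ∫⁻ ξ, Φ (step z ξ) + w (step z ξ) ∂ν ≤ Φ z + σ) (z₀ : Z) (n : ℕ) :
    ∫⁻ ω, Φ (chain step z₀ (fun i => s i ω) n) ∂Pr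
      + ∑ j ∈ Finset.range n, ∫⁻ ω, w (chain step z₀ (fun i => s i ω) (j + 1)) ∂Pr
      ≤ Φ z₀ + n * σ := by
  have hle : ∀ j, (⨆ i ∈ Set.Iio j, MeasurableSpace.comap (s i) inferInstance) ≤ mΩ :=
    fun j => iSup₂_le fun i _ => (hs i).comap_le
  have hmeas : ∀ j, Measurable fun ω => chain step z₀ (fun i => s i ω) j := fun j =>
    (measurable_chain_iSup hstep z₀ s j).mono (hle j) le_rfl
  induction n with
  | zero => simp [chain]
  | succ n ih =>
    have hindep : IndepFun (fun ω => chain step z₀ (fun i => s i ω) n) (s n) Pr := by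
      have h1 := indep_iSup_of_disjoint (fun i => (hs i).comap_le) hind
        (S := Set.Iio n) (T := {n}) (by simp)
      refine indep_of_indep_of_le_left (indep_of_indep_of_le_right h1 ?_)
        (measurable_chain_iSup hstep z₀ s n).comap_le
      exact le_iSup₂_of_le (f := fun i (_ : i ∈ ({n} : Set ℕ)) =>
          MeasurableSpace.comap (s i) inferInstance) n rfl le_rfl
    have h1 := lintegral_le_of_indepFun (hmeas n) (hs n) hindep
      (K := fun q => Φ (step q.1 q.2) + w (step q.1 q.2))
      ((hΦ.comp hstep).add (hw.comp hstep)) (L := fun z => Φ z + σ)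
      (fun z => by rw [hlaw]; exact hdrift z)
    rw [lintegral_add_right _ measurable_const, lintegral_const, measure_univ, mul_one] at h1
    have h2 : ∫⁻ ω, Φ (chain step z₀ (fun i => s i ω) (n + 1))
          + w (chain step z₀ (fun i => s i ω) (n + 1)) ∂Pr
        = ∫⁻ ω, Φ (chain step z₀ (fun i => s i ω) (n + 1)) ∂Pr
          + ∫⁻ ω, w (chain step z₀ (fun i => s i ω) (n + 1)) ∂Pr :=
      lintegral_add_right _ (hw.comp (hmeas (n + 1)))
    replace h1 := h2.symm.trans_le h1
    rw [Finset.sum_range_succ, ← add_assoc, add_right_comm]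
    refine (add_le_add_left h1 _).trans ?_
    rw [add_right_comm, Nat.cast_add, Nat.cast_one, add_mul, one_mul, ← add_assoc]
    exact add_le_add_left ih _

theorem integrable_and_integral_sq_le {V : Type*} [NormedAddCommGroup V] {ν : Measure Ξ}
    [IsProbabilityMeasure ν] {G : Ξ → V} (hG : AEStronglyMeasurable G ν) {M : ℝ}
    (hM : ∫⁻ s, ‖G s‖ₑ ^ 2 ∂ν ≤ ENNReal.ofReal (M ^ 2)) :
    Integrable G ν ∧ Integrable (fun s => ‖G s‖ ^ 2) ν ∧ ∫ s, ‖G s‖ ^ 2 ∂ν ≤ M ^ 2 := by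
  have henorm : ∀ s, ‖‖G s‖ ^ 2‖ₑ = ‖G s‖ₑ ^ 2 := fun s => by simp
  have hsq : Integrable (fun s => ‖G s‖ ^ 2) ν := by
    refine ⟨hG.norm.pow 2, ?_⟩
    rw [HasFiniteIntegral]
    simp only [henorm]
    exact hM.trans_lt ENNReal.ofReal_lt_top
  refine ⟨((memLp_two_iff_integrable_sq_norm hG).2 hsq).integrable (by norm_num), hsq, ?_⟩
  rw [integral_eq_lintegral_of_nonneg_ae (Filter.Eventually.of_forall fun s => by positivity)
    hsq.1]
  refine ENNReal.toReal_le_of_le_ofReal (by positivity) (le_trans (le_of_eq ?_) hM)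
  refine lintegral_congr fun s => ?_
  rw [← henorm, Real.enorm_eq_ofReal (by positivity)]

end Probability

/-! ### Deterministic inequalities for one step of mirror descent. -/

section InnerLoop

variable {p : ℕ} {F Ξ : Type*} [NormedAddCommGroup F] [NormedSpace ℝ F]

local notation "𝔼" => EuclideanSpace ℝ (Fin p)

theorem inner_sub_sq_le {E : Type*} [NormedAddCommGroup E] [InnerProductSpace ℝ E] (u v : E)
    {η : ℝ} (hη : 0 < η) : inner ℝ u v - 1 / (2 * η) * ‖u‖ ^ 2 ≤ η / 2 * ‖v‖ ^ 2 := by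
  have h1 := real_inner_le_norm u v
  have h2 : ‖u‖ * ‖v‖ - 1 / (2 * η) * ‖u‖ ^ 2 - η / 2 * ‖v‖ ^ 2
      = -(1 / (2 * η) * (‖u‖ - η * ‖v‖) ^ 2) := by field_simp; ring
  have h3 : 0 ≤ 1 / (2 * η) * (‖u‖ - η * ‖v‖) ^ 2 := by positivity
  linarith

namespace Problem

variable (P : Problem p F Ξ)

/-- The two quadratic penalties merge into one with coefficient `1 / (2ηx) + ρ`; the iterate, the
center and the sampled subgradient enter only through the linear term, so the update is a continuous
function of a vector. -/
theorem primal_objective_eq {ρ ηx : ℝ} (a xbar G x : 𝔼) :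
    inner ℝ x G + 1 / (2 * ηx) * ‖x - a‖ ^ 2 + 1 / (2 * (1 / (2 * ρ))) * ‖x - xbar‖ ^ 2
        + (P.g x).toReal
      = quadObj (fun x => (P.g x).toReal) (1 / (2 * ηx) + ρ)
          ((1 / ηx) • a + (2 * ρ) • xbar - G) x
        + (1 / (2 * ηx) * ‖a‖ ^ 2 + ρ * ‖xbar‖ ^ 2) := by
  have hγ : 1 / (2 * (1 / (2 * ρ))) = ρ := by field_simp
  rw [hγ, quadObj, norm_sub_sq_real, norm_sub_sq_real, inner_sub_right, inner_add_right,
    inner_smul_right, inner_smul_right]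
  field_simp
  ring

theorem dual_objective_eq {ηy : ℝ} (a : F) (H : StrongDual ℝ F) (y : F) :
    -(H y) + 1 / ηy * P.V y a + (P.r y).toReal
      = (1 / ηy * P.d y + (P.r y).toReal - (H + (1 / ηy) • P.dGrad a) y)
        + 1 / ηy * (P.dGrad a a - P.d a) := by
  simp only [Problem.V, bregman, add_apply, smul_apply, smul_eq_mul, map_sub]
  ring

end Problem

theorem isMinOn_congr_add_const {α : Type*} {f g : α → ℝ} {S : Set α} {a : α} (c : ℝ)
    (h : ∀ x, f x = g x + c) : IsMinOn f S a ↔ IsMinOn g S a := by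
  simp only [isMinOn_iff, h, add_le_add_iff_right]

namespace SMDStep

variable {P : Problem p F Ξ} {ρ μ : ℝ} {ηx ηy : ℝ} {s : Ξ} {a b : State p F}

/-- Quadratic growth of the subproblem at its minimizer, tested at `xd`. The movement from `a.x` to
`b.x` is absorbed by Young's inequality into `ηx / 2 * ‖gx‖²`, while the proximal term contributes
the extra `ρ‖b.x - xd‖²`. -/
theorem primal_bound {xbar : 𝔼} (h : SMDStep P (1 / (2 * ρ)) xbar ηx ηy s a b)
    (hW : WeaklyConvexConcave P ρ μ) (hηx : 0 < ηx) {xd : 𝔼} (hxd : xd ∈ P.X) :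
    (1 / (2 * ηx) + ρ) * ‖b.x - xd‖ ^ 2 + ((P.g b.x).toReal + ρ * ‖b.x - xbar‖ ^ 2)
        - ((P.g xd).toReal + ρ * ‖xd - xbar‖ ^ 2)
      ≤ 1 / (2 * ηx) * ‖a.x - xd‖ ^ 2 + ηx / 2 * ‖P.gx a.x a.y s‖ ^ 2
        - inner ℝ (P.gx a.x a.y s) (a.x - xd) := by
  have hγ : 1 / (2 * (1 / (2 * ρ))) = ρ := by field_simp
  have h1 := quadObj_add_sq_le hW.g_closed_convex.convex h.x_mem
    ((isMinOn_congr_add_const _ fun x => P.primal_objective_eq (ρ := ρ) (ηx := ηx) a.x xbar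
      (P.gx a.x a.y s) x).1 h.x_min) hxd
  have h2 := P.primal_objective_eq (ρ := ρ) (ηx := ηx) a.x xbar (P.gx a.x a.y s) xd
  have h3 := P.primal_objective_eq (ρ := ρ) (ηx := ηx) a.x xbar (P.gx a.x a.y s) b.x
  rw [hγ] at h2 h3
  have h4 := inner_sub_sq_le (a.x - b.x) (P.gx a.x a.y s) hηx
  rw [norm_sub_rev a.x b.x, inner_sub_left] at h4
  rw [inner_sub_right, real_inner_comm a.x, real_inner_comm xd, norm_sub_rev b.x xd,
    norm_sub_rev a.x xd]
  linarith

variable [FiniteDimensional ℝ F]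

/-- The first order condition at `b.y` combines with the three-point identity of the Bregman
divergence; `V(b.y, a.y) ≥ ‖b.y - a.y‖² / 2` pays for the movement. Membership in `Yo` is
propagated, so the next step can start. -/
theorem dual_bound {xbar : 𝔼} (h : SMDStep P (1 / (2 * ρ)) xbar ηx ηy s a b)
    (hW : WeaklyConvexConcave P ρ μ) (hηy : 0 < ηy) (ha : a.y ∈ P.Yo) :
    b.y ∈ P.Yo ∧ ∀ yd ∈ P.Y, 1 / ηy * P.V yd b.y + (P.r b.y).toReal - (P.r yd).toReal
      ≤ 1 / ηy * P.V yd a.y + ηy / 2 * ‖P.gy a.x a.y s‖ ^ 2 - P.gy a.x a.y s (yd - a.y) := by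
  set H := P.gy a.x a.y s
  obtain ⟨hbo, ζ, hζr, hζ⟩ := hW.dgf.exists_subgradient_of_isMinOn hW.r_closed_convex.convex hηy
    h.y_mem ((isMinOn_congr_add_const _ fun y => P.dual_objective_eq (ηy := ηy) a.y H y).1 h.y_min)
  refine ⟨hbo, fun yd hyd => ?_⟩
  have h1 := hζr yd hyd
  have h2 := hζ yd hyd
  have h3 := hW.dgf.half_sq_le_bregman h.y_mem ha
  have h4 : H (b.y - a.y) ≤ ‖H‖ * ‖b.y - a.y‖ := (le_abs_self _).trans (H.le_opNorm _)
  have h5 : ‖H‖ * ‖b.y - a.y‖ - 1 / ηy * (1 / 2 * ‖b.y - a.y‖ ^ 2) - ηy / 2 * ‖H‖ ^ 2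
      = -(1 / (2 * ηy) * (‖b.y - a.y‖ - ηy * ‖H‖) ^ 2) := by field_simp; ring
  have h6 : 0 ≤ 1 / (2 * ηy) * (‖b.y - a.y‖ - ηy * ‖H‖) ^ 2 := by positivity
  have h7 := mul_le_mul_of_nonneg_left h3 (by positivity : 0 ≤ 1 / ηy)
  simp only [Problem.V, bregman, add_apply, smul_apply, smul_eq_mul, map_sub] at *
  linarith

end SMDStep

end InnerLoop

/-! ### Mean drift of the potential and the averaged output. -/

section InnerLoop

variable {p : ℕ} {F Ξ : Type*} [NormedAddCommGroup F] [NormedSpace ℝ F]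

local notation "𝔼" => EuclideanSpace ℝ (Fin p)

/-- The set of pairs of primal and dual points at which an iteration can start. -/
def Problem.Dom (P : Problem p F Ξ) : Set (𝔼 × F) := P.X ×ˢ P.Yo

/-- The potential of the iteration with prox-center `xbar` and saddle point `(xd, yd)`. -/
noncomputable def potential (P : Problem p F Ξ) (ρ Qg Qr ηx ηy : ℝ) (xbar xd : 𝔼) (yd : F)
    (z : 𝔼 × F) : ℝ :=
  1 / (2 * ηx) * ‖z.1 - xd‖ ^ 2 + 1 / ηy * P.V yd z.2 + ((P.g z.1).toReal - (P.g xd).toReal + Qg)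
    + ρ * ‖z.1 - xbar‖ ^ 2 + ((P.r z.2).toReal - (P.r yd).toReal + Qr)

variable [FiniteDimensional ℝ F] [MeasurableSpace F] {P : Problem p F Ξ} {ρ μ Mx My Qg Qr : ℝ}

/-- The offsets `Qg` and `Qr` compensate negative differences of `g` and `r`, so that expectations
can be taken as Lebesgue integrals. -/
theorem potential_nonneg [MeasurableSpace Ξ] {ν : Measure Ξ} (hW : WeaklyConvexConcave P ρ μ)
    (hO : StochasticOracle P ν Mx My Qg Qr) (hρ : 0 < ρ) {ηx ηy : ℝ} (hηx : 0 < ηx) (hηy : 0 < ηy)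
    {xbar xd : 𝔼} {yd : F} (hxd : xd ∈ P.X) (hyd : yd ∈ P.Y) {z : 𝔼 × F} (hz : z ∈ P.Dom) :
    0 ≤ potential P ρ Qg Qr ηx ηy xbar xd yd z := by
  have h1 := hO.g_osc xd hxd z.1 hz.1
  have h2 := hO.r_osc yd hyd z.2 hz.2.1
  have h3 : 0 ≤ 1 / (2 * ηx) * ‖z.1 - xd‖ ^ 2 := by positivity
  have h4 : 0 ≤ 1 / ηy * P.V yd z.2 :=
    mul_nonneg (by positivity) (hW.dgf.bregman_nonneg hyd hz.2)
  have h5 : 0 ≤ ρ * ‖z.1 - xbar‖ ^ 2 := by positivity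
  rw [potential]
  linarith

/-- The subgradients are taken at the old iterate, while `g`, `r` and the proximal term are
evaluated at the new one; for this reason the potential carries their values along. The loss of weak
convexity is exactly the growth at the saddle point. -/
theorem lintegral_potential_step_le [MeasurableSpace Ξ] {ν : Measure Ξ}
    [IsProbabilityMeasure ν] (hW : WeaklyConvexConcave P ρ μ)
    (hO : StochasticOracle P ν Mx My Qg Qr) (hρ : 0 < ρ) {ηx ηy : ℝ} (hηx : 0 < ηx) (hηy : 0 < ηy)
    {xbar xd : 𝔼} {yd : F} (hxd : xd ∈ P.X) (hyd : yd ∈ P.Y)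
    (hsaddle : ∀ x ∈ P.X, ∀ y ∈ P.Y,
      P.saddle ρ xbar xd y + ρ / 2 * ‖x - xd‖ ^ 2 ≤ P.saddle ρ xbar x yd)
    {z : 𝔼 × F} (hz : z ∈ P.Dom) {zn : Ξ → 𝔼 × F}
    (hzn : ∀ s, SMDStep P (1 / (2 * ρ)) xbar ηx ηy s ⟨z.1, z.2, 0⟩ ⟨(zn s).1, (zn s).2, 1⟩) :
    ∫⁻ s, ENNReal.ofReal (potential P ρ Qg Qr ηx ηy xbar xd yd (zn s) + ρ * ‖(zn s).1 - xd‖ ^ 2) ∂ν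
      ≤ ENNReal.ofReal (potential P ρ Qg Qr ηx ηy xbar xd yd z
          + (ηx / 2 * Mx ^ 2 + ηy / 2 * My ^ 2)) := by
  obtain ⟨x, y⟩ := z
  obtain ⟨hx, hy⟩ := hz
  simp only at hx hy hzn
  have hmx : AEStronglyMeasurable (P.gx x y) ν :=
    (hO.gx_measurable.comp_measurable (by fun_prop : Measurable fun s : Ξ =>
      (x, y, s))).aestronglyMeasurable
  have hmy : AEStronglyMeasurable (P.gy x y) ν :=
    (hO.gy_measurable.comp_measurable (by fun_prop : Measurable fun s : Ξ =>
      (x, y, s))).aestronglyMeasurable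
  obtain ⟨hix, hix2, hbx⟩ := integrable_and_integral_sq_le hmx (hO.gx_moment x hx y hy.1)
  obtain ⟨hiy, hiy2, hby⟩ := integrable_and_integral_sq_le hmy (hO.gy_moment x hx y hy.1)
  set c : ℝ := 1 / (2 * ηx) * ‖x - xd‖ ^ 2 + 1 / ηy * P.V yd y + Qg + Qr + ρ * ‖xd - xbar‖ ^ 2
  -- Sum of the primal and dual bounds. Its integral involves the sampled subgradients only through
  -- their means and second moments.
  set R : Ξ → ℝ := fun s => c + ηx / 2 * ‖P.gx x y s‖ ^ 2 + ηy / 2 * ‖P.gy x y s‖ ^ 2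
    - inner ℝ (P.gx x y s) (x - xd) - P.gy x y s (yd - y)
  have hi1 : Integrable (fun s => inner ℝ (P.gx x y s) (x - xd)) ν := hix.inner_const _
  have hi2 : Integrable (fun s => P.gy x y s (yd - y)) ν := hiy.apply_continuousLinearMap _
  have hi3 : Integrable (fun s => ηx / 2 * ‖P.gx x y s‖ ^ 2) ν := hix2.const_mul _
  have hi4 : Integrable (fun s => ηy / 2 * ‖P.gy x y s‖ ^ 2) ν := hiy2.const_mul _
  have hR : Integrable R ν :=
    ((((integrable_const c).add hi3).add hi4).sub hi1).sub hi2
  have hle : ∀ s, potential P ρ Qg Qr ηx ηy xbar xd yd (zn s) + ρ * ‖(zn s).1 - xd‖ ^ 2 ≤ R s := by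
    intro s
    have h1 := (hzn s).primal_bound hW hηx hxd
    have h2 := ((hzn s).dual_bound hW hηy hy).2 yd hyd
    simp only [potential, R, c] at *
    linarith
  have hnonneg : ∀ s, 0 ≤ R s := fun s => by
    refine le_trans ?_ (hle s)
    have h1 : (zn s) ∈ P.Dom := ⟨(hzn s).x_mem, ((hzn s).dual_bound hW hηy hy).1⟩
    have h2 := potential_nonneg hW hO hρ hηx hηy (xbar := xbar) hxd hyd h1
    positivity
  have hint : ∫ s, R s ∂ν = c + ηx / 2 * ∫ s, ‖P.gx x y s‖ ^ 2 ∂ν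
      + ηy / 2 * ∫ s, ‖P.gy x y s‖ ^ 2 ∂ν
      - inner ℝ (∫ s, P.gx x y s ∂ν) (x - xd) - (∫ s, P.gy x y s ∂ν) (yd - y) := by
    have e1 : ∫ s, inner ℝ (P.gx x y s) (x - xd) ∂ν = inner ℝ (∫ s, P.gx x y s ∂ν) (x - xd) := by
      rw [real_inner_comm, ← integral_inner hix]
      simp only [real_inner_comm]
    have e2 : ∫ s, P.gy x y s (yd - y) ∂ν = (∫ s, P.gy x y s ∂ν) (yd - y) :=
      (ContinuousLinearMap.integral_apply hiy _).symm
    have hi5 : Integrable (fun s => c + ηx / 2 * ‖P.gx x y s‖ ^ 2) ν := (integrable_const c).add hi3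
    have hi6 : Integrable (fun s => c + ηx / 2 * ‖P.gx x y s‖ ^ 2 + ηy / 2 * ‖P.gy x y s‖ ^ 2) ν :=
      hi5.add hi4
    have hi7 : Integrable (fun s => c + ηx / 2 * ‖P.gx x y s‖ ^ 2 + ηy / 2 * ‖P.gy x y s‖ ^ 2
        - inner ℝ (P.gx x y s) (x - xd)) ν := hi6.sub hi1
    simp only [R]
    rw [integral_sub hi7 hi2, integral_sub hi6 hi1, integral_add hi5 hi4, integral_add (integrable_const c) hi3,
      integral_const, integral_const_mul, integral_const_mul, e1, e2]
    simp
  have hmeanx := hW.weaklyConvex y hy.1 xd hxd x hx _ (hO.gx_mean x hx y hy.1)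
  have hmeany := le_of_mem_frechetSubdiff (hW.concave x hx).neg (fun _ _ => rfl) hy.1 hyd
    (hO.gy_mean x hx y hy.1)
  have hs := hsaddle x hx y hy.1
  calc ∫⁻ s, ENNReal.ofReal
        (potential P ρ Qg Qr ηx ηy xbar xd yd (zn s) + ρ * ‖(zn s).1 - xd‖ ^ 2) ∂ν
      ≤ ∫⁻ s, ENNReal.ofReal (R s) ∂ν := lintegral_mono fun s => ENNReal.ofReal_le_ofReal (hle s)
    _ = ENNReal.ofReal (∫ s, R s ∂ν) :=
      (ofReal_integral_eq_lintegral_ofReal hR (Filter.Eventually.of_forall hnonneg)).symm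
    _ ≤ _ := by
      refine ENNReal.ofReal_le_ofReal ?_
      rw [hint]
      have h1 := mul_le_mul_of_nonneg_left hbx (half_pos hηx).le
      have h2 := mul_le_mul_of_nonneg_left hby (half_pos hηy).le
      rw [norm_sub_rev xd x, ← neg_sub x xd, inner_neg_right] at hmeanx
      simp only [Pi.neg_apply, neg_apply] at hmeany
      simp only [potential, Problem.saddle, c] at *
      linarith

variable [BorelSpace F]

theorem measurable_potential (hW : WeaklyConvexConcave P ρ μ) {ηx ηy : ℝ}
    {xbar xd : 𝔼} {yd : F} :
    Measurable fun z : P.Dom => potential P ρ Qg Qr ηx ηy xbar xd yd z.1 := by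
  have hg : Measurable fun z : P.Dom => (P.g z.1.1).toReal :=
    (hW.g_closed_convex.closed.measurable.comp (by fun_prop)).ereal_toReal
  have hr : Measurable fun z : P.Dom => (P.r z.1.2).toReal :=
    (hW.r_closed_convex.closed.measurable.comp (by fun_prop)).ereal_toReal
  have hV : Measurable fun z : P.Dom => P.V yd z.1.2 := by
    have h1 : Continuous fun z : P.Dom => P.dGrad z.1.2 :=
      hW.dgf.grad_continuous.comp_continuous (by fun_prop) fun z => z.2.2
    have h2 : Continuous fun z : P.Dom => P.d z.1.2 :=
      hW.dgf.continuous.comp_continuous (by fun_prop) fun z => z.2.2.1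
    exact ((continuous_const.sub h2).sub (h1.clm_apply (by fun_prop))).measurable
  unfold potential
  fun_prop

variable [MeasurableSpace Ξ] {ν : Measure Ξ}

/-- The solution maps of the two proximal subproblems give a measurable update of the iterates. -/
theorem exists_measurable_step (hW : WeaklyConvexConcave P ρ μ)
    (hO : StochasticOracle P ν Mx My Qg Qr) (hρ : 0 < ρ) (hX : IsClosed P.X) (hY : IsCompact P.Y)
    {ηx ηy : ℝ} (hηx : 0 < ηx) (hηy : 0 < ηy) :
    ∃ step : 𝔼 → P.Dom → Ξ → P.Dom,
      (Measurable fun q : 𝔼 × P.Dom × Ξ => step q.1 q.2.1 q.2.2) ∧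
      (∀ xbar z s, SMDStep P (1 / (2 * ρ)) xbar ηx ηy s ⟨z.1.1, z.1.2, 0⟩
        ⟨(step xbar z s).1.1, (step xbar z s).1.2, 1⟩) ∧
      ∀ (xbar : 𝔼) (z : P.Dom) s a b, SMDStep P (1 / (2 * ρ)) xbar ηx ηy s a b →
        (a.x, a.y) = z.1 → (b.x, b.y) = (step xbar z s).1 := by
  have : ProperSpace F := FiniteDimensional.proper_real F
  obtain ⟨x₀, hx₀⟩ := hW.X_nonempty
  obtain ⟨Sx, hSx, hSxmin⟩ := exists_continuous_quadObj_argmin hX ⟨x₀, hx₀⟩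
    hW.g_closed_convex.convex hW.g_closed_convex.lowerSemicontinuousOn_toReal
    (m := (P.g x₀).toReal - Qg) (fun x hx => by linarith [hO.g_osc x₀ hx₀ x hx])
    (by positivity : 0 < 1 / (2 * ηx) + ρ)
  obtain ⟨Sy, hSy, hSymin⟩ := hW.dgf.exists_continuous_argmin hY hW.Y_nonempty
    hW.r_closed_convex.convex hW.r_closed_convex.lowerSemicontinuousOn_toReal hηy
  have hmem : ∀ v ℓ, (Sx v, Sy ℓ) ∈ P.Dom := fun v ℓ => ⟨((hSxmin v _).2 rfl).1,
    (hW.dgf.exists_subgradient_of_isMinOn hW.r_closed_convex.convex hηy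
      ((hSymin ℓ _).2 rfl).1 ((hSymin ℓ _).2 rfl).2).1⟩
  have hchar : ∀ (xbar : 𝔼) s (a b : State p F), SMDStep P (1 / (2 * ρ)) xbar ηx ηy s a b ↔
      b.x = Sx ((1 / ηx) • a.x + (2 * ρ) • xbar - P.gx a.x a.y s) ∧
      b.y = Sy (P.gy a.x a.y s + (1 / ηy) • P.dGrad a.y) ∧ b.calls = a.calls + 1 := by
    intro xbar s a b
    have hx := isMinOn_congr_add_const (S := P.X) (a := b.x) _
      fun x => P.primal_objective_eq (ρ := ρ) (ηx := ηx) a.x xbar (P.gx a.x a.y s) x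
    have hy := isMinOn_congr_add_const (S := P.Y) (a := b.y) _
      fun y => P.dual_objective_eq (ηy := ηy) a.y (P.gy a.x a.y s) y
    rw [← hSxmin, ← hSymin]
    constructor
    · rintro ⟨h1, h2, h3, h4, h5⟩
      exact ⟨⟨h1, hx.1 h2⟩, ⟨h3, hy.1 h4⟩, h5⟩
    · rintro ⟨⟨h1, h2⟩, ⟨h3, h4⟩, h5⟩
      exact ⟨h1, hx.2 h2, h3, hy.2 h4, h5⟩
  refine ⟨fun xbar z s => ⟨(Sx ((1 / ηx) • z.1.1 + (2 * ρ) • xbar - P.gx z.1.1 z.1.2 s),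
    Sy (P.gy z.1.1 z.1.2 s + (1 / ηy) • P.dGrad z.1.2)), hmem _ _⟩, ?_, ?_, ?_⟩
  · refine Measurable.subtype_mk (Measurable.prodMk ?_ ?_)
    · have h1 : Measurable fun q : 𝔼 × P.Dom × Ξ => P.gx q.2.1.1.1 q.2.1.1.2 q.2.2 :=
        hO.gx_measurable.measurable.comp (f := fun q : 𝔼 × P.Dom × Ξ =>
          (q.2.1.1.1, q.2.1.1.2, q.2.2)) (by fun_prop)
      exact hSx.measurable.comp (by fun_prop)
    · have h1 : Measurable fun q : 𝔼 × P.Dom × Ξ => P.gy q.2.1.1.1 q.2.1.1.2 q.2.2 :=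
        hO.gy_measurable.measurable.comp (f := fun q : 𝔼 × P.Dom × Ξ =>
          (q.2.1.1.1, q.2.1.1.2, q.2.2)) (by fun_prop)
      have h2 : Measurable fun z : P.Dom => P.dGrad z.1.2 :=
        (hW.dgf.grad_continuous.comp_continuous (by fun_prop) fun z => z.2.2).measurable
      have h3 : Measurable fun q : 𝔼 × P.Dom × Ξ => P.dGrad q.2.1.1.2 :=
        h2.comp (measurable_fst.comp measurable_snd)
      exact hSy.measurable.comp (h1.add (h3.const_smul (1 / ηy)))
  · exact fun xbar z s => (hchar _ _ _ _).2 ⟨rfl, rfl, rfl⟩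
  · intro xbar z s a b hab hz
    obtain ⟨h1, h2, -⟩ := (hchar _ _ _ _).1 hab
    have hz1 : a.x = z.1.1 := congrArg Prod.fst hz
    have hz2 : a.y = z.1.2 := congrArg Prod.snd hz
    rw [h1, h2, hz1, hz2]

theorem norm_average_sub_sq_le {E : Type*} [NormedAddCommGroup E] [NormedSpace ℝ E] {J : ℕ}
    (hJ : 0 < J) (x : ℕ → E) (c : E) :
    ‖(1 / (J : ℝ)) • ∑ j ∈ Finset.range J, x j - c‖ ^ 2
      ≤ 1 / (J : ℝ) * ∑ j ∈ Finset.range J, ‖x j - c‖ ^ 2 := by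
  have hJ' : (J : ℝ) ≠ 0 := by positivity
  have h1 := (convexOn_univ_norm (E := E)).pow (fun _ _ => norm_nonneg _) 2
  have h2 := h1.map_sum_le (t := Finset.range J) (w := fun _ => 1 / (J : ℝ))
    (p := fun j => x j - c) (fun _ _ => by positivity) (by simp [hJ']) (fun _ _ => Set.mem_univ _)
  simp only [Pi.pow_apply, smul_eq_mul] at h2
  rw [← Finset.smul_sum, ← Finset.mul_sum, Finset.sum_sub_distrib, smul_sub, Finset.sum_const,
    Finset.card_range, ← Nat.cast_smul_eq_nsmul ℝ, smul_smul, one_div_mul_cancel hJ',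
    one_smul] at h2
  exact h2

/-- The averaged output of the inner loop is close to the proximal point in mean square. -/
theorem lintegral_average_sub_sq_le [IsProbabilityMeasure ν] (hW : WeaklyConvexConcave P ρ μ)
    (hO : StochasticOracle P ν Mx My Qg Qr) (hρ : 0 < ρ) {ηx ηy : ℝ} (hηx : 0 < ηx) (hηy : 0 < ηy)
    {xbar xd : 𝔼} {yd : F} (hxd : xd ∈ P.X) (hyd : yd ∈ P.Y)
    (hsaddle : ∀ x ∈ P.X, ∀ y ∈ P.Y,
      P.saddle ρ xbar xd y + ρ / 2 * ‖x - xd‖ ^ 2 ≤ P.saddle ρ xbar x yd)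
    {step : P.Dom → Ξ → P.Dom} (hstep : Measurable fun q : P.Dom × Ξ => step q.1 q.2)
    (hSMD : ∀ z s, SMDStep P (1 / (2 * ρ)) xbar ηx ηy s ⟨z.1.1, z.1.2, 0⟩
      ⟨(step z s).1.1, (step z s).1.2, 1⟩)
    {Ω : Type*} [MeasurableSpace Ω] {Pr : Measure Ω} [IsProbabilityMeasure Pr] {s : ℕ → Ω → Ξ}
    (hs : ∀ i, Measurable (s i)) (hlaw : ∀ i, Measure.map (s i) Pr = ν) (hind : iIndepFun s Pr)
    {z₀ : P.Dom} (hz₀ : z₀.1.1 = xbar) {J : ℕ} (hJ : 0 < J) :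
    ∫⁻ ω, ‖(1 / (J : ℝ)) • ∑ j ∈ Finset.range J, (chain step z₀ (fun i => s i ω) j).1.1 - xd‖ₑ ^ 2
        ∂Pr
      ≤ ENNReal.ofReal (1 / J * (‖xbar - xd‖ ^ 2 + 1 / ρ * (1 / (2 * ηx) * ‖xbar - xd‖ ^ 2
        + 1 / ηy * P.V yd z₀.1.2 + 2 * Qg + 2 * Qr
        + J * (ηx / 2 * Mx ^ 2 + ηy / 2 * My ^ 2)))) := by
  -- The average contains the iterate 0, which is the center and contributes `‖xbar - xd‖²`
  -- directly; the drift controls the iterates `1, …, m`.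
  obtain ⟨m, rfl⟩ : ∃ m, J = m + 1 := ⟨J - 1, by omega⟩
  set σ : ℝ := ηx / 2 * Mx ^ 2 + ηy / 2 * My ^ 2
  have hσ : 0 ≤ σ := by positivity
  set pot : P.Dom → ℝ := fun z => potential P ρ Qg Qr ηx ηy xbar xd yd z.1
  have hpot : ∀ z, 0 ≤ pot z := fun z => potential_nonneg hW hO hρ hηx hηy hxd hyd z.2
  set w : P.Dom → ENNReal := fun z => ENNReal.ofReal (‖z.1.1 - xd‖ ^ 2)
  have hw : Measurable w := by
    have : Measurable fun z : P.Dom => ‖z.1.1 - xd‖ ^ 2 :=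
      Continuous.measurable (by fun_prop)
    exact this.ennreal_ofReal
  have hΦ : Measurable fun z => ENNReal.ofReal (1 / ρ * pot z) :=
    ((measurable_potential hW).const_mul _).ennreal_ofReal
  have hdrift : ∀ z, ∫⁻ ξ, ENNReal.ofReal (1 / ρ * pot (step z ξ)) + w (step z ξ) ∂ν
      ≤ ENNReal.ofReal (1 / ρ * pot z) + ENNReal.ofReal (1 / ρ * σ) := by
    intro z
    have h1 := lintegral_potential_step_le hW hO hρ hηx hηy hxd hyd hsaddle z.2
      (fun s => hSMD z s)
    have h2 := mul_le_mul_right h1 (ENNReal.ofReal (1 / ρ))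
    rw [← lintegral_const_mul' _ _ ENNReal.ofReal_ne_top, ← ENNReal.ofReal_mul (by positivity),
      mul_add, ENNReal.ofReal_add (mul_nonneg (by positivity) (hpot z)) (by positivity)] at h2
    refine le_trans (le_of_eq ?_) h2
    refine lintegral_congr fun ξ => ?_
    rw [← ENNReal.ofReal_mul (by positivity), mul_add, ← mul_assoc, one_div_mul_cancel hρ.ne',
      one_mul, ENNReal.ofReal_add (mul_nonneg (by positivity) (hpot _)) (by positivity)]
  have hchain := lintegral_chain_add_sum_le hs hlaw hind hstep hΦ hw hdrift z₀ m
  have hmeas : ∀ j, Measurable fun ω => chain step z₀ (fun i => s i ω) j := fun j =>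
    (measurable_chain_iSup hstep z₀ s j).mono (iSup₂_le fun i _ => (hs i).comap_le) le_rfl
  have hpot₀ : pot z₀ ≤ 1 / (2 * ηx) * ‖xbar - xd‖ ^ 2 + 1 / ηy * P.V yd z₀.1.2 + 2 * Qg + 2 * Qr := by
    have h1 := hO.g_osc _ z₀.2.1 xd hxd
    have h2 := hO.r_osc _ z₀.2.2.1 yd hyd
    simp only [pot, potential]
    rw [hz₀] at h1 ⊢
    rw [sub_self, norm_zero]
    linarith
  calc ∫⁻ ω, ‖(1 / ((m + 1 : ℕ) : ℝ)) • ∑ j ∈ Finset.range (m + 1),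
          (chain step z₀ (fun i => s i ω) j).1.1 - xd‖ₑ ^ 2 ∂Pr
      ≤ ∫⁻ ω, ENNReal.ofReal (1 / ((m + 1 : ℕ) : ℝ)) * ∑ j ∈ Finset.range (m + 1),
          w (chain step z₀ (fun i => s i ω) j) ∂Pr := by
        refine lintegral_mono fun ω => ?_
        rw [← ENNReal.ofReal_sum_of_nonneg (fun _ _ => by positivity),
          ← ENNReal.ofReal_mul (by positivity), ← ofReal_norm, ← ENNReal.ofReal_pow (norm_nonneg _)]
        exact ENNReal.ofReal_le_ofReal (norm_average_sub_sq_le hJ _ _)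
    _ = ENNReal.ofReal (1 / ((m + 1 : ℕ) : ℝ)) * (w z₀ + ∑ j ∈ Finset.range m,
          ∫⁻ ω, w (chain step z₀ (fun i => s i ω) (j + 1)) ∂Pr) := by
        have h1 : ∫⁻ ω, ∑ j ∈ Finset.range (m + 1), w (chain step z₀ (fun i => s i ω) j) ∂Pr
            = ∑ j ∈ Finset.range (m + 1), ∫⁻ ω, w (chain step z₀ (fun i => s i ω) j) ∂Pr :=
          lintegral_finsetSum _ (fun j _ => hw.comp (hmeas j))
        rw [lintegral_const_mul' _ _ ENNReal.ofReal_ne_top, h1, Finset.sum_range_succ']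
        have h2 : ∫⁻ ω, w (chain step z₀ (fun i => s i ω) 0) ∂Pr = w z₀ := by simp [chain]
        rw [h2, add_comm (w z₀)]
    _ ≤ ENNReal.ofReal (1 / ((m + 1 : ℕ) : ℝ)) * (w z₀ + (ENNReal.ofReal (1 / ρ * pot z₀)
          + m * ENNReal.ofReal (1 / ρ * σ))) := by
        gcongr
        exact le_trans le_add_self hchain
    _ = ENNReal.ofReal (1 / ((m + 1 : ℕ) : ℝ) * (‖z₀.1.1 - xd‖ ^ 2
          + (1 / ρ * pot z₀ + m * (1 / ρ * σ)))) := by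
        have h1 : 0 ≤ 1 / ρ * pot z₀ := mul_nonneg (by positivity) (hpot z₀)
        rw [ENNReal.ofReal_mul (p := 1 / ((m + 1 : ℕ) : ℝ)) (by positivity),
          ENNReal.ofReal_add (by positivity) (by positivity),
          ENNReal.ofReal_add h1 (by positivity), ENNReal.ofReal_mul (Nat.cast_nonneg m),
          ENNReal.ofReal_natCast]
    _ ≤ _ := by
        refine ENNReal.ofReal_le_ofReal (mul_le_mul_of_nonneg_left ?_ (by positivity))
        rw [hz₀, add_le_add_iff_left]
        have h1 : 1 / ρ * pot z₀ + m * (1 / ρ * σ) = 1 / ρ * (pot z₀ + m * σ) := by ring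
        rw [h1]
        refine mul_le_mul_of_nonneg_left ?_ (by positivity)
        push_cast
        linarith

end InnerLoop

/-! ### Descent of the envelope and the random output index. -/

section OuterLoop

/-- Summation of a perturbed descent inequality. -/
theorem sum_le_of_descent {n : ℕ} {e A : ℕ → ENNReal} {ρ θ Δ : ℝ} {δ : ℕ → ℝ} (hρ : 0 < ρ)
    (hθ : 0 ≤ θ) (hθ1 : θ < 1) (hΔ : 0 ≤ Δ) (hδ : ∀ t, 0 ≤ δ t) (he : e 0 ≤ ENNReal.ofReal Δ)
    (hA : ∀ t ≤ n, ENNReal.ofReal ρ * A t ≤ e t)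
    (hstep : ∀ t < n, e (t + 1) + ENNReal.ofReal ρ * A t
      ≤ e t + ENNReal.ofReal ρ * (ENNReal.ofReal θ * A t + ENNReal.ofReal (δ t))) :
    ∑ t ∈ Finset.range (n + 1), A t
      ≤ ENNReal.ofReal ((Δ + ρ * ∑ t ∈ Finset.range n, δ t) / (ρ * (1 - θ))) := by
  have hρ0 : ENNReal.ofReal ρ ≠ 0 := by simpa using hρ
  -- Finiteness propagates from `e 0` alternately to `A t` and `e (t + 1)`; only then can the
  -- inequalities be read in `ℝ`.
  have hAfin : ∀ t ≤ n, e t ≠ ⊤ → A t ≠ ⊤ := by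
    intro t ht hfin hAt
    have := hA t ht
    rw [hAt, ENNReal.mul_top hρ0, top_le_iff] at this
    exact hfin this
  have hefin : ∀ t ≤ n, e t ≠ ⊤ := by
    intro t
    induction t with
    | zero => exact fun _ => ne_top_of_le_ne_top ENNReal.ofReal_ne_top he
    | succ t ih =>
      intro ht
      have h1 := ih (by omega)
      have h2 := hAfin t (by omega) h1
      refine ne_top_of_le_ne_top ?_ (le_self_add.trans (hstep t (by omega)))
      finiteness
  have hArfin : ∀ t ≤ n, A t ≠ ⊤ := fun t ht => hAfin t ht (hefin t ht)
  have hA' : ∀ t ≤ n, ρ * (A t).toReal ≤ (e t).toReal := by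
    intro t ht
    have := ENNReal.toReal_mono (hefin t ht) (hA t ht)
    rwa [ENNReal.toReal_mul, ENNReal.toReal_ofReal hρ.le] at this
  have hstep' : ∀ t < n, (e (t + 1)).toReal + ρ * (A t).toReal
      ≤ (e t).toReal + ρ * (θ * (A t).toReal + δ t) := by
    intro t ht
    have h1 := hefin t ht.le
    have h2 := hArfin t ht.le
    have h3 := hefin (t + 1) ht
    have := ENNReal.toReal_mono (by finiteness) (hstep t ht)
    rwa [ENNReal.toReal_add h3 (by finiteness), ENNReal.toReal_add h1 (by finiteness),
      ENNReal.toReal_mul, ENNReal.toReal_mul, ENNReal.toReal_add (by finiteness) (by finiteness),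
      ENNReal.toReal_mul, ENNReal.toReal_ofReal hρ.le, ENNReal.toReal_ofReal hθ,
      ENNReal.toReal_ofReal (hδ t)] at this
  have hsum : ∀ m ≤ n, (e m).toReal + ρ * (1 - θ) * ∑ t ∈ Finset.range m, (A t).toReal
      ≤ Δ + ρ * ∑ t ∈ Finset.range m, δ t := by
    intro m
    induction m with
    | zero =>
      intro _
      simpa using ENNReal.toReal_le_of_le_ofReal hΔ he
    | succ m ih =>
      intro hm
      have h1 := ih (by omega)
      have h2 := hstep' m (by omega)
      rw [Finset.sum_range_succ, Finset.sum_range_succ, mul_add, mul_add]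
      linarith
  -- No step follows the last index, so its term is paid by the remaining `e n`.
  have hfinal : ρ * (1 - θ) * ∑ t ∈ Finset.range (n + 1), (A t).toReal
      ≤ Δ + ρ * ∑ t ∈ Finset.range n, δ t := by
    have h1 := hsum n le_rfl
    have h2 := hA' n le_rfl
    have h3 : 0 ≤ ρ * (θ * (A n).toReal) := by positivity
    rw [Finset.sum_range_succ, mul_add]
    linarith
  have hfin : ∑ t ∈ Finset.range (n + 1), A t ≠ ⊤ :=
    ENNReal.sum_ne_top.2 fun t ht => hArfin t (Nat.lt_succ_iff.1 (Finset.mem_range.1 ht))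
  rw [← ENNReal.ofReal_toReal hfin, ENNReal.toReal_sum fun t ht =>
    hArfin t (Nat.lt_succ_iff.1 (Finset.mem_range.1 ht))]
  refine ENNReal.ofReal_le_ofReal ?_
  rw [le_div_iff₀ (mul_pos hρ (by linarith))]
  linarith

/-- The expectation at a uniform index that is independent of the summands. -/
theorem lintegral_uniform_index {Ω Ξ : Type*} {mΩ : MeasurableSpace Ω} [MeasurableSpace Ξ]
    {Pr : Measure Ω} {ν : Measure Ξ} {T : ℕ} {ξ : ℕ → ℕ → Ω → Ξ}
    {τ : Ω → Fin T} (hS : IsSampling Pr ν T ξ τ) {A : ℕ → Ω → ENNReal}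
    (hA : ∀ t < T, Measurable[MeasurableSpace.comap (fun ω (i : ℕ × ℕ) => ξ i.1 i.2 ω)
      inferInstance] (A t)) :
    ∫⁻ ω, A (τ ω) ω ∂Pr = (T : ENNReal)⁻¹ * ∑ t ∈ Finset.range T, ∫⁻ ω, A t ω ∂Pr := by
  have hle : MeasurableSpace.comap (fun ω (i : ℕ × ℕ) => ξ i.1 i.2 ω) inferInstance ≤ mΩ :=
    (measurable_pi_lambda _ fun i : ℕ × ℕ => hS.sample_measurable i.1 i.2).comap_le
  have hτ := hS.index_measurable
  have hset : ∀ i : Fin T, Measurable[MeasurableSpace.comap τ inferInstance]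
      ((τ ⁻¹' {i}).indicator (1 : Ω → ENNReal)) := fun i => by
    have h1 : Measurable (({i} : Set (Fin T)).indicator (1 : Fin T → ENNReal)) :=
      measurable_one.indicator (measurableSet_singleton i)
    exact h1.comp (comap_measurable τ)
  have h1 : ∀ ω, A (τ ω) ω = ∑ i : Fin T, (τ ⁻¹' {i}).indicator 1 ω * A i ω := by
    intro ω
    rw [Finset.sum_eq_single (τ ω)]
    · simp
    · intro i _ hi
      rw [Set.indicator_of_notMem (by simpa using hi.symm), zero_mul]
    · simp
  have h2 : ∀ i : Fin T, ∫⁻ ω, (τ ⁻¹' {i}).indicator 1 ω * A i ω ∂Pr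
      = (T : ENNReal)⁻¹ * ∫⁻ ω, A i ω ∂Pr := by
    intro i
    rw [lintegral_mul_eq_lintegral_mul_lintegral_of_independent_measurableSpace hτ.comap_le hle
      hS.index_indep (hset i) (hA i i.2),
      lintegral_indicator_one (hτ (measurableSet_singleton i)), hS.index_law]
  have h3 : ∫⁻ ω, ∑ i : Fin T, (τ ⁻¹' {i}).indicator 1 ω * A i ω ∂Pr
      = ∑ i : Fin T, ∫⁻ ω, (τ ⁻¹' {i}).indicator 1 ω * A i ω ∂Pr :=
    lintegral_finsetSum _ fun i _ => ((hset i).mono hτ.comap_le le_rfl).mul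
      ((hA i i.2).mono hle le_rfl)
  simp only [h1]
  rw [h3]
  simp only [h2]
  rw [← Finset.mul_sum, Fin.sum_univ_eq_sum_range (fun t => ∫⁻ ω, A t ω ∂Pr)]

variable {p : ℕ} {F Ξ : Type*} [NormedAddCommGroup F] [NormedSpace ℝ F]

local notation "𝔼" => EuclideanSpace ℝ (Fin p)

/-- Averaging `J` iterates takes only `J - 1` steps, because the starting point is among them. -/
theorem IsSMD.calls_eq {P : Problem p F Ξ} {γ : ℝ} {xbar : 𝔼} {ybar : F} {ηx ηy : ℝ} {J : ℕ}
    {s : ℕ → Ξ} {k : ℕ} {xhat : 𝔼} {k' : ℕ} (h : IsSMD P γ xbar ybar ηx ηy J s k xhat k') :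
    k' = k + (J - 1) := by
  obtain ⟨-, u, hu0, hu, -, rfl⟩ := h
  have : ∀ j, j + 1 ≤ J ∨ j = 0 → (u j).calls = k + j := by
    intro j
    induction j with
    | zero => intro _; rw [hu0]; rfl
    | succ j ih =>
      intro hj
      rw [(hu j (by omega)).calls_eq, ih (by omega), add_assoc]
  exact this _ (by omega)

theorem IsPGSMD.calls_le {P : Problem p F Ξ} {γ : ℝ} {init : 𝔼 → F → Prop} {cost : ℕ}
    {ηx ηy : ℕ → ℝ} {J : ℕ → ℕ} {T : ℕ} {x₀ : 𝔼} {s : ℕ → ℕ → Ξ} {u : ℕ → State p F}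
    (h : IsPGSMD P γ init cost ηx ηy J T x₀ s u) {t : ℕ} (ht : t + 1 ≤ T) :
    (u t).calls ≤ t * cost + ∑ i ∈ Finset.range t, J i := by
  induction t with
  | zero => simp [h.2.1]
  | succ t ih =>
    have h1 := (h.2.2 t (by omega)).2.calls_eq
    have h2 := ih (by omega)
    rw [h1, Finset.sum_range_succ, add_mul]
    omega

variable [FiniteDimensional ℝ F] [MeasurableSpace F] [BorelSpace F] [MeasurableSpace Ξ]
  {P : Problem p F Ξ} {ρ μ Mx My Qg Qr : ℝ} {ν : Measure Ξ}

/-- The output of one call of the inner loop, as a function of the prox-center and the samples. -/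
theorem exists_measurable_output (hW : WeaklyConvexConcave P ρ μ)
    (hO : StochasticOracle P ν Mx My Qg Qr) (hρ : 0 < ρ) (hX : IsClosed P.X) (hY : IsCompact P.Y)
    {ηx ηy : ℝ} (hηx : 0 < ηx) (hηy : 0 < ηy) {J : ℕ} (hJ : 0 < J) {Ybar : 𝔼 → F}
    (hYbar : ContinuousOn Ybar {x | x ∈ P.X ∧ Ybar x ∈ P.Yo})
    {Ω : Type*} [MeasurableSpace Ω] {Pr : Measure Ω} [IsProbabilityMeasure Pr] {s : ℕ → Ω → Ξ}
    (hs : ∀ i, Measurable (s i)) (hlaw : ∀ i, Measure.map (s i) Pr = ν) (hind : iIndepFun s Pr) :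
    ∃ out : {x | x ∈ P.X ∧ Ybar x ∈ P.Yo} × (ℕ → Ξ) → 𝔼, Measurable out ∧ (∀ q, out q ∈ P.X) ∧
      (∀ x s k xhat k', IsSMD P (1 / (2 * ρ)) x.1 (Ybar x.1) ηx ηy J s k xhat k' →
        xhat = out (x, s)) ∧
      ∀ x, ∀ xd ∈ P.X, ∀ yd ∈ P.Y, (∀ x' ∈ P.X, ∀ y ∈ P.Y,
        P.saddle ρ x.1 xd y + ρ / 2 * ‖x' - xd‖ ^ 2 ≤ P.saddle ρ x.1 x' yd) →
        ∫⁻ ω, ‖out (x, fun i => s i ω) - xd‖ₑ ^ 2 ∂Pr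
        ≤ ENNReal.ofReal (1 / J * (‖x.1 - xd‖ ^ 2 + 1 / ρ * (1 / (2 * ηx) * ‖x.1 - xd‖ ^ 2
          + 1 / ηy * P.V yd (Ybar x.1) + 2 * Qg + 2 * Qr
          + J * (ηx / 2 * Mx ^ 2 + ηy / 2 * My ^ 2)))) := by
  have hν : IsProbabilityMeasure ν := by
    rw [← hlaw 0]; exact Measure.isProbabilityMeasure_map (hs 0).aemeasurable
  obtain ⟨step, hstep, hSMD, huniq⟩ := exists_measurable_step hW hO hρ hX hY hηx hηy
  set G : Set 𝔼 := {x | x ∈ P.X ∧ Ybar x ∈ P.Yo}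
  set z₀ : G → P.Dom := fun x => ⟨(x.1, Ybar x.1), x.2.1, x.2.2⟩
  have hz₀ : Measurable z₀ := by
    refine Measurable.subtype_mk (measurable_subtype_coe.prodMk ?_)
    exact (hYbar.comp_continuous continuous_subtype_val fun x => x.2).measurable
  have hstepG : Measurable fun q : G × P.Dom × Ξ => step q.1.1 q.2.1 q.2.2 :=
    hstep.comp ((measurable_subtype_coe.comp measurable_fst).prodMk measurable_snd)
  have hchain := fun j => measurable_chain (step := fun x : G => step x.1) hstepG hz₀ j
  refine ⟨fun q => (1 / (J : ℝ)) • ∑ j ∈ Finset.range J, (chain (step q.1.1) (z₀ q.1) q.2 j).1.1,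
    ?_, fun q => ?_, ?_, ?_⟩
  · have h1 : ∀ j, Measurable fun q : G × (ℕ → Ξ) => (chain (step q.1.1) (z₀ q.1) q.2 j).1.1 :=
      fun j => measurable_fst.comp (measurable_subtype_coe.comp (hchain j))
    exact Measurable.const_smul (Finset.measurable_fun_sum _ fun j _ => h1 j) (1 / (J : ℝ))
  · beta_reduce
    rw [Finset.smul_sum]
    refine hW.convex_X.sum_mem (fun _ _ => by positivity) ?_ fun j _ =>
      (chain (step q.1.1) (z₀ q.1) q.2 j).2.1
    rw [Finset.sum_const, Finset.card_range, nsmul_eq_mul, mul_one_div_cancel (by positivity)]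
  · rintro x s k xhat k' ⟨-, v, hv0, hv, rfl, -⟩
    have h1 : ∀ j, j + 1 ≤ J → ((v j).x, (v j).y) = (chain (step x.1) (z₀ x) s j).1 := by
      intro j
      induction j with
      | zero => intro _; rw [hv0]; rfl
      | succ j ih => exact fun hj => huniq _ _ _ _ _ (hv j (by omega)) (ih (by omega))
    refine congrArg _ (Finset.sum_congr rfl fun j hj => ?_)
    exact congrArg Prod.fst (h1 j (Finset.mem_range.1 hj))
  · intro x xd hxd yd hyd hsaddle
    exact lintegral_average_sub_sq_le hW hO hρ hηx hηy hxd hyd hsaddle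
      (hstep.comp (measurable_const.prodMk measurable_id)) (fun z s => hSMD x.1 z s) hs hlaw hind
      (z₀ := z₀ x) rfl hJ

end OuterLoop

section OuterLoop

variable {p : ℕ} {F Ξ : Type*} [NormedAddCommGroup F] [NormedSpace ℝ F]
  [FiniteDimensional ℝ F] [MeasurableSpace F] [BorelSpace F] [MeasurableSpace Ξ]
  {P : Problem p F Ξ} {ρ μ Mx My Qg Qr : ℝ} {ν : Measure Ξ}

local notation "𝔼" => EuclideanSpace ℝ (Fin p)

/-- If each call of the inner loop contracts the mean squared distance to the proximal point up to
the error `δ t`, then the output of the outer loop is nearly stationary. -/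
theorem nearlyStationary_of_contraction (hW : WeaklyConvexConcave P ρ μ)
    (hO : StochasticOracle P ν Mx My Qg Qr) (hρ : 0 < ρ) (hX : IsClosed P.X) (hY : IsCompact P.Y)
    {init : 𝔼 → F → Prop} {cost : ℕ} {ηx ηy : ℕ → ℝ} {J : ℕ → ℕ} {T : ℕ} (hT : 1 ≤ T)
    (hηx : ∀ t, 0 < ηx t) (hηy : ∀ t, 0 < ηy t) (hJ : ∀ t, 0 < J t) {Ybar : 𝔼 → F}
    (hYbar : ContinuousOn Ybar {x | x ∈ P.X ∧ Ybar x ∈ P.Yo})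
    (hinit : ∀ x ∈ P.X, ∀ y ∈ P.Yo, init x y → y = Ybar x)
    {θ : ℝ} {δ : ℕ → ℝ} (hθ : 0 ≤ θ) (hθ1 : θ < 1) (hδ : ∀ t, 0 ≤ δ t)
    (hbound : ∀ t, ∀ xbar ∈ P.X, Ybar xbar ∈ P.Yo → ∀ xd ∈ P.X, ∀ yd ∈ P.Y,
      (∀ y ∈ P.Y, P.f xd y - (P.r y).toReal ≤ P.f xd yd - (P.r yd).toReal) →
      1 / (J t : ℝ) * (‖xbar - xd‖ ^ 2 + 1 / ρ * (1 / (2 * ηx t) * ‖xbar - xd‖ ^ 2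
        + 1 / ηy t * P.V yd (Ybar xbar) + 2 * Qg + 2 * Qr
        + J t * (ηx t / 2 * Mx ^ 2 + ηy t / 2 * My ^ 2))) ≤ θ * ‖xbar - xd‖ ^ 2 + δ t)
    {x₀ : 𝔼} (hx₀ : x₀ ∈ P.X) {Δ : ℝ} (hΔ : P.psi x₀ ≤ (⨅ x, P.psi x) + (Δ : EReal))
    {Ω : Type*} [mΩ : MeasurableSpace Ω] {Pr : Measure Ω} [IsProbabilityMeasure Pr]
    {ξ : ℕ → ℕ → Ω → Ξ} {τ : Ω → Fin T} {u : Ω → ℕ → State p F} (hS : IsSampling Pr ν T ξ τ)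
    (hP : ∀ ω, IsPGSMD P (1 / (2 * ρ)) init cost ηx ηy J T x₀ (fun t j => ξ t j ω) (u ω))
    {ε : ℝ} (hε : 4 * ρ ^ 2 * ((Δ + ρ * ∑ t ∈ Finset.range (T - 1), δ t) / (ρ * (1 - θ)))
      ≤ T * ε ^ 2) :
    NearlyStationary Pr P.psi (1 / (2 * ρ)) ε (fun ω => (u ω (τ ω)).x) := by
  have hsub : ∀ x ∈ P.X, ∀ y ∈ P.Y,
      (euclSubdiff (fun z => ((P.f z y : ℝ) : EReal)) x).Nonempty :=
    fun x hx y hy => ⟨_, hO.gx_mean x hx y hy⟩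
  obtain ⟨prox, hprox, hproxiff, hproxX, hproxmin⟩ := hW.exists_prox hY hρ hX hsub
  obtain ⟨m, hm, hmle⟩ := hW.exists_iInf_psi_eq hY
  -- `𝓕 t` collects the samples of the calls before `t`, and `𝓖 t` those of the call `t`. The center
  -- `t` is measurable for the first and hence independent of the second.
  set 𝓕 : ℕ → MeasurableSpace Ω := fun t =>
    ⨆ i ∈ {i : ℕ × ℕ | i.1 < t}, MeasurableSpace.comap (ξ i.1 i.2) inferInstance with h𝓕
  set 𝓖 : ℕ → MeasurableSpace Ω := fun t =>
    ⨆ i ∈ {i : ℕ × ℕ | i.1 = t}, MeasurableSpace.comap (ξ i.1 i.2) inferInstance with h𝓖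
  have h𝓕le : ∀ t, 𝓕 t ≤ mΩ := fun t => iSup₂_le fun i _ => (hS.sample_measurable _ _).comap_le
  have h𝓖le : ∀ t, 𝓖 t ≤ mΩ := fun t => iSup₂_le fun i _ => (hS.sample_measurable _ _).comap_le
  have h𝓕mono : ∀ t, 𝓕 t ≤ 𝓕 (t + 1) := fun t =>
    biSup_mono fun i (hi : i.1 < t) => Nat.lt_succ_of_lt hi
  have h𝓖𝓕 : ∀ t, 𝓖 t ≤ 𝓕 (t + 1) := fun t =>
    biSup_mono fun i (hi : i.1 = t) => hi ▸ Nat.lt_succ_self t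
  have hsample : ∀ t, Measurable[𝓖 t] fun ω (j : ℕ) => ξ t j ω := fun t =>
    @measurable_pi_lambda _ _ _ (𝓖 t) _ _ fun j => (comap_measurable (ξ t j)).mono
      (le_iSup₂_of_le (f := fun (i : ℕ × ℕ) (_ : i ∈ {i : ℕ × ℕ | i.1 = t}) =>
          MeasurableSpace.comap (ξ i.1 i.2) inferInstance) (t, j) rfl le_rfl) le_rfl
  choose out hout houtX houteq houtbound using fun t =>
    exists_measurable_output hW hO hρ hX hY (hηx t) (hηy t) (hJ t) hYbar
      (fun j => hS.sample_measurable t j) (fun j => hS.sample_law t j)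
      (hS.sample_indep.precomp (g := fun j => (t, j)) fun a b h => (Prod.mk.inj h).2)
  have hG : ∀ t, t + 2 ≤ T → (∀ ω, (u ω t).x ∈ P.X) →
      ∀ ω, (u ω t).y = Ybar (u ω t).x ∧ (u ω t).x ∈ {x | x ∈ P.X ∧ Ybar x ∈ P.Yo} := by
    intro t ht hmem ω
    obtain ⟨h1, h2⟩ := (hP ω).2.2 t ht
    have h3 := hinit _ (hmem ω) _ h2.1 h1
    exact ⟨h3, hmem ω, h3 ▸ h2.1⟩
  have hnext : ∀ t, ∀ (ht : t + 2 ≤ T) (hmem : ∀ ω, (u ω t).x ∈ P.X) (ω : Ω),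
      (u ω (t + 1)).x = out t (⟨(u ω t).x, (hG t ht hmem ω).2⟩, fun j => ξ t j ω) := by
    intro t ht hmem ω
    have h1 := ((hP ω).2.2 t ht).2
    rw [(hG t ht hmem ω).1] at h1
    exact houteq t ⟨(u ω t).x, (hG t ht hmem ω).2⟩ _ _ _ _ h1
  have hmeas : ∀ t, t + 1 ≤ T →
      (∀ ω, (u ω t).x ∈ P.X) ∧ Measurable[𝓕 t] fun ω => (u ω t).x := by
    intro t
    induction t with
    | zero =>
      intro _
      have h0 : ∀ ω, (u ω 0).x = x₀ := fun ω => (hP ω).1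
      simp only [h0]
      exact ⟨fun _ => hx₀, measurable_const⟩
    | succ t ih =>
      intro ht
      obtain ⟨hmem, hmt⟩ := ih (by omega)
      simp only [hnext t ht hmem]
      refine ⟨fun ω => houtX t _, (hout t).comp (Measurable.prodMk (m := 𝓕 (t + 1)) ?_ ?_)⟩
      · exact Measurable.subtype_mk (hmt.mono (h𝓕mono t) le_rfl)
      · exact (hsample t).mono (h𝓖𝓕 t) le_rfl
  set A : ℕ → Ω → ENNReal := fun t ω => ‖prox (u ω t).x - (u ω t).x‖ₑ ^ 2 with hA
  have hAmeas : ∀ t, t + 1 ≤ T → Measurable[𝓕 t] (A t) := by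
    intro t ht
    have h1 : Measurable fun x : 𝔼 => ‖prox x - x‖ₑ ^ 2 := Continuous.measurable (by fun_prop)
    exact h1.comp (hmeas t ht).2
  -- The Moreau envelope of the objective, minus its infimum.
  set env : 𝔼 → ℝ := fun x => P.psiR (prox x) + ρ * ‖prox x - x‖ ^ 2 - m with henv
  have hsq : ∀ v : 𝔼, ‖v‖ₑ ^ 2 = ENNReal.ofReal (‖v‖ ^ 2) := fun v => by
    rw [← ofReal_norm, ENNReal.ofReal_pow (norm_nonneg _)]
  have henvA : ∀ x, ρ * ‖prox x - x‖ ^ 2 ≤ env x := fun x => by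
    have := hmle _ (hproxX x)
    simp only [henv]; linarith
  have hΔR : P.psiR x₀ - m ≤ Δ := by
    rw [hm, (hW.exists_psi_eq hY hx₀).1, ← EReal.coe_add, EReal.coe_le_coe_iff] at hΔ
    linarith
  have hΔ0 : 0 ≤ Δ := by linarith [hmle x₀ hx₀]
  obtain ⟨n, rfl⟩ : ∃ n, T = n + 1 := ⟨T - 1, by omega⟩
  rw [Nat.add_sub_cancel] at hε
  have hsum : ∑ t ∈ Finset.range (n + 1), ∫⁻ ω, A t ω ∂Pr
      ≤ ENNReal.ofReal ((Δ + ρ * ∑ t ∈ Finset.range n, δ t) / (ρ * (1 - θ))) := by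
    refine sum_le_of_descent (e := fun t => ∫⁻ ω, ENNReal.ofReal (env (u ω t).x) ∂Pr)
      hρ hθ hθ1 hΔ0 hδ ?_ ?_ ?_
    · have h1 : ∀ ω, ENNReal.ofReal (env (u ω 0).x) ≤ ENNReal.ofReal Δ := fun ω => by
        refine ENNReal.ofReal_le_ofReal ?_
        have h2 := hproxmin x₀ x₀ hx₀
        rw [sub_self, norm_zero] at h2
        simp only [henv, (hP ω).1]
        linarith
      exact (lintegral_mono h1).trans (by simp)
    · intro t ht
      rw [← lintegral_const_mul' _ _ ENNReal.ofReal_ne_top]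
      refine lintegral_mono fun ω => ?_
      rw [hA]
      simp only [hsq]
      rw [← ENNReal.ofReal_mul hρ.le]
      exact ENNReal.ofReal_le_ofReal (henvA _)
    · intro t ht
      obtain ⟨hmem, hmt⟩ := hmeas t (by omega)
      have hmt' : Measurable fun ω => (u ω (t + 1)).x :=
        (hmeas (t + 1) (by omega)).2.mono (h𝓕le _) le_rfl
      have hmΩ : Measurable fun ω => (u ω t).x := hmt.mono (h𝓕le t) le_rfl
      have hAm : Measurable (A t) := (hAmeas t (by omega)).mono (h𝓕le t) le_rfl
      obtain ⟨B, hB⟩ : ∃ B : Ω → ENNReal, B = fun ω => ‖(u ω (t + 1)).x - prox (u ω t).x‖ₑ ^ 2 :=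
        ⟨_, rfl⟩
      have hBm : Measurable B :=
        hB ▸ ((hmt'.sub (hprox.measurable.comp hmΩ)).enorm).pow_const 2
      have hpt : ∀ ω, ENNReal.ofReal (env (u ω (t + 1)).x) + ENNReal.ofReal ρ * A t ω
          ≤ ENNReal.ofReal (env (u ω t).x) + ENNReal.ofReal ρ * B ω := by
        intro ω
        have h0 : ∀ x, 0 ≤ env x := fun x => le_trans (by positivity) (henvA x)
        -- The old proximal point is a competitor in the envelope at the new center.
        have h1 := hproxmin (u ω (t + 1)).x _ (hproxX (u ω t).x)
        rw [hA, hB]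
        simp only [hsq]
        rw [← ENNReal.ofReal_mul hρ.le, ← ENNReal.ofReal_mul hρ.le,
          ← ENNReal.ofReal_add (h0 _) (by positivity), ← ENNReal.ofReal_add (h0 _) (by positivity)]
        refine ENNReal.ofReal_le_ofReal ?_
        rw [norm_sub_rev _ (prox _)]
        simp only [henv]
        linarith
      have hBle : ∫⁻ ω, B ω ∂Pr
          ≤ ENNReal.ofReal θ * ∫⁻ ω, A t ω ∂Pr + ENNReal.ofReal (δ t) := by
        set X : Ω → {x | x ∈ P.X ∧ Ybar x ∈ P.Yo} := fun ω =>
          ⟨(u ω t).x, (hG t (by omega) hmem ω).2⟩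
        have hXm : Measurable[𝓕 t] X := Measurable.subtype_mk hmt
        have hsm := (hsample t).mono (h𝓖le t) le_rfl
        have hindep : IndepFun X (fun ω j => ξ t j ω) Pr := by
          have h1 := indep_iSup_of_disjoint (fun i : ℕ × ℕ => (hS.sample_measurable _ _).comap_le)
            hS.sample_indep (S := {i : ℕ × ℕ | i.1 < t}) (T := {i : ℕ × ℕ | i.1 = t})
            (Set.disjoint_left.2 fun i (hi : i.1 < t) (hi' : i.1 = t) => by omega)
          exact indep_of_indep_of_le_left (indep_of_indep_of_le_right h1 (hsample t).comap_le)
            hXm.comap_le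
        have hK : Measurable fun q : {x | x ∈ P.X ∧ Ybar x ∈ P.Yo} × (ℕ → Ξ) =>
            ‖out t q - prox q.1.1‖ₑ ^ 2 := by
          have h1 : Measurable fun q : {x | x ∈ P.X ∧ Ybar x ∈ P.Yo} × (ℕ → Ξ) => prox q.1.1 :=
            hprox.measurable.comp (measurable_subtype_coe.comp measurable_fst)
          exact (((hout t).sub h1).enorm).pow_const 2
        have h1 := lintegral_le_of_indepFun (hXm.mono (h𝓕le t) le_rfl) hsm hindep hK
          (L := fun x => ENNReal.ofReal θ * ‖prox x.1 - x.1‖ₑ ^ 2 + ENNReal.ofReal (δ t)) (by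
            intro x
            rw [lintegral_map (f := fun b => ‖out t (x, b) - prox x.1‖ₑ ^ 2)
              (hK.comp measurable_prodMk_left) hsm]
            obtain ⟨yd, hyd, hsaddle⟩ :=
              hW.exists_saddle hY hρ hX hsub (hproxX x.1) (hproxmin x.1)
            refine (houtbound t x _ (hproxX x.1) yd hyd hsaddle).trans ?_
            rw [hsq, ← ENNReal.ofReal_mul hθ, ← ENNReal.ofReal_add (by positivity) (hδ t)]
            refine ENNReal.ofReal_le_ofReal ?_
            rw [norm_sub_rev (prox x.1) x.1]
            refine hbound t x.1 x.2.1 x.2.2 _ (hproxX x.1) yd hyd fun y hy => ?_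
            have := hsaddle _ (hproxX x.1) y hy
            rw [sub_self, norm_zero] at this
            simp only [Problem.saddle] at this
            linarith)
        have h2 : ∀ ω, B ω = ‖out t (X ω, fun j => ξ t j ω) - prox (X ω).1‖ₑ ^ 2 := fun ω => by
          rw [hB]
          simp only [hnext t (by omega) hmem ω, X]
        simp only [h2]
        refine h1.trans (le_of_eq ?_)
        rw [lintegral_add_right _ measurable_const, lintegral_const_mul' _ _ ENNReal.ofReal_ne_top]
        simp [A, X]
      calc ∫⁻ ω, ENNReal.ofReal (env (u ω (t + 1)).x) ∂Pr + ENNReal.ofReal ρ * ∫⁻ ω, A t ω ∂Pr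
          = ∫⁻ ω, ENNReal.ofReal (env (u ω (t + 1)).x) + ENNReal.ofReal ρ * A t ω ∂Pr := by
            rw [lintegral_add_right _ (hAm.const_mul _),
              lintegral_const_mul' _ _ ENNReal.ofReal_ne_top]
        _ ≤ ∫⁻ ω, ENNReal.ofReal (env (u ω t).x) + ENNReal.ofReal ρ * B ω ∂Pr := lintegral_mono hpt
        _ = ∫⁻ ω, ENNReal.ofReal (env (u ω t).x) ∂Pr + ENNReal.ofReal ρ * ∫⁻ ω, B ω ∂Pr := by
            rw [lintegral_add_right _ (hBm.const_mul _),
              lintegral_const_mul' _ _ ENNReal.ofReal_ne_top]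
        _ ≤ _ := by gcongr
  have hcomap : ∀ t, 𝓕 t ≤ MeasurableSpace.comap (fun ω (i : ℕ × ℕ) => ξ i.1 i.2 ω)
      inferInstance := fun t => iSup₂_le fun i _ => by
    have h1 : Measurable[MeasurableSpace.comap (fun ω (i : ℕ × ℕ) => ξ i.1 i.2 ω) inferInstance]
        (fun ω (i : ℕ × ℕ) => ξ i.1 i.2 ω) := comap_measurable _
    exact ((measurable_pi_apply i).comp h1).comap_le
  have hτ := lintegral_uniform_index hS (A := A)
    fun t ht => (hAmeas t ht).mono (hcomap t) le_rfl
  have hγ : 1 / (1 / (2 * ρ)) ^ 2 = 4 * ρ ^ 2 := by field_simp; ring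
  refine ⟨fun ω => prox (u ω (τ ω)).x, fun ω z => hproxiff _ _, ?_, ?_⟩
  · rw [hγ, ← lintegral_const_mul' _ _ ENNReal.ofReal_ne_top]
    refine lintegral_mono fun ω => ?_
    have h1 := hW.infEDist_euclSubdiff_le hY (hproxX (u ω (τ ω)).x) hρ (hproxmin (u ω (τ ω)).x)
    have h2 := pow_le_pow_left' h1 2
    rw [mul_pow, ← ENNReal.ofReal_pow (by positivity)] at h2
    refine h2.trans (le_of_eq ?_)
    congr 2
    ring
  · rw [hγ]
    change ENNReal.ofReal (4 * ρ ^ 2) * ∫⁻ ω, A (τ ω) ω ∂Pr ≤ _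
    rw [hτ]
    have hn : (0 : ℝ) < (n + 1 : ℕ) := by positivity
    calc _ ≤ ENNReal.ofReal (4 * ρ ^ 2) * (((n + 1 : ℕ) : ENNReal)⁻¹ *
          ENNReal.ofReal ((Δ + ρ * ∑ t ∈ Finset.range n, δ t) / (ρ * (1 - θ)))) := by gcongr
      _ = ENNReal.ofReal (4 * ρ ^ 2 * (((n + 1 : ℕ) : ℝ)⁻¹ *
          ((Δ + ρ * ∑ t ∈ Finset.range n, δ t) / (ρ * (1 - θ))))) := by
        rw [ENNReal.ofReal_mul (p := 4 * ρ ^ 2) (by positivity),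
          ENNReal.ofReal_mul (p := ((n + 1 : ℕ) : ℝ)⁻¹) (by positivity),
          ENNReal.ofReal_inv_of_pos hn, ENNReal.ofReal_natCast]
      _ ≤ _ := by
        refine ENNReal.ofReal_le_ofReal ?_
        rw [mul_left_comm, inv_mul_le_iff₀ hn]
        exact hε

end OuterLoop

/-! ### Compactness from quadratic growth. -/

section Compactness

variable {F : Type*} [NormedAddCommGroup F] [NormedSpace ℝ F] [FiniteDimensional ℝ F]

/-- A closed set on which the square of the distance to some point grows at most linearly in this
distance is compact. -/
theorem isCompact_of_sq_le {Y : Set F} (hY : IsClosed Y) {y₀ : F} {a b c : ℝ} (hb : 0 ≤ b)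
    (hc : 0 < c) (h : ∀ y ∈ Y, c * ‖y - y₀‖ ^ 2 ≤ a + b * ‖y - y₀‖) : IsCompact Y := by
  have := FiniteDimensional.proper_real F
  refine (isCompact_closedBall y₀ (1 + (|a| + b) / c)).of_isClosed_subset hY fun y hy => ?_
  rw [mem_closedBall_iff_norm]
  by_contra! hlt
  have h1 := h y hy
  have h2 : 0 ≤ (|a| + b) / c := by positivity
  have h3 : 1 < ‖y - y₀‖ := by linarith
  have h4 : c * (1 + (|a| + b) / c) = c + |a| + b := by field_simp; ring
  have h5 : (c + |a| + b) * ‖y - y₀‖ < c * ‖y - y₀‖ ^ 2 := by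
    rw [← h4, sq]
    nlinarith [mul_pos hc (by linarith : 0 < ‖y - y₀‖)]
  nlinarith [le_abs_self a, abs_nonneg a, mul_pos hc (by linarith : 0 < ‖y - y₀‖)]

end Compactness

/-! ### Choice of the number of outer iterations. -/

section Rate

theorem sum_inv_add_two_le {T : ℕ} (hT : 2 ≤ T) :
    ∑ t ∈ Finset.range (T - 1), 1 / ((t : ℝ) + 2) ≤ 1 + Real.log T := by
  have h1 := harmonic_le_one_add_log (T - 1)
  have h2 : Real.log ((T - 1 : ℕ) : ℝ) ≤ Real.log T :=
    Real.log_le_log (by exact_mod_cast (by omega : 0 < T - 1)) (by exact_mod_cast Nat.sub_le T 1)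
  refine le_trans ?_ (h1.trans (by linarith))
  rw [harmonic]
  push_cast
  refine Finset.sum_le_sum fun t _ => ?_
  rw [one_div]
  exact inv_anti₀ (by positivity) (by linarith)

/-- A number `T` of order `log (1 / ε) / ε ^ 2` with `K * (1 + log T) ≤ T * ε ^ 2`. -/
theorem exists_iterations {K : ℝ} (hK : 0 ≤ K) : ∃ B : ℝ, 1 ≤ B ∧ ∀ ε : ℝ, 0 < ε → ε ≤ 1 →
    ∃ T : ℕ, 2 ≤ T ∧ K * (1 + Real.log T) ≤ T * ε ^ 2 ∧
      (T : ℝ) ≤ B * (1 / ε ^ 2) * (1 + Real.log (1 / ε)) := by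
  obtain ⟨M, hM, hKM⟩ : ∃ M : ℝ, 0 ≤ M ∧ K * (4 + Real.log (M + 3)) ≤ M := by
    -- The bound `log z ≤ z / s - 1 + log s` has slope `1 / s`, and `K / s ≤ 1 / 2`; half of `M`
    -- therefore remains to pay for the constants.
    set s := 2 * K + 2 with hs
    refine ⟨2 * (4 * K + 3 / 2 + K * |Real.log s|), by positivity, ?_⟩
    set M := 2 * (4 * K + 3 / 2 + K * |Real.log s|) with hM
    have hM0 : 0 ≤ M := by positivity
    have hs0 : 0 < s := by positivity
    have h1 : Real.log (M + 3) = Real.log ((M + 3) / s) + Real.log s := by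
      rw [← Real.log_mul (by positivity) hs0.ne', div_mul_cancel₀ _ hs0.ne']
    have h2 := Real.log_le_sub_one_of_pos (show 0 < (M + 3) / s by positivity)
    have h3 : K * ((M + 3) / s) ≤ (M + 3) / 2 := by
      rw [mul_div_assoc', div_le_div_iff₀ hs0 two_pos]
      nlinarith
    have h4 := mul_le_mul_of_nonneg_left (le_abs_self (Real.log s)) hK
    rw [h1]
    nlinarith
  refine ⟨M + 3, by linarith, fun ε hε hε1 => ?_⟩
  have hl : 0 ≤ Real.log (1 / ε) := Real.log_nonneg (by rw [le_div_iff₀ hε]; linarith)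
  set L := 1 + Real.log (1 / ε) with hL
  have hL1 : 1 ≤ L := by linarith
  have he2 : 1 ≤ 1 / ε ^ 2 := by
    rw [le_div_iff₀ (by positivity)]
    nlinarith
  have hpos : 0 ≤ M * (1 / ε ^ 2) * L := by positivity
  have hT : ((⌈M * (1 / ε ^ 2) * L⌉₊ + 2 : ℕ) : ℝ) ≤ (M + 3) * (1 / ε ^ 2) * L := by
    have h1 := Nat.ceil_lt_add_one hpos
    have h2 : 1 ≤ 1 / ε ^ 2 * L := one_le_mul_of_one_le_of_one_le he2 hL1
    push_cast
    nlinarith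
  -- The summand 2 ensures that at least one inner call takes place, which provides an actual dual
  -- starting point.
  refine ⟨⌈M * (1 / ε ^ 2) * L⌉₊ + 2, by omega, ?_, hT⟩
  have hlog : Real.log ((⌈M * (1 / ε ^ 2) * L⌉₊ + 2 : ℕ) : ℝ)
      ≤ Real.log (M + 3) + 2 * Real.log (1 / ε) + (L - 1) := by
    refine (Real.log_le_log (by positivity) hT).trans ?_
    rw [Real.log_mul (by positivity) (by positivity), Real.log_mul (by positivity) (by positivity)]
    have h1 : Real.log (1 / ε ^ 2) = 2 * Real.log (1 / ε) := by
      rw [← one_div_pow, Real.log_pow]; norm_num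
    have h2 := Real.log_le_sub_one_of_pos (show 0 < L by linarith)
    linarith
  have hlM : 0 ≤ Real.log (M + 3) := Real.log_nonneg (by linarith)
  have h1 : K * (1 + Real.log ((⌈M * (1 / ε ^ 2) * L⌉₊ + 2 : ℕ) : ℝ)) ≤ M * L := by
    calc _ ≤ K * ((4 + Real.log (M + 3)) * L) := by
          refine mul_le_mul_of_nonneg_left ?_ hK
          nlinarith
      _ ≤ M * L := by
          rw [← mul_assoc]
          exact mul_le_mul_of_nonneg_right hKM (by linarith)
  refine h1.trans ?_
  have h2 := Nat.le_ceil (M * (1 / ε ^ 2) * L)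
  have h3 : M * L = M * (1 / ε ^ 2) * L * ε ^ 2 := by field_simp
  rw [h3]
  refine mul_le_mul_of_nonneg_right ?_ (by positivity)
  push_cast
  linarith

end Rate

/-! ### Stability of the inner maximizers in case D2. -/

section Stability

variable {p : ℕ} {F Ξ : Type*} [NormedAddCommGroup F] [NormedSpace ℝ F] {ρ μ : ℝ}
  {P : Problem p F Ξ}

/-- As `f(x, ·)` is linear, maximality of `f(x, ·) - r` is a subgradient inequality for `r`, and
strong convexity can be used with this subgradient. -/
theorem mem_frechetSubdiff_of_isMaxOn (hW : WeaklyConvexConcave P ρ μ)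
    {C : EuclideanSpace ℝ (Fin p) → StrongDual ℝ F} (hC : ∀ x y, P.f x y = C x y) {x : EuclideanSpace ℝ (Fin p)} {y : F} (hy : y ∈ P.Y)
    (hmax : IsMaxOn (fun z => P.f x z - (P.r z).toReal) P.Y y) : C x ∈ frechetSubdiff P.r y := by
  refine mem_frechetSubdiff_of_le (hW.r_closed_convex.coe_toReal hy).symm fun z hz => ?_
  rw [← hW.r_closed_convex.coe_toReal hz, EReal.coe_le_coe_iff]
  have := hmax (show z ∈ P.Y from hz)
  simp only [Set.mem_ofPred_eq, hC] at this
  rw [map_sub]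
  linarith

/-- The maximizers of `f(x, ·) - r` depend Lipschitz continuously on `x`. -/
theorem dist_isMaxOn_le [FiniteDimensional ℝ F] (hW : WeaklyConvexConcave P ρ μ) (hμ : 0 < μ)
    {C : EuclideanSpace ℝ (Fin p) → StrongDual ℝ F} (hC : ∀ x y, P.f x y = C x y) {Mc : ℝ}
    (hlip : ∀ x ∈ P.X, ∀ x' ∈ P.X, ‖C x - C x'‖ ≤ Mc * ‖x - x'‖) {x x' : EuclideanSpace ℝ (Fin p)} (hx : x ∈ P.X)
    (hx' : x' ∈ P.X) {y y' : F} (hy : y ∈ P.Yo) (hy' : y' ∈ P.Y)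
    (hmax : IsMaxOn (fun z => P.f x z - (P.r z).toReal) P.Y y)
    (hmax' : P.f x' y - (P.r y).toReal ≤ P.f x' y' - (P.r y').toReal) :
    ‖y' - y‖ ≤ 2 * Mc / μ * ‖x - x'‖ ∧ P.V y' y ≤ 2 * Mc ^ 2 / μ ^ 2 * ‖x - x'‖ ^ 2 := by
  have h1 := hW.r_strong y' hy' y hy _ (mem_frechetSubdiff_of_isMaxOn hW hC hy.1 hmax)
  have h2 := hW.dgf.half_sq_le_bregman hy' hy
  have h3 : (C x' - C x) (y' - y) ≤ Mc * ‖x - x'‖ * ‖y' - y‖ := by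
    refine (le_abs_self _).trans (((C x' - C x).le_opNorm _).trans ?_)
    rw [norm_sub_rev x x']
    exact mul_le_mul_of_nonneg_right (hlip _ hx' _ hx) (norm_nonneg _)
  rw [hC, hC] at hmax'
  have h4 : μ * P.V y' y ≤ Mc * ‖x - x'‖ * ‖y' - y‖ := by
    simp only [Problem.V]
    simp only [sub_apply, map_sub] at h1 h3
    linarith
  have h0 : 0 ≤ Mc * ‖x - x'‖ := (norm_nonneg _).trans (hlip _ hx _ hx')
  have h5 : ‖y' - y‖ ≤ 2 * Mc / μ * ‖x - x'‖ := by
    have h6 : μ * ‖y' - y‖ ^ 2 ≤ 2 * (Mc * ‖x - x'‖) * ‖y' - y‖ := by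
      simp only [Problem.V] at h4
      nlinarith
    rcases (norm_nonneg (y' - y)).eq_or_lt with h7 | h7
    · rw [← h7]
      have : 2 * Mc / μ * ‖x - x'‖ = 2 * (Mc * ‖x - x'‖) / μ := by ring
      rw [this]
      positivity
    · have h8 : μ * ‖y' - y‖ ≤ 2 * (Mc * ‖x - x'‖) :=
        le_of_mul_le_mul_right (by linarith [sq ‖y' - y‖]) h7
      rw [div_mul_eq_mul_div, le_div_iff₀ hμ]
      linarith
  refine ⟨h5, ?_⟩
  have h6 : μ * P.V y' y ≤ Mc * ‖x - x'‖ * (2 * Mc / μ * ‖x - x'‖) :=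
    h4.trans (mul_le_mul_of_nonneg_left h5 h0)
  have h7 : Mc * ‖x - x'‖ * (2 * Mc / μ * ‖x - x'‖)
      = μ * (2 * Mc ^ 2 / μ ^ 2 * ‖x - x'‖ ^ 2) := by field_simp
  exact le_of_mul_le_mul_left (h6.trans h7.le) hμ

end Stability

/-! ### Verification of the contraction in the two cases. -/

section Cases

variable {p : ℕ} {F Ξ : Type*} [NormedAddCommGroup F] [NormedSpace ℝ F]
  [FiniteDimensional ℝ F] [MeasurableSpace F] [BorelSpace F] [MeasurableSpace Ξ]
  {ρ μ Mx My Qg Qr : ℝ}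

local notation "𝔼" => EuclideanSpace ℝ (Fin p)

theorem nearlyStationary_caseD1 {P : Problem p F Ξ} {ν : Measure Ξ} {Dx Dy : ℝ} (hρ : 0 < ρ)
    (hMx : 0 < Mx) (hMy : 0 < My) (hDx : 0 < Dx) (hDy : 0 < Dy)
    (hW : WeaklyConvexConcave P ρ 0) (hO : StochasticOracle P ν Mx My Qg Qr)
    (hD : CaseD1 P Dx Dy) {x₀ : 𝔼} (hx₀ : x₀ ∈ P.X) {Δ : ℝ}
    (hΔ : P.psi x₀ ≤ (⨅ x, P.psi x) + (Δ : EReal)) {Ω : Type*} [MeasurableSpace Ω]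
    {Pr : Measure Ω} [IsProbabilityMeasure Pr] {T : ℕ} (hT : 2 ≤ T) {ξ : ℕ → ℕ → Ω → Ξ}
    {τ : Ω → Fin T} {u : Ω → ℕ → State p F} (hS : IsSampling Pr ν T ξ τ)
    (hP : ∀ ω, IsPGSMD1 P (1 / (2 * ρ)) Mx My Dx Dy T x₀ (fun t j => ξ t j ω) (u ω)) {ε : ℝ}
    (hε : 12 * ρ * (|Δ| + (Dx * Mx + Dy * My + 2 * |Qg| + 2 * |Qr|)) * (1 + Real.log T)
      ≤ T * ε ^ 2) :
    NearlyStationary Pr P.psi (1 / (2 * ρ)) ε (fun ω => (u ω (τ ω)).x) := by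
  have hX := hW.g_closed_convex.isClosed_effDom hO.g_osc
  have hYc := hW.r_closed_convex.isClosed_effDom hO.r_osc
  obtain ⟨ω₀⟩ := nonempty_of_isProbabilityMeasure Pr
  obtain ⟨⟨-, hmin⟩, hyo, -⟩ := (hP ω₀).2.2 0 hT
  set ybar := (u ω₀ 0).y
  have hybar : ybar ∈ P.Y := hyo.1
  -- At the minimizer of `d` the zero functional is a subgradient, so the selected gradient is
  -- nonnegative in directions into `Y`. Consequently `V(·, ybar)` is at most the range of `d`, and
  -- `Y` is bounded.
  have hζ : ∀ y ∈ P.Y, 0 ≤ P.dGrad ybar (y - ybar) := fun y hy => by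
    simpa using hW.dgf.subgradient_le_gradient hy hyo (ζ := 0) fun z hz => by simpa using hmin hz
  have hV : ∀ y ∈ P.Y, P.V y ybar ≤ P.d y - P.d ybar := fun y hy => by
    have := hζ y hy
    simp only [Problem.V, bregman]
    linarith
  have hY : IsCompact P.Y := by
    refine isCompact_of_sq_le hYc (y₀ := ybar) (a := Dy ^ 2 / 2) (b := 0) (c := 1 / 2) le_rfl
      (by norm_num) fun y hy => ?_
    have h1 := hW.dgf.half_sq_le_bregman hy hyo
    have h2 := hV y hy
    have h3 := hD.range_d y hy ybar hybar
    simp only [Problem.V] at h2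
    linarith
  have hsqrt : ∀ t : ℕ, √(((t + 2) ^ 2 : ℕ) : ℝ) = (t : ℝ) + 2 := fun t => by
    push_cast
    exact Real.sqrt_sq (by positivity)
  set c := Dx * Mx + Dy * My + 2 * |Qg| + 2 * |Qr| with hc
  have hc0 : 0 ≤ c := by positivity
  -- With `s = t + 2` and `j_t = s²`, the step sizes make the initial potential and the accumulated
  -- noise both `O(s)`, giving the error `c / (ρ s)`. The squared distance itself has the factor `1
  -- / s² ≤ 1 / 4`, below `θ = 1 / 2`.
  refine nearlyStationary_of_contraction hW hO hρ hX hY (by omega)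
    (fun t => by rw [hsqrt]; positivity) (fun t => by rw [hsqrt]; positivity)
    (fun t => by positivity) (Ybar := fun _ => ybar) continuousOn_const ?_ (θ := 1 / 2)
    (δ := fun t => c / ρ * (1 / ((t : ℝ) + 2))) (by norm_num) (by norm_num)
    (fun t => by positivity) ?_ hx₀ hΔ hS hP ?_
  · rintro x - y - ⟨hy, hymin⟩
    have h1 := hW.dgf.half_sq_le_bregman hy hyo
    have h2 := hV y hy
    have h3 := hymin hybar
    simp only [Problem.V, Set.mem_ofPred_eq] at h2 h3
    have h4 : ‖y - ybar‖ ^ 2 ≤ 0 := by linarith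
    exact sub_eq_zero.1 (norm_eq_zero.1 (pow_eq_zero_iff two_ne_zero |>.1
      (le_antisymm h4 (sq_nonneg _))))
  · intro t x hx _ xd hxd yd hyd _
    rw [hsqrt]
    have hs : (2 : ℝ) ≤ (t : ℝ) + 2 := by linarith [(Nat.cast_nonneg t : (0 : ℝ) ≤ t)]
    push_cast
    set s := (t : ℝ) + 2
    have hs0 : 0 < s := by linarith
    have ha : ‖x - xd‖ ^ 2 ≤ Dx ^ 2 :=
      pow_le_pow_left₀ (norm_nonneg _) (hD.diam_X x hx xd hxd) 2
    have hb : P.V yd ybar ≤ Dy ^ 2 / 2 := by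
      linarith [hV yd hyd, hD.range_d yd hyd ybar hybar]
    have ha0 : 0 ≤ ‖x - xd‖ ^ 2 := sq_nonneg _
    set a := ‖x - xd‖ ^ 2
    have e1 : 1 / (2 * (Dx / (Mx * s))) * a ≤ Dx * Mx * s / 2 := by
      calc _ = Mx * s / (2 * Dx) * a := by field_simp
        _ ≤ Mx * s / (2 * Dx) * Dx ^ 2 := by gcongr
        _ = _ := by field_simp
    have e2 : 1 / (Dy / (My * s)) * P.V yd ybar ≤ Dy * My * s / 2 := by
      calc _ = My * s / Dy * P.V yd ybar := by field_simp
        _ ≤ My * s / Dy * (Dy ^ 2 / 2) := by gcongr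
        _ = _ := by field_simp
    have e3 : s ^ 2 * (Dx / (Mx * s) / 2 * Mx ^ 2 + Dy / (My * s) / 2 * My ^ 2)
        = Dx * Mx * s / 2 + Dy * My * s / 2 := by field_simp
    have e4 : 2 * Qg + 2 * Qr ≤ (2 * |Qg| + 2 * |Qr|) * s := by
      nlinarith [le_abs_self Qg, le_abs_self Qr, abs_nonneg Qg, abs_nonneg Qr]
    rw [e3]
    calc _ ≤ 1 / s ^ 2 * (a + 1 / ρ * (c * s)) := by
          refine mul_le_mul_of_nonneg_left (add_le_add le_rfl
            (mul_le_mul_of_nonneg_left ?_ (by positivity))) (by positivity)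
          rw [hc]
          linarith
      _ = 1 / s ^ 2 * a + c / ρ * (1 / s) := by field_simp
      _ ≤ _ := by
          gcongr
          nlinarith
  · rw [← Finset.mul_sum]
    have h1 := sum_inv_add_two_le hT
    have h2 : ρ * (c / ρ * ∑ t ∈ Finset.range (T - 1), 1 / ((t : ℝ) + 2))
        ≤ c * (1 + Real.log T) := by
      rw [← mul_assoc, mul_div_cancel₀ _ hρ.ne']
      gcongr
    have h3 : 0 ≤ Real.log T := Real.log_natCast_nonneg T
    have h4 : Δ ≤ |Δ| * (1 + Real.log T) := by
      nlinarith [le_abs_self Δ, abs_nonneg Δ]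
    refine le_trans ?_ hε
    calc _ = 8 * ρ * (Δ + ρ * (c / ρ * ∑ t ∈ Finset.range (T - 1), 1 / ((t : ℝ) + 2))) := by
          field_simp; ring
      _ ≤ 8 * ρ * (|Δ| * (1 + Real.log T) + c * (1 + Real.log T)) := by gcongr
      _ ≤ 12 * ρ * (|Δ| * (1 + Real.log T) + c * (1 + Real.log T)) := by gcongr; norm_num
      _ = _ := by ring

theorem nearlyStationary_caseD2 {n : ℕ} {P : Problem p F (Fin n)} {ν : Measure (Fin n)} {Mc : ℝ}
    {c : Fin n → 𝔼 → StrongDual ℝ F} (hρ : 0 < ρ) (hμ : 0 < μ) (hMc : 0 < Mc)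
    (hW : WeaklyConvexConcave P ρ μ) (hO : StochasticOracle P ν Mx My Qg Qr)
    (hD : CaseD2 P ρ Mc c) {x₀ : 𝔼} (hx₀ : x₀ ∈ P.X) {Δ : ℝ}
    (hΔ : P.psi x₀ ≤ (⨅ x, P.psi x) + (Δ : EReal)) {Ω : Type*} [MeasurableSpace Ω]
    {Pr : Measure Ω} [IsProbabilityMeasure Pr] {T : ℕ} (hT : 2 ≤ T) {ξ : ℕ → ℕ → Ω → Fin n}
    {τ : Ω → Fin T} {u : Ω → ℕ → State p F} (hS : IsSampling Pr ν T ξ τ)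
    (hP : ∀ ω, IsPGSMD2 P (1 / (2 * ρ)) ρ μ Mc n T x₀ (fun t j => ξ t j ω) (u ω)) {ε : ℝ}
    (hε : 12 * ρ * (|Δ| + (2 * |Qg| + 2 * |Qr| + 30 * Mx ^ 2 / ρ + 2 * Mc ^ 2 * My ^ 2 /
      (ρ * μ ^ 2))) * (1 + Real.log T) ≤ T * ε ^ 2) :
    NearlyStationary Pr P.psi (1 / (2 * ρ)) ε (fun ω => (u ω (τ ω)).x) := by
  have hX := hW.g_closed_convex.isClosed_effDom hO.g_osc
  have hYc := hW.r_closed_convex.isClosed_effDom hO.r_osc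
  obtain ⟨C, hC, hlip⟩ : ∃ C : 𝔼 → StrongDual ℝ F, (∀ x y, P.f x y = C x y) ∧
      ∀ x ∈ P.X, ∀ x' ∈ P.X, ‖C x - C x'‖ ≤ Mc * ‖x - x'‖ :=
    ⟨fun x => (1 / (n : ℝ)) • ∑ i, c i x, fun x y => by simp [hD.f_eq], hD.lipschitz⟩
  obtain ⟨ω₀⟩ := nonempty_of_isProbabilityMeasure Pr
  obtain ⟨⟨hy₀, hmax₀⟩, hyo, -⟩ := (hP ω₀).2.2 0 hT
  set y₀ := (u ω₀ 0).y
  have hY : IsCompact P.Y := by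
    -- Strong convexity of `r` at `y₀` forces quadratic growth along `Y`, against an oscillation of
    -- at most `Qr` and a linear term.
    refine isCompact_of_sq_le hYc (y₀ := y₀) (a := Qr) (b := ‖C (u ω₀ 0).x‖) (c := μ / 2)
      (norm_nonneg _) (by positivity) fun y hy => ?_
    have h1 := hW.r_strong y hy y₀ hyo _ (mem_frechetSubdiff_of_isMaxOn hW hC hy₀ hmax₀)
    have h2 := hW.dgf.half_sq_le_bregman hy hyo
    have h3 := hO.r_osc y hy y₀ hy₀
    have h4 := (abs_le.1 ((C (u ω₀ 0).x).le_opNorm (y - y₀))).1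
    nlinarith
  choose Ybar hYbarY hYbar using fun x => hW.exists_isMaxOn hY x
  have hηx : ∀ t : ℕ, 60 / (ρ * (((t + 32 : ℕ) : ℝ) - 30)) = 60 / (ρ * ((t : ℝ) + 2)) := fun t => by
    push_cast
    ring_nf
  set K := 2 * |Qg| + 2 * |Qr| + 30 * Mx ^ 2 / ρ + 2 * Mc ^ 2 * My ^ 2 / (ρ * μ ^ 2) with hK
  have hK0 : 0 ≤ K := by positivity
  -- With `s = t + 2` one has `j_t = s + 30`. The divergence term contributes `1 / 2` to the
  -- contraction factor, and the remaining terms `(1 + s / 120) / (s + 30) ≤ 1 / 30`; the sum is `θ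
  -- = 8 / 15`.
  refine nearlyStationary_of_contraction hW hO hρ hX hY (by omega)
    (fun t => by rw [hηx]; positivity) (fun t => by positivity)
    (fun t => by positivity) (Ybar := Ybar) ?_ ?_ (θ := 8 / 15)
    (δ := fun t => K / ρ * (1 / ((t : ℝ) + 2))) (by norm_num) (by norm_num)
    (fun t => by positivity) ?_ hx₀ hΔ hS hP ?_
  · refine (LipschitzOnWith.of_dist_le_mul (K := ⟨2 * Mc / μ, by positivity⟩) ?_).continuousOn
    rintro x ⟨hx, hxo⟩ x' ⟨hx', -⟩
    rw [dist_eq_norm, dist_eq_norm, norm_sub_rev]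
    exact (dist_isMaxOn_le hW hμ hC hlip hx hx' hxo (hYbarY x') (hYbar x)
      (hYbar x' _ (hYbarY x))).1
  · rintro x hx y hyo ⟨hy, hymax⟩
    have h1 := (dist_isMaxOn_le hW hμ hC hlip hx hx hyo (hYbarY x) hymax (hYbar x y hy)).1
    rw [sub_self, norm_zero, mul_zero] at h1
    exact (sub_eq_zero.1 (norm_le_zero_iff.1 h1)).symm
  · intro t x hx hxo xd hxd yd hyd hmax
    have hV := (dist_isMaxOn_le hW hμ hC hlip hx hxd hxo hyd (hYbar x) (hmax _ (hYbarY x))).2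
    rw [hηx]
    have hs : (2 : ℝ) ≤ (t : ℝ) + 2 := by linarith [(Nat.cast_nonneg t : (0 : ℝ) ≤ t)]
    have hJ : ((t + 32 : ℕ) : ℝ) = (t : ℝ) + 2 + 30 := by push_cast; ring
    rw [hJ]
    set s := (t : ℝ) + 2
    have hs0 : 0 < s := by linarith
    have ha0 : 0 ≤ ‖x - xd‖ ^ 2 := sq_nonneg _
    set a := ‖x - xd‖ ^ 2
    have e1 : 1 / (2 * (60 / (ρ * s))) * a = ρ * s / 120 * a := by field_simp; ring
    have e2 : 1 / (8 * Mc ^ 2 * (1 / (2 * ρ)) / (μ ^ 2 * (s + 30))) * P.V yd (Ybar x)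
        ≤ ρ * (s + 30) / 2 * a := by
      calc _ = ρ * μ ^ 2 * (s + 30) / (4 * Mc ^ 2) * P.V yd (Ybar x) := by field_simp; ring
        _ ≤ ρ * μ ^ 2 * (s + 30) / (4 * Mc ^ 2) * (2 * Mc ^ 2 / μ ^ 2 * a) := by gcongr
        _ = _ := by field_simp; ring
    have e3 : (s + 30) * (60 / (ρ * s) / 2 * Mx ^ 2
        + 8 * Mc ^ 2 * (1 / (2 * ρ)) / (μ ^ 2 * (s + 30)) / 2 * My ^ 2)
        = (s + 30) * (30 * Mx ^ 2 / ρ) / s + 2 * Mc ^ 2 * My ^ 2 / (ρ * μ ^ 2) := by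
      field_simp; ring
    have e4 : 2 * Qg + 2 * Qr ≤ 2 * |Qg| + 2 * |Qr| := by
      linarith [le_abs_self Qg, le_abs_self Qr]
    have e5 : 2 * |Qg| + 2 * |Qr| + 2 * Mc ^ 2 * My ^ 2 / (ρ * μ ^ 2)
        ≤ (s + 30) * (2 * |Qg| + 2 * |Qr| + 2 * Mc ^ 2 * My ^ 2 / (ρ * μ ^ 2)) / s := by
      rw [le_div_iff₀ hs0, mul_comm]
      gcongr
      linarith
    rw [e1, e3]
    calc _ ≤ 1 / (s + 30) * (a + 1 / ρ * (ρ * s / 120 * a + ρ * (s + 30) / 2 * a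
          + (s + 30) * K / s)) := by
          refine mul_le_mul_of_nonneg_left (add_le_add le_rfl
            (mul_le_mul_of_nonneg_left ?_ (by positivity))) (by positivity)
          rw [hK]
          have : (s + 30) * (2 * |Qg| + 2 * |Qr| + 30 * Mx ^ 2 / ρ
              + 2 * Mc ^ 2 * My ^ 2 / (ρ * μ ^ 2)) / s
            = (s + 30) * (30 * Mx ^ 2 / ρ) / s
              + (s + 30) * (2 * |Qg| + 2 * |Qr| + 2 * Mc ^ 2 * My ^ 2 / (ρ * μ ^ 2)) / s := by
            ring
          rw [this]
          linarith
      _ = (1 + s / 120) / (s + 30) * a + 1 / 2 * a + K / ρ * (1 / s) := by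
          field_simp
          ring
      _ ≤ 1 / 30 * a + 1 / 2 * a + K / ρ * (1 / s) := by
          have : (1 + s / 120) / (s + 30) ≤ 1 / 30 := by
            rw [div_le_div_iff₀ (by positivity) (by norm_num)]
            linarith
          gcongr
      _ = _ := by ring
  · rw [← Finset.mul_sum]
    have h1 := sum_inv_add_two_le hT
    have h2 : ρ * (K / ρ * ∑ t ∈ Finset.range (T - 1), 1 / ((t : ℝ) + 2))
        ≤ K * (1 + Real.log T) := by
      rw [← mul_assoc, mul_div_cancel₀ _ hρ.ne']
      gcongr
    have h3 : 0 ≤ Real.log T := Real.log_natCast_nonneg T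
    have h4 : Δ ≤ |Δ| * (1 + Real.log T) := by
      nlinarith [le_abs_self Δ, abs_nonneg Δ]
    refine le_trans ?_ hε
    -- The factor is `4 / (1 - 8 / 15) = 60 / 7`.
    calc _ = 60 / 7 * ρ * (Δ + ρ * (K / ρ * ∑ t ∈ Finset.range (T - 1), 1 / ((t : ℝ) + 2))) := by
          field_simp; ring
      _ ≤ 60 / 7 * ρ * (|Δ| * (1 + Real.log T) + K * (1 + Real.log T)) := by gcongr
      _ ≤ 12 * ρ * (|Δ| * (1 + Real.log T) + K * (1 + Real.log T)) := by gcongr; norm_num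
      _ = _ := by ring

end Cases

/-! ### Counting stochastic subgradients. -/

theorem iteration_bounds {B ε : ℝ} (hB : 1 ≤ B) (hε : 0 < ε) (hε1 : ε ≤ 1) {T : ℕ}
    (hT : (T : ℝ) ≤ B * (1 / ε ^ 2) * (1 + Real.log (1 / ε))) :
    (T : ℝ) ≤ 34 * B ^ 3 * (1 / ε ^ 2) * (1 + Real.log (1 / ε)) ^ 3 ∧
    (T : ℝ) ^ 3 ≤ 34 * B ^ 3 * (1 / ε ^ 6) * (1 + Real.log (1 / ε)) ^ 3 ∧
    ∀ n : ℕ, (T * n + 33 * T ^ 2 : ℝ)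
      ≤ 34 * B ^ 3 * (n * (1 / ε ^ 2) + 1 / ε ^ 4) * (1 + Real.log (1 / ε)) ^ 3 := by
  have hl : 0 ≤ Real.log (1 / ε) := Real.log_nonneg (by rw [le_div_iff₀ hε]; linarith)
  have h1L : 1 ≤ 1 + Real.log (1 / ε) := by linarith
  generalize 1 + Real.log (1 / ε) = L at *
  have hL0 : 0 ≤ L := by linarith
  have hBL : 1 ≤ B * L := one_le_mul_of_one_le_of_one_le hB h1L
  have hT0 : (0 : ℝ) ≤ T := by positivity
  -- As `B L ≥ 1`, its first and second powers are dominated by the cube, so one constant and one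
  -- logarithmic exponent serve all three bounds.
  have h1 : B * L ≤ B ^ 3 * L ^ 3 := by
    rw [← mul_pow]
    exact le_self_pow₀ hBL (by norm_num)
  have h2 : (B * L) ^ 2 ≤ B ^ 3 * L ^ 3 := by
    rw [← mul_pow]
    exact pow_le_pow_right₀ hBL (by norm_num)
  have h3 : (T : ℝ) ≤ 1 / ε ^ 2 * (B ^ 3 * L ^ 3) := by
    refine hT.trans ?_
    calc _ = 1 / ε ^ 2 * (B * L) := by ring
      _ ≤ _ := by gcongr
  have h4 : (T : ℝ) ^ 2 ≤ 1 / ε ^ 4 * (B ^ 3 * L ^ 3) := by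
    refine (pow_le_pow_left₀ hT0 hT 2).trans ?_
    calc _ = 1 / ε ^ 4 * (B * L) ^ 2 := by field_simp
      _ ≤ _ := by gcongr
  have h5 : (T : ℝ) ^ 3 ≤ 1 / ε ^ 6 * (B ^ 3 * L ^ 3) := by
    refine (pow_le_pow_left₀ hT0 hT 3).trans (le_of_eq ?_)
    field_simp
  have hB0 : 0 ≤ B := by linarith
  have p1 : 0 ≤ 1 / ε ^ 2 * (B ^ 3 * L ^ 3) := by positivity
  have p2 : 0 ≤ 1 / ε ^ 4 * (B ^ 3 * L ^ 3) := by positivity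
  have p3 : 0 ≤ 1 / ε ^ 6 * (B ^ 3 * L ^ 3) := by positivity
  refine ⟨by linarith, by linarith, fun n => ?_⟩
  have h6 := mul_le_mul_of_nonneg_right h3 (Nat.cast_nonneg (α := ℝ) n)
  have p4 := mul_nonneg p1 (Nat.cast_nonneg (α := ℝ) n)
  linarith

end WCC

/-- Complexity of PG-SMD in both cases. The constants `C`, `k` and the number `T` of outer
iterations depend only on the listed parameters (and `T` on `ε`), not on the dimensions, the
functions, the number `n` of summands or the probability space. -/
theorem theorem1 :
    (∀ ρ Mx My Dx Dy Qg Qr Δ : ℝ, 0 < ρ → 0 < Mx → 0 < My → 0 < Dx → 0 < Dy →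
      ∃ (C : ℝ) (k : ℕ), ∀ ε : ℝ, 0 < ε → ε ≤ 1 →
        ∃ T : ℕ, 1 ≤ T ∧ (T : ℝ) ≤ C * (1 / ε ^ 2) * (1 + Real.log (1 / ε)) ^ k ∧
          ∀ (p : ℕ) (F : Type*) [NormedAddCommGroup F] [NormedSpace ℝ F] [FiniteDimensional ℝ F]
            [MeasurableSpace F] [BorelSpace F] (Ξ : Type*) [MeasurableSpace Ξ]
            (ν : Measure Ξ) [IsProbabilityMeasure ν] (P : WCC.Problem p F Ξ)
            (x0 : EuclideanSpace ℝ (Fin p)),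
            WCC.WeaklyConvexConcave P ρ 0 →
            WCC.StochasticOracle P ν Mx My Qg Qr →
            WCC.CaseD1 P Dx Dy →
            x0 ∈ P.X → P.psi x0 ≤ (⨅ x, P.psi x) + (Δ : EReal) →
            ∀ (Ω : Type*) [MeasurableSpace Ω] (Pr : Measure Ω) [IsProbabilityMeasure Pr]
              (ξ : ℕ → ℕ → Ω → Ξ) (τ : Ω → Fin T) (u : Ω → ℕ → WCC.State p F),
              WCC.IsSampling Pr ν T ξ τ →
              (∀ ω, WCC.IsPGSMD1 P (1 / (2 * ρ)) Mx My Dx Dy T x0 (fun t j => ξ t j ω) (u ω)) →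
              WCC.NearlyStationary Pr P.psi (1 / (2 * ρ)) ε (fun ω => (u ω (τ ω)).x) ∧
              ∀ ω, ((u ω (T - 1)).calls : ℝ) ≤ C * (1 / ε ^ 6) * (1 + Real.log (1 / ε)) ^ k) ∧
    (∀ ρ μ Mx My Mc Qg Qr Δ : ℝ, 0 < ρ → 0 < μ → 0 < Mx → 0 < My → 0 < Mc →
      ∃ (C : ℝ) (k : ℕ), ∀ ε : ℝ, 0 < ε → ε ≤ 1 →
        ∃ T : ℕ, 1 ≤ T ∧ (T : ℝ) ≤ C * (1 / ε ^ 2) * (1 + Real.log (1 / ε)) ^ k ∧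
          ∀ (p : ℕ) (F : Type*) [NormedAddCommGroup F] [NormedSpace ℝ F] [FiniteDimensional ℝ F]
            [MeasurableSpace F] [BorelSpace F] (n : ℕ) (ν : Measure (Fin n))
            (P : WCC.Problem p F (Fin n))
            (c : Fin n → EuclideanSpace ℝ (Fin p) → StrongDual ℝ F)
            (x0 : EuclideanSpace ℝ (Fin p)),
            0 < n → (∀ i, ν {i} = (n : ENNReal)⁻¹) →
            WCC.WeaklyConvexConcave P ρ μ →
            WCC.StochasticOracle P ν Mx My Qg Qr →
            WCC.CaseD2 P ρ Mc c →
            x0 ∈ P.X → P.psi x0 ≤ (⨅ x, P.psi x) + (Δ : EReal) →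
            ∀ (Ω : Type*) [MeasurableSpace Ω] (Pr : Measure Ω) [IsProbabilityMeasure Pr]
              (ξ : ℕ → ℕ → Ω → Fin n) (τ : Ω → Fin T) (u : Ω → ℕ → WCC.State p F),
              WCC.IsSampling Pr ν T ξ τ →
              (∀ ω, WCC.IsPGSMD2 P (1 / (2 * ρ)) ρ μ Mc n T x0 (fun t j => ξ t j ω) (u ω)) →
              WCC.NearlyStationary Pr P.psi (1 / (2 * ρ)) ε (fun ω => (u ω (τ ω)).x) ∧
              ∀ ω, ((u ω (T - 1)).calls : ℝ)
                ≤ C * (n * (1 / ε ^ 2) + 1 / ε ^ 4) * (1 + Real.log (1 / ε)) ^ k) := by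
  refine ⟨fun ρ Mx My Dx Dy Qg Qr Δ hρ hMx hMy hDx hDy => ?_,
    fun ρ μ Mx My Mc Qg Qr Δ hρ hμ hMx hMy hMc => ?_⟩
  · obtain ⟨B, hB, hT⟩ := WCC.exists_iterations
      (K := 12 * ρ * (|Δ| + (Dx * Mx + Dy * My + 2 * |Qg| + 2 * |Qr|))) (by positivity)
    refine ⟨34 * B ^ 3, 3, fun ε hε hε1 => ?_⟩
    obtain ⟨T, hT2, hTε, hTB⟩ := hT ε hε hε1
    obtain ⟨hb1, hb3, -⟩ := WCC.iteration_bounds hB hε hε1 hTB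
    refine ⟨T, by omega, hb1, ?_⟩
    intro p F _ _ _ _ _ Ξ _ ν _ P x0 hW hO hD hx₀ hΔ Ω _ Pr _ ξ τ u hS hP
    refine ⟨WCC.nearlyStationary_caseD1 hρ hMx hMy hDx hDy hW hO hD hx₀ hΔ hT2 hS hP hTε,
      fun ω => le_trans ?_ hb3⟩
    have h1 := (hP ω).calls_le (t := T - 1) (by omega)
    -- The last call has `t = T - 2`, so each length is at most `T²`.
    have h2 : ∑ t ∈ Finset.range (T - 1), (t + 2) ^ 2 ≤ (T - 1) * T ^ 2 := by
      rw [← smul_eq_mul]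
      nth_rewrite 2 [← Finset.card_range (T - 1)]
      refine Finset.sum_le_card_nsmul _ _ _ fun t ht => ?_
      have := Finset.mem_range.1 ht
      exact Nat.pow_le_pow_left (by omega) 2
    have h3 : (u ω (T - 1)).calls ≤ T ^ 3 := by
      have : (T - 1) * T ^ 2 ≤ T * T ^ 2 := Nat.mul_le_mul_right _ (Nat.sub_le T 1)
      linarith [pow_succ' T 2]
    exact_mod_cast h3
  · obtain ⟨B, hB, hT⟩ := WCC.exists_iterations
      (K := 12 * ρ * (|Δ| + (2 * |Qg| + 2 * |Qr| + 30 * Mx ^ 2 / ρ + 2 * Mc ^ 2 * My ^ 2 /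
        (ρ * μ ^ 2)))) (by positivity)
    refine ⟨34 * B ^ 3, 3, fun ε hε hε1 => ?_⟩
    obtain ⟨T, hT2, hTε, hTB⟩ := hT ε hε hε1
    obtain ⟨hb1, -, hb2⟩ := WCC.iteration_bounds hB hε hε1 hTB
    refine ⟨T, by omega, hb1, ?_⟩
    intro p F _ _ _ _ _ n ν P c x0 hn hν hW hO hD hx₀ hΔ Ω _ Pr _ ξ τ u hS hP
    refine ⟨WCC.nearlyStationary_caseD2 hρ hμ hMc hW hO hD hx₀ hΔ hT2 hS hP hTε,
      fun ω => le_trans ?_ (hb2 n)⟩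
    have h1 := (hP ω).calls_le (t := T - 1) (by omega)
    have h2 : ∑ t ∈ Finset.range (T - 1), (t + 32) ≤ (T - 1) * (T + 32) := by
      rw [← smul_eq_mul]
      nth_rewrite 2 [← Finset.card_range (T - 1)]
      refine Finset.sum_le_card_nsmul _ _ _ fun t ht => ?_
      have := Finset.mem_range.1 ht
      omega
    -- `T + 32 ≤ 33 T` because `T ≥ 1`; the term `T n` counts the exact maximizations.
    have h3 : (u ω (T - 1)).calls ≤ T * n + 33 * T ^ 2 := by
      have h4 : (T - 1) * (T + 32) ≤ T * (T + 32) := Nat.mul_le_mul_right _ (Nat.sub_le T 1)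
      have h5 : (T - 1) * n ≤ T * n := Nat.mul_le_mul_right _ (Nat.sub_le T 1)
      nlinarith
    exact_mod_cast h3
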